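/- **Conventions.** Let $E\ge 1$, $C\ge 0$. An $(E,C)$-geodesic coarsely convex bicombing on a metric space $(X,d)$ is a map $\gamma\colon X\times X\times[0,1]\to X$ with $\gamma(x,y,0)=x$, $\gamma(x,y,1)=y$, $d(\gamma(x,y,t),\gamma(x,y,s))=|t-s|\,d(x,y)$, such that for all $x_1,x_2,y_1,y_2\in X$ and $a,b,c\in[0,1]$ $$d(\gamma(x_1,y_1,ca),\gamma(x_2,y_2,cb))\le (1-c)E\,d(x_1,x_2)+cE\,d(\gamma(x_1,y_1,a),\gamma(x_2,y_2,b))+C.$$ A geodesic coarsely convex space is a metric space with such a bicombing. Write $\hat\gamma(x,y,t)=\gamma(x,y,t/d(x,y))$ for $t\le d(x,y)$ and $\hat\gamma(x,y,t)=y$ for $t>d(x,y)$. Fix a base point $e\in X$, put $D_1=2(2(1+E)+C)+2$ and $$(x\mid y)_e=\min\{d(e,x),\,d(e,y),\,\sup\{t\ge 0: d(\hat\gamma(e,x,t),\hat\gamma(e,y,t))\le D_1\}\}.$$ The ideal boundary $\partial X$ is the set of sequences $(x_i)$ in $X$ with $(x_i\mid x_j)_e\to\infty$ as $i,j\to\infty$,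 modulo $(x_i)\sim(y_i)$ iff $(x_i\mid y_i)_e\to\infty$. For $\xi,\eta\in \overline X=X\cup\partial X$ let $(\xi\mid\eta)$ be the supremum of $\liminf_i (x_i\mid y_i)_e$ over the sequences representing $\xi$ and $\eta$ (a point of $X$ is represented only by its constant sequence). For $n\geq 1$ let $V_n$ be the set of all $(\xi,\eta)\in\overline X\times\overline X$ with $(\xi\mid\eta)>n$, together with all $(x,y)\in X\times X$ with $d(x,y)<1/n$. The sets $V_n[\xi]=\{\eta:(\xi,\eta)\in V_n\}$, $n\ge 1$, are a neighbourhood base at $\xi$, and $\partial X$ has the subspace topology of $\overline X$. A net of $X$ is a set $X_0$ with a map $i_X\colon X_0\to X$ that is proper for the discrete topology on $X_0$, and a base point $e_X=i_X(\varepsilon_X)$ with $\varepsilon_X\in X_0$. For spaces $X,Y$ with nets, the free product $X*Y$ is the tree of spaces built of copies (sheets) of $X$ and of $Y$ and of edges of length one, with its path metric: to a first sheet, a copy of $X$, one attaches for each $a\in X_0$ an edge from $i_X(a)$ to the base point $e_Y$ of a new copy of $Y$; to this copy one attaches for each $b\in Y_0\setminus\{\varepsilon_Y\}$ an edge from $i_Y(b)$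 to the base point $e_X$ of a new copy of $X$; to that copy one attaches in the same way a copy of $Y$ for each $a\in X_0\setminus\{\varepsilon_X\}$; and so on. Given bicombings $\gamma_X,\gamma_Y$, the associated bicombing on $X*Y$ joins two points by the path that runs along the edges and follows, in each sheet that it meets, $\gamma_X$ resp. $\gamma_Y$ from the point where it starts in or enters the sheet to the point where it ends in or leaves it, parametrised proportionally to arc length. $\dim$ is the covering dimension (by finite open covers), with $\dim\emptyset=-1$ and with value $\infty$ allowed. **Theorem.** Let $X$ and $Y$ be geodesic coarsely convex spaces with nets. The associated bicombing on $X*Y$ is $(E,C)$-geodesic coarsely convex for some $E\ge1$, $C\ge0$. If $\partial X$ and $\partial Y$ are not both empty, then $$\dim\partial(X*Y)=\max\{\dim\partial X,\ \dim\partial Y\},$$ where $\partial(X*Y)$ is formed with the associated bicombing, for any such constants $E,C$, and the three base points are arbitrary. -/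

import Mathlib

open Filter Topology
open scoped ENNReal

universe u v

noncomputable section

/-! ## Geodesic coarsely convex bicombings -/

/-- An `(E, C)`-geodesic coarsely convex bicombing on a metric space `X`. -/
structure GCCBicombing (X : Type u) [MetricSpace X] where
  /-- the map `γ : X × X × [0,1] → X` -/
  toFun : X → X → unitInterval → X
  E : ℝ
  C : ℝ
  one_le_E : 1 ≤ E
  C_nonneg : 0 ≤ C
  map_zero : ∀ x y, toFun x y 0 = x
  map_one : ∀ x y, toFun x y 1 = y
  geodesic : ∀ x y (s t : unitInterval),
    dist (toFun x y t) (toFun x y s) = |(t : ℝ) - s| * dist x y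
  convex : ∀ (x₁ x₂ y₁ y₂ : X) (a b c : unitInterval),
    dist (toFun x₁ y₁ (c * a)) (toFun x₂ y₂ (c * b)) ≤
      (1 - (c : ℝ)) * E * dist x₁ x₂ + c * E * dist (toFun x₁ y₁ a) (toFun x₂ y₂ b) + C

/-- The reparametrisation `(x, y, t) ↦ γ(x, y, t / d(x,y))` for `0 ≤ t ≤ d(x,y)`, constantly equal
to `y` for `t > d(x,y)`. -/
def reparam {X : Type u} [MetricSpace X] (γ : X → X → unitInterval → X) (x y : X) (t : ℝ) : X :=
  γ x y (Set.projIcc 0 1 zero_le_one (t / dist x y))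

namespace GCCBicombing

variable {X : Type u} [MetricSpace X] (γ : GCCBicombing X)

/-- The constant `D₁ = 2 D + 2`, with `D = 2 (1 + E) k₁ + C`, where `k₁ = 1` because the bicombing
is geodesic (`λ = 1` and `k = 0`). -/
def D₁ : ℝ := 2 * (2 * (1 + γ.E) + γ.C) + 2

/-- The Gromov product `(x | y)_e`. It is valued in `[0, ∞]`, so that the supremum of an unbounded
set of times is `∞`; the product itself is at most `d(e,x)`. -/
def gromovProd (e x y : X) : ℝ≥0∞ :=
  min (edist e x) (min (edist e y)
    (⨆ t ∈ {t : ℝ | 0 ≤ t ∧ dist (reparam γ.toFun e x t) (reparam γ.toFun e y t) ≤ γ.D₁},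
      ENNReal.ofReal t))

theorem gromovProd_comm (e x y : X) : γ.gromovProd e x y = γ.gromovProd e y x := by
  simp only [gromovProd, dist_comm (reparam γ.toFun e x _)]
  rw [min_left_comm]

theorem reparam_of_le (x y : X) {t : ℝ} (h0 : 0 ≤ t) (h : t ≤ dist x y) :
    reparam γ.toFun x y t = γ.toFun x y ⟨t / dist x y, unitInterval.div_mem h0 dist_nonneg h⟩ := by
  unfold reparam
  rw [Set.projIcc_of_mem zero_le_one (unitInterval.div_mem h0 dist_nonneg h)]

theorem reparam_of_ge (x y : X) {t : ℝ} (h : dist x y ≤ t) :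
    reparam γ.toFun x y t = y := by
  unfold reparam
  rcases eq_or_lt_of_le (dist_nonneg (x := x) (y := y)) with h0 | h0
  · have hxy : x = y := dist_eq_zero.1 h0.symm
    subst hxy
    have := γ.geodesic x x 0 (Set.projIcc 0 1 zero_le_one (t / dist x x))
    rw [dist_self x, mul_zero, γ.map_zero] at this
    rw [dist_self x]
    exact dist_eq_zero.1 this
  · rw [Set.projIcc_of_right_le]
    · exact γ.map_one x y
    · rwa [le_div_iff₀ h0, one_mul]

theorem dist_reparam (x y : X) {s t : ℝ} (hs0 : 0 ≤ s) (hs : s ≤ dist x y) (ht0 : 0 ≤ t)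
    (ht : t ≤ dist x y) :
    dist (reparam γ.toFun x y s) (reparam γ.toFun x y t) = |s - t| := by
  rw [γ.reparam_of_le x y hs0 hs, γ.reparam_of_le x y ht0 ht, γ.geodesic]
  rcases eq_or_lt_of_le (dist_nonneg (x := x) (y := y)) with h0 | h0
  · have h1 : s = 0 := le_antisymm (h0 ▸ hs) hs0
    have h2 : t = 0 := le_antisymm (h0 ▸ ht) ht0
    simp [h1, h2]
  · simp only
    rw [← sub_div, abs_div, abs_of_pos h0, div_mul_cancel₀ _ h0.ne']

theorem reparam_zero (x y : X) : reparam γ.toFun x y 0 = x := by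
  rw [γ.reparam_of_le x y le_rfl dist_nonneg]
  convert γ.map_zero x y
  simp

/-- Before the Gromov product is reached, the two geodesics are close to each other. -/
theorem exists_time_of_lt {e x y : X} {t : ℝ} (ht : 0 ≤ t)
    (h : ENNReal.ofReal t < γ.gromovProd e x y) :
    ∃ τ, t ≤ τ ∧ τ ≤ dist e x ∧ τ ≤ dist e y ∧
      dist (reparam γ.toFun e x τ) (reparam γ.toFun e y τ) ≤ 2 * γ.D₁ := by
  simp only [gromovProd, lt_min_iff] at h
  obtain ⟨hx, hy, hs⟩ := h
  rw [edist_dist, ENNReal.ofReal_lt_ofReal_iff_of_nonneg ht] at hx hy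
  obtain ⟨t₁, hs⟩ := lt_iSup_iff.1 hs
  obtain ⟨⟨h0, hd⟩, hs⟩ := lt_iSup_iff.1 hs
  rw [ENNReal.ofReal_lt_ofReal_iff_of_nonneg ht] at hs
  have hD : 0 ≤ γ.D₁ := dist_nonneg.trans hd
  by_cases c1 : t₁ ≤ dist e x ∧ t₁ ≤ dist e y
  · exact ⟨t₁, hs.le, c1.1, c1.2, by linarith⟩
  -- a symmetric statement for the geodesic that ends first
  have key : ∀ p q : X, dist e p ≤ dist e q → dist e p ≤ t₁ →
      dist (reparam γ.toFun e p t₁) (reparam γ.toFun e q t₁) ≤ γ.D₁ →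
      dist (reparam γ.toFun e p (dist e p)) (reparam γ.toFun e q (dist e p)) ≤ 2 * γ.D₁ := by
    intro p q hpq hp hD1
    rw [γ.reparam_of_ge e p hp] at hD1
    rw [γ.reparam_of_ge e p le_rfl]
    set τ := min t₁ (dist e q) with hτ
    have hτ0 : 0 ≤ τ := le_min h0 dist_nonneg
    have hpτ : dist e p ≤ τ := le_min hp hpq
    have hq : reparam γ.toFun e q t₁ = reparam γ.toFun e q τ := by
      rcases le_total t₁ (dist e q) with h | h
      · rw [hτ, min_eq_left h]
      · rw [hτ, min_eq_right h, γ.reparam_of_ge e q h, γ.reparam_of_ge e q le_rfl]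
    rw [hq] at hD1
    have h1 := γ.dist_reparam e q (s := 0) (t := τ) le_rfl dist_nonneg hτ0 (min_le_right _ _)
    rw [γ.reparam_zero, zero_sub, abs_neg, abs_of_nonneg hτ0] at h1
    have h2 := γ.dist_reparam e q (s := τ) (t := dist e p) hτ0 (min_le_right _ _) dist_nonneg hpq
    rw [abs_of_nonneg (by linarith)] at h2
    have h3 := dist_triangle e p (reparam γ.toFun e q τ)
    have h4 := dist_triangle p (reparam γ.toFun e q τ) (reparam γ.toFun e q (dist e p))
    linarith
  rcases le_total (dist e x) (dist e y) with hxy | hxy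
  · have hxt : dist e x ≤ t₁ := by
      by_contra hc
      exact c1 ⟨by linarith, by linarith⟩
    exact ⟨dist e x, hx.le, le_rfl, hxy, key x y hxy hxt hd⟩
  · have hyt : dist e y ≤ t₁ := by
      by_contra hc
      exact c1 ⟨by linarith, by linarith⟩
    refine ⟨dist e y, hy.le, hxy, le_rfl, ?_⟩
    rw [dist_comm] at hd ⊢
    exact key y x hxy hyt hd

theorem dist_reparam_le {e x y : X} {t : ℝ} (ht : 0 ≤ t)
    (h : ENNReal.ofReal t < γ.gromovProd e x y) :
    dist (reparam γ.toFun e x (t / (2 * γ.E * γ.D₁)))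
      (reparam γ.toFun e y (t / (2 * γ.E * γ.D₁))) ≤ 1 + γ.C := by
  have hE := γ.one_le_E
  have hC := γ.C_nonneg
  have hD : 1 ≤ γ.D₁ := by unfold D₁; linarith
  have hED : 1 ≤ 2 * γ.E * γ.D₁ := by nlinarith
  rcases eq_or_lt_of_le ht with rfl | ht'
  · simp only [zero_div, reparam_zero, dist_self]; linarith
  obtain ⟨τ, h1, hx, hy, h2⟩ := γ.exists_time_of_lt ht h
  have hτ : 0 < τ := lt_of_lt_of_le ht' h1
  have hsτ : t / (2 * γ.E * γ.D₁) ≤ τ := (div_le_self ht hED).trans h1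
  have hs0 : 0 ≤ t / (2 * γ.E * γ.D₁) := by positivity
  set s := t / (2 * γ.E * γ.D₁) with hs
  rw [γ.reparam_of_le e x hτ.le hx, γ.reparam_of_le e y hτ.le hy] at h2
  rw [γ.reparam_of_le e x hs0 (hsτ.trans hx), γ.reparam_of_le e y hs0 (hsτ.trans hy)]
  have hc := γ.convex e e x y
    ⟨τ / dist e x, unitInterval.div_mem hτ.le dist_nonneg hx⟩
    ⟨τ / dist e y, unitInterval.div_mem hτ.le dist_nonneg hy⟩
    ⟨s / τ, unitInterval.div_mem hs0 hτ.le hsτ⟩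
  have e1 : ∀ (d : ℝ) (p : τ / d ∈ unitInterval) (q : s / τ ∈ unitInterval)
      (r : s / d ∈ unitInterval),
      ((⟨s / τ, q⟩ : unitInterval) * ⟨τ / d, p⟩) = ⟨s / d, r⟩ := by
    intro d p q r
    ext
    simp only [Set.Icc.coe_mul]
    field_simp
  rw [e1 _ _ _ (unitInterval.div_mem hs0 dist_nonneg (hsτ.trans hx)),
    e1 _ _ _ (unitInterval.div_mem hs0 dist_nonneg (hsτ.trans hy))] at hc
  refine hc.trans ?_
  rw [dist_self, mul_zero, zero_add]
  have h3 : s / τ * γ.E * (2 * γ.D₁) ≤ 1 := by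
    have : s * (2 * γ.E * γ.D₁) = t := by rw [hs]; field_simp
    have h4 : s / τ * γ.E * (2 * γ.D₁) = t / τ := by rw [← this]; ring
    rw [h4]; exact div_le_one_of_le₀ h1 hτ.le
  have h5 : 0 ≤ s / τ * γ.E := by positivity
  have := mul_le_mul_of_nonneg_left h2 h5
  simp only at this ⊢
  linarith

/-- The quasi-ultrametric inequality for the Gromov product. -/
theorem gromovProd_quasiUltra (e x y z : X) :
    min (γ.gromovProd e x y) (γ.gromovProd e y z) ≤
      ENNReal.ofReal (2 * γ.E * γ.D₁) * γ.gromovProd e x z := by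
  have hE := γ.one_le_E
  have hC := γ.C_nonneg
  have hD : 1 ≤ γ.D₁ := by unfold D₁; linarith
  have hED : 1 ≤ 2 * γ.E * γ.D₁ := by nlinarith
  have hk0 : 0 < 2 * γ.E * γ.D₁ := by linarith
  refine le_of_forall_lt fun r hr => ?_
  obtain ⟨t, ht, hrt, htm⟩ : ∃ t : ℝ, 0 ≤ t ∧ r < ENNReal.ofReal t ∧
      ENNReal.ofReal t < min (γ.gromovProd e x y) (γ.gromovProd e y z) := by
    obtain ⟨q, h1, h2⟩ := exists_between hr
    refine ⟨q.toReal, ENNReal.toReal_nonneg, ?_, ?_⟩ <;>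
      rwa [ENNReal.ofReal_toReal (ne_top_of_lt h2)]
  refine hrt.trans_le ?_
  have hxy := htm.trans_le (min_le_left _ _)
  have hyz := htm.trans_le (min_le_right _ _)
  have h1 := γ.dist_reparam_le ht hxy
  have h2 := γ.dist_reparam_le ht hyz
  obtain ⟨τ, hτ, hτx, -, -⟩ := γ.exists_time_of_lt ht hxy
  obtain ⟨σ, hσ, -, hσz, -⟩ := γ.exists_time_of_lt ht hyz
  set s := t / (2 * γ.E * γ.D₁) with hs
  have hst : s ≤ t := div_le_self ht hED
  have hks : t = (2 * γ.E * γ.D₁) * s := by rw [hs]; field_simp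
  have hs0 : 0 ≤ s := div_nonneg ht hk0.le
  rw [hks, ENNReal.ofReal_mul hk0.le]
  refine mul_le_mul_right ?_ _
  refine le_min ?_ (le_min ?_ ?_)
  · rw [edist_dist]; exact ENNReal.ofReal_le_ofReal (by linarith)
  · rw [edist_dist]; exact ENNReal.ofReal_le_ofReal (by linarith)
  · refine le_iSup₂ (f := fun t _ => ENNReal.ofReal t) s ⟨hs0, ?_⟩
    refine (dist_triangle _ (reparam γ.toFun e y s) _).trans ?_
    have : γ.D₁ = 2 * (2 * (1 + γ.E) + γ.C) + 2 := rfl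
    linarith

/-- Sequences `(xᵢ)` with `(xᵢ | xⱼ)_e → ∞` as `i, j → ∞`. -/
def SInfty (e : X) : Type u :=
  {x : ℕ → X // Tendsto (fun p : ℕ × ℕ => γ.gromovProd e (x p.1) (x p.2)) atTop (𝓝 ∞)}

/-- Two such sequences are equivalent when `(xᵢ | yᵢ)_e → ∞`. -/
instance sInftySetoid (e : X) : Setoid (γ.SInfty e) where
  r x y := Tendsto (fun i => γ.gromovProd e (x.1 i) (y.1 i)) atTop (𝓝 ∞)
  iseqv :=
    { refl := fun x => x.2.comp (tendsto_atTop_diagonal)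
      symm := fun {x y} h => by simpa only [gromovProd_comm γ e (x.1 _)] using h
      trans := fun {x y z} h1 h2 => by
        have h := h1.min h2
        rw [min_self] at h
        have h3 : Tendsto (fun i => ENNReal.ofReal (2 * γ.E * γ.D₁) *
            γ.gromovProd e (x.1 i) (z.1 i)) atTop (𝓝 ∞) :=
          tendsto_nhds_top_mono' h fun i => γ.gromovProd_quasiUltra e _ _ _
        have h4 := ENNReal.Tendsto.const_mul (a := (ENNReal.ofReal (2 * γ.E * γ.D₁))⁻¹) h3
          (Or.inl ENNReal.top_ne_zero)
        have hE := γ.one_le_E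
        have hC := γ.C_nonneg
        have hk : 0 < 2 * γ.E * γ.D₁ := by
          have : 0 < γ.D₁ := by unfold D₁; linarith
          positivity
        rw [ENNReal.mul_top (ENNReal.inv_ne_zero.2 ENNReal.ofReal_ne_top)] at h4
        refine h4.congr fun i => ?_
        rw [← mul_assoc, ENNReal.inv_mul_cancel (ENNReal.ofReal_pos.2 hk).ne'
          ENNReal.ofReal_ne_top, one_mul] }

/-- The ideal boundary `∂X = S_∞(X) / ∼`, as a set. -/
def IdealBoundary (e : X) : Type u := Quotient (γ.sInftySetoid e)

/-- The union `X ∪ ∂X`. -/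
def Bordification (e : X) : Type u := X ⊕ γ.IdealBoundary e

/-- The sequences that represent a point of `X ∪ ∂X`: for a point of `X` the constant sequence,
for a point of `∂X` the members of the class. -/
def Represents {e : X} (x : ℕ → X) : γ.Bordification e → Prop
  | Sum.inl p => x = fun _ => p
  | Sum.inr ξ => ∃ s : γ.SInfty e, s.1 = x ∧ Quotient.mk (γ.sInftySetoid e) s = ξ

/-- The Gromov product on `X ∪ ∂X`: the supremum of `liminf (xᵢ | yᵢ)_e` over all representing
sequences. -/
def extProd {e : X} (ξ η : γ.Bordification e) : ℝ≥0∞ :=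
  sSup {r | ∃ x y : ℕ → X, γ.Represents x ξ ∧ γ.Represents y η ∧
    r = liminf (fun i => γ.gromovProd e (x i) (y i)) atTop}

/-- The set `V_n[ξ]`, where `V_n` consists of the pairs `(ξ, η)` with `(ξ | η) > n`, together with
the pairs of points of `X` at distance less than `1/n`. -/
def V {e : X} (n : ℕ) (ξ : γ.Bordification e) : Set (γ.Bordification e) :=
  {η | (n : ℝ≥0∞) < γ.extProd ξ η ∨
    ∃ x y : X, ξ = Sum.inl x ∧ η = Sum.inl y ∧ dist x y < 1 / (n : ℝ)}

theorem V_anti {e : X} {m n : ℕ} (hm : 0 < m) (h : m ≤ n) (ξ : γ.Bordification e) :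
    γ.V n ξ ⊆ γ.V m ξ := by
  rintro η (hη | ⟨x, y, hx, hy, hd⟩)
  · exact Or.inl (lt_of_le_of_lt (by exact_mod_cast h) hη)
  · exact Or.inr ⟨x, y, hx, hy, hd.trans_le
      (one_div_le_one_div_of_le (by exact_mod_cast hm) (by exact_mod_cast h))⟩

/-- The topology of `X ∪ ∂X`, in which the sets `V_n[ξ]`, `n ≥ 1`, form a neighbourhood base of
`ξ` (the topology of the uniformity with base `{V_n}`). -/
instance (e : X) : TopologicalSpace (γ.Bordification e) where
  IsOpen U := ∀ ξ ∈ U, ∃ n : ℕ, 0 < n ∧ γ.V n ξ ⊆ U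
  isOpen_univ := fun _ _ => ⟨1, one_pos, Set.subset_univ _⟩
  isOpen_inter := fun U W hU hW ξ hξ => by
    obtain ⟨m, hm, h1⟩ := hU ξ hξ.1
    obtain ⟨n, hn, h2⟩ := hW ξ hξ.2
    exact ⟨max m n, lt_max_of_lt_left hm,
      Set.subset_inter ((γ.V_anti hm (le_max_left _ _) ξ).trans h1)
        ((γ.V_anti hn (le_max_right _ _) ξ).trans h2)⟩
  isOpen_sUnion := fun s hs ξ ⟨U, hU, hξ⟩ => by
    obtain ⟨n, hn, h⟩ := hs U hU ξ hξ
    exact ⟨n, hn, h.trans (Set.subset_sUnion_of_mem hU)⟩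

/-- The inclusion of `∂X` in `X ∪ ∂X`. -/
def ofBoundary {e : X} (ξ : γ.IdealBoundary e) : γ.Bordification e := Sum.inr ξ

/-- The ideal boundary carries the subspace topology of `X ∪ ∂X`. -/
instance (e : X) : TopologicalSpace (γ.IdealBoundary e) :=
  TopologicalSpace.induced γ.ofBoundary inferInstance

end GCCBicombing

/-! ## Covering dimension -/

/-- Every finite open cover of `M` has a finite open refinement such that every point lies in at
most `n + 1` of its members. -/
def CoveringDimLE (M : Type u) [TopologicalSpace M] (n : ℕ) : Prop :=
  ∀ 𝒰 : Set (Set M), 𝒰.Finite → (∀ U ∈ 𝒰, IsOpen U) → ⋃₀ 𝒰 = Set.univ →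
    ∃ 𝒱 : Set (Set M), 𝒱.Finite ∧ (∀ W ∈ 𝒱, IsOpen W) ∧ ⋃₀ 𝒱 = Set.univ ∧
      (∀ W ∈ 𝒱, ∃ U ∈ 𝒰, W ⊆ U) ∧ ∀ p : M, {W ∈ 𝒱 | p ∈ W}.ncard ≤ n + 1

open Classical in
/-- The covering dimension of a topological space; `⊥` stands for the value `-1` that is given to
the empty space, and `⊤` for infinite dimension. -/
def coveringDim (M : Type u) [TopologicalSpace M] : WithBot ℕ∞ :=
  if IsEmpty M then ⊥
  else ((⨅ (n : ℕ) (_ : CoveringDimLE M n), (n : ℕ∞) : ℕ∞) : WithBot ℕ∞)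

/-! ## Free products of metric spaces with nets -/

/-- A net of a metric space `X`: a set `X₀`, a map `i : X₀ → X` that is proper for the discrete
topology on `X₀`, and a base point in the image of `i`, given as the image of an element `base`. -/
structure Net (X : Type u) [MetricSpace X] where
  carrier : Type v
  toSpace : carrier → X
  proper : ∀ K : Set X, IsCompact K → (toSpace ⁻¹' K).Finite
  base : carrier

namespace Net

/-- The base point of a net. -/
def pt {X : Type u} [MetricSpace X] (N : Net.{u, v} X) : X := N.toSpace N.base

end Net

section FreeProduct

variable {S : Bool → Type u} [∀ i, MetricSpace (S i)] (N : ∀ i, Net.{u, v} (S i))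

/-- The letters at which something new is attached to a sheet of type `i`: all elements of the net
for the root sheet (`r = true`), and all elements but the base element for every other sheet
(whose base point is joined to its parent sheet). -/
def Letter (i r : Bool) : Type v := {a : (N i).carrier // r = false → a ≠ (N i).base}

/-- A tree of spaces consisting of copies ("sheets") of `S false` and `S true` and of edges of
length one. `TreeOf N i r` has a root sheet, a copy of `S i`. For each letter `a` of the root sheet
an edge of length one starts at the point `i(a)` of the root sheet, and ends at the base point of
the root sheet of a copy of `TreeOf N (!i) false`. A point is a point of the root sheet, or an
interior point of such an edge, given by its distance to the root sheet, or a point of one of these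
copies.

For `r = true` this is the free product: unfolding the recursion, the sheets correspond to the
reduced (alternating) words in the nontrivial letters of both nets, every net point of every
sheet is joined by an edge of length one to exactly one sheet of the other type, and the pattern
of edges is that of the Bass-Serre tree of a free product. -/
inductive TreeOf : Bool → Bool → Type (max u v)
  | sheet {i r : Bool} (x : S i) : TreeOf i r
  | edge {i r : Bool} (a : Letter N i r) (t : Set.Ioo (0 : ℝ) 1) : TreeOf i r
  | branch {i r : Bool} (a : Letter N i r) (z : TreeOf (!i) false) : TreeOf i r

namespace TreeOf

variable {N}

/-- The point of the root sheet that is closest to `z`. -/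
def gate : {i r : Bool} → TreeOf N i r → S i
  | _, _, sheet x => x
  | i, _, edge a _ => (N i).toSpace a.1
  | i, _, branch a _ => (N i).toSpace a.1

/-- The distance of `z` to the root sheet. -/
def depth : {i r : Bool} → TreeOf N i r → ℝ
  | _, _, sheet _ => 0
  | _, _, edge _ t => t
  | i, _, branch _ z => 1 + (dist (N (!i)).pt (gate z) + depth z)

/-- The distance of `z` to the base point of the root sheet. -/
def height {i r : Bool} (z : TreeOf N i r) : ℝ := dist (N i).pt (gate z) + depth z

open Classical in
/-- The path metric. Two points behind the same letter are compared there; otherwise a path from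
one to the other goes through both gates. -/
def treeDist : {i r : Bool} → TreeOf N i r → TreeOf N i r → ℝ
  | _, _, edge a s, edge b t =>
    if a = b then |(s : ℝ) - t| else
      depth (edge a s) + dist (gate (edge a s)) (gate (edge b t)) + depth (edge b t)
  | _, _, edge a s, branch b w =>
    if a = b then (1 - s) + height w else
      depth (edge a s) + dist (gate (edge a s)) (gate (branch b w)) + depth (branch b w)
  | _, _, branch a z, edge b t =>
    if a = b then height z + (1 - t) else
      depth (branch a z) + dist (gate (branch a z)) (gate (edge b t)) + depth (edge b t)
  | _, _, branch a z, branch b w =>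
    if a = b then treeDist z w else
      depth (branch a z) + dist (gate (branch a z)) (gate (branch b w)) + depth (branch b w)
  | _, _, z, w => depth z + dist (gate z) (gate w) + depth w

theorem depth_nonneg : {i r : Bool} → (z : TreeOf N i r) → 0 ≤ depth z
  | _, _, sheet _ => by simp [depth]
  | _, _, edge _ t => t.2.1.le
  | i, _, branch _ z => by
    have := depth_nonneg z
    have := dist_nonneg (x := (N (!i)).pt) (y := gate z)
    simp only [depth]
    linarith

theorem height_nonneg {i r : Bool} (z : TreeOf N i r) : 0 ≤ height z :=
  add_nonneg dist_nonneg (depth_nonneg z)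

theorem treeDist_self : {i r : Bool} → (z : TreeOf N i r) → treeDist z z = 0
  | _, _, sheet _ => by simp [treeDist, depth, gate]
  | _, _, edge _ t => by simp [treeDist]
  | i, _, branch _ z => by simp [treeDist, treeDist_self z]

theorem treeDist_comm : {i r : Bool} → (z w : TreeOf N i r) → treeDist z w = treeDist w z
  | i, _, branch a z, branch b w => by
    have h := treeDist_comm z w
    by_cases hab : a = b
    · subst hab
      simp only [treeDist, if_true, h]
    · have hba : ¬ b = a := fun h => hab h.symm
      simp only [treeDist, hab, hba, if_false, dist_comm (gate (branch b w))]
      ring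
  | _, _, edge a s, edge b t => by
    by_cases hab : a = b
    · subst hab
      simp only [treeDist, if_true, abs_sub_comm (t : ℝ)]
    · have hba : ¬ b = a := fun h => hab h.symm
      simp only [treeDist, hab, hba, if_false, dist_comm (gate (edge b t))]
      ring
  | _, _, edge a s, branch b w => by
    by_cases hab : a = b
    · subst hab
      simp only [treeDist, if_true]
      ring
    · have hba : ¬ b = a := fun h => hab h.symm
      simp only [treeDist, hab, hba, if_false, dist_comm (gate (branch b w))]
      ring
  | _, _, branch a z, edge b t => by
    by_cases hab : a = b
    · subst hab
      simp only [treeDist, if_true]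
      ring
    · have hba : ¬ b = a := fun h => hab h.symm
      simp only [treeDist, hab, hba, if_false, dist_comm (gate (edge b t))]
      ring
  | _, _, sheet x, sheet y => by simp [treeDist, depth, gate, dist_comm]
  | _, _, sheet x, edge _ _ => by simp [treeDist, depth, gate, dist_comm, add_comm]
  | _, _, sheet x, branch _ _ => by simp [treeDist, depth, gate, dist_comm, add_comm]
  | _, _, edge _ _, sheet x => by simp [treeDist, depth, gate, dist_comm, add_comm]
  | _, _, branch _ _, sheet x => by simp [treeDist, depth, gate, dist_comm, add_comm]

theorem treeDist_le_height : {i r : Bool} → (z w : TreeOf N i r) →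
    treeDist z w ≤ height z + height w ∧ height z ≤ treeDist z w + height w
  | i, _, branch a z, branch b w => by
    have h := treeDist_le_height z w
    have := dist_triangle_left (gate (branch a z)) (gate (branch b w)) (N i).pt
    have := dist_triangle_right (N i).pt (gate (branch a z)) (gate (branch b w))
    have := height_nonneg w
    have := depth_nonneg (branch b w)
    have := depth_nonneg (branch a z)
    simp only [treeDist]
    split_ifs with hab
    · subst hab
      have := dist_nonneg (x := (N i).pt) (y := (N i).toSpace a.1)
      simp only [height, depth, gate] at *
      constructor <;> linarith
    · simp only [height, gate] at *
      constructor <;> linarith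
  | i, _, edge a s, edge b t => by
    have := dist_triangle_left (gate (edge a s)) (gate (edge b t)) (N i).pt
    have := dist_triangle_right (N i).pt (gate (edge a s)) (gate (edge b t))
    have := s.2.1
    have := t.2.1
    have := le_abs_self ((s : ℝ) - t)
    have := neg_abs_le ((s : ℝ) - t)
    simp only [treeDist]
    split_ifs with hab
    · subst hab
      have := dist_nonneg (x := (N i).pt) (y := (N i).toSpace a.1)
      have : |(s : ℝ) - t| ≤ s + t := abs_le.2 ⟨by linarith, by linarith⟩
      simp only [height, depth, gate] at *
      constructor <;> linarith
    · simp only [height, depth, gate] at *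
      constructor <;> linarith
  | i, _, edge a s, branch b w => by
    have := dist_triangle_left (gate (edge a s)) (gate (branch b w)) (N i).pt
    have := dist_triangle_right (N i).pt (gate (edge a s)) (gate (branch b w))
    have := s.2.1
    have := s.2.2
    have := height_nonneg w
    have := depth_nonneg (branch b w)
    simp only [treeDist]
    split_ifs with hab
    · subst hab
      have := dist_nonneg (x := (N i).pt) (y := (N i).toSpace a.1)
      simp only [height, depth, gate] at *
      constructor <;> linarith
    · simp only [height, depth, gate] at *
      constructor <;> linarith
  | i, _, branch b w, edge a s => by
    have := dist_triangle_left (gate (branch b w)) (gate (edge a s)) (N i).pt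
    have := dist_triangle_right (N i).pt (gate (branch b w)) (gate (edge a s))
    have := s.2.1
    have := s.2.2
    have := height_nonneg w
    have := depth_nonneg (branch b w)
    simp only [treeDist]
    split_ifs with hab
    · subst hab
      have := dist_nonneg (x := (N i).pt) (y := (N i).toSpace b.1)
      simp only [height, depth, gate] at *
      constructor <;> linarith
    · simp only [height, depth, gate] at *
      constructor <;> linarith
  | i, _, sheet x, w => by
    have := dist_triangle_left x (gate w) (N i).pt
    have := dist_triangle_right (N i).pt x (gate w)
    have := depth_nonneg w
    cases w <;> simp only [treeDist, height, gate, depth] at * <;> constructor <;> linarith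
  | i, _, z, sheet x => by
    have := dist_triangle_left (gate z) x (N i).pt
    have := dist_triangle_right (N i).pt (gate z) x
    have := depth_nonneg z
    cases z <;> simp only [treeDist, height, gate, depth] at * <;> constructor <;> linarith

theorem eq_of_treeDist_eq_zero : {i r : Bool} → (z w : TreeOf N i r) → treeDist z w = 0 → z = w
  | i, _, branch a z, branch b w => fun h => by
    have := height_nonneg w
    have := height_nonneg z
    simp only [treeDist, depth, height, gate] at *
    split_ifs at h with hab
    · rw [hab, eq_of_treeDist_eq_zero z w h]
    · have := dist_nonneg (x := (N i).toSpace a.1) (y := (N i).toSpace b.1)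
      linarith
  | i, _, edge a s, edge b t => fun h => by
    have := s.2.1
    have := t.2.1
    simp only [treeDist, depth, gate] at *
    split_ifs at h with hab
    · rw [hab, Subtype.ext (sub_eq_zero.1 (abs_eq_zero.1 h))]
    · have := dist_nonneg (x := (N i).toSpace a.1) (y := (N i).toSpace b.1)
      linarith
  | i, _, edge a s, branch b w => fun h => by
    have := s.2.1
    have := s.2.2
    have := height_nonneg w
    have := dist_nonneg (x := (N i).toSpace a.1) (y := (N i).toSpace b.1)
    simp only [treeDist, depth, gate, height] at *
    split_ifs at h with hab <;> linarith
  | i, _, branch b w, edge a s => fun h => by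
    have := s.2.1
    have := s.2.2
    have := height_nonneg w
    have := dist_nonneg (x := (N i).toSpace b.1) (y := (N i).toSpace a.1)
    simp only [treeDist, depth, gate, height] at *
    split_ifs at h with hab <;> linarith
  | i, _, sheet x, sheet y => fun h => by
    simp only [treeDist, depth, gate, zero_add, add_zero] at h
    rw [dist_eq_zero.1 h]
  | i, _, sheet x, edge b t => fun h => by
    have := t.2.1
    have := dist_nonneg (x := x) (y := (N i).toSpace b.1)
    simp only [treeDist, depth, gate] at h
    linarith
  | i, _, edge b t, sheet x => fun h => by
    have := t.2.1
    have := dist_nonneg (x := (N i).toSpace b.1) (y := x)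
    simp only [treeDist, depth, gate] at h
    linarith
  | i, _, sheet x, branch b w => fun h => by
    have := height_nonneg w
    have := dist_nonneg (x := x) (y := (N i).toSpace b.1)
    simp only [treeDist, depth, gate, height] at *
    linarith
  | i, _, branch b w, sheet x => fun h => by
    have := height_nonneg w
    have := dist_nonneg (x := (N i).toSpace b.1) (y := x)
    simp only [treeDist, depth, gate, height] at *
    linarith

theorem treeDist_le_gate {i r : Bool} (z w : TreeOf N i r) :
    treeDist z w ≤ depth z + dist (gate z) (gate w) + depth w := by
  have h0 := depth_nonneg z
  have h1 := depth_nonneg w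
  cases z with
  | sheet x => cases w <;> simp only [treeDist, le_refl]
  | edge a s =>
    cases w with
    | sheet y => simp only [treeDist, le_refl]
    | edge b t =>
      simp only [treeDist]
      split_ifs with hab
      · have := s.2.1
        have := t.2.1
        have : |(s : ℝ) - t| ≤ s + t := abs_le.2 ⟨by linarith, by linarith⟩
        subst hab
        simp only [depth, gate, dist_self]
        linarith
      · exact le_rfl
    | branch b w =>
      simp only [treeDist]
      split_ifs with hab
      · have := s.2.1
        subst hab
        simp only [depth, gate, dist_self, height]
        linarith
      · exact le_rfl
  | branch a z =>
    cases w with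
    | sheet y => simp only [treeDist, le_refl]
    | edge b t =>
      simp only [treeDist]
      split_ifs with hab
      · have := t.2.1
        subst hab
        simp only [depth, gate, dist_self, height]
        linarith
      · exact le_rfl
    | branch b w =>
      simp only [treeDist]
      split_ifs with hab
      · have := (treeDist_le_height z w).1
        subst hab
        simp only [depth, gate, dist_self, height] at *
        linarith
      · exact le_rfl

/-- `z` and `w` lie behind the same letter of the root sheet. -/
def Together {i r : Bool} : TreeOf N i r → TreeOf N i r → Prop
  | edge a _, edge b _ => a = b
  | edge a _, branch b _ => a = b
  | branch a _, edge b _ => a = b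
  | branch a _, branch b _ => a = b
  | _, _ => False

theorem Together.trans {i r : Bool} {z u w : TreeOf N i r} (h : Together z u)
    (h' : Together u w) : Together z w := by
  cases z <;> cases u <;> cases w <;> simp_all [Together]

theorem Together.gate_eq {i r : Bool} {z w : TreeOf N i r} (h : Together z w) :
    gate z = gate w := by
  cases z <;> cases w <;> simp_all [Together, gate]

theorem treeDist_of_not_together {i r : Bool} {z w : TreeOf N i r} (h : ¬ Together z w) :
    treeDist z w = depth z + dist (gate z) (gate w) + depth w := by
  cases z <;> cases w <;> simp_all [Together, treeDist]

theorem depth_le_treeDist {i r : Bool} {z w : TreeOf N i r} (h : Together z w) :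
    depth z ≤ treeDist z w + depth w := by
  have := (treeDist_le_height z w).2
  rw [height, height, h.gate_eq] at this
  linarith

theorem Together.symm {i r : Bool} {z w : TreeOf N i r} (h : Together z w) : Together w z := by
  cases z <;> cases w <;> simp_all [Together]

theorem treeDist_triangle_of_not_together {i r : Bool} {z u w : TreeOf N i r}
    (h : ¬ (Together z u ∧ Together u w)) : treeDist z w ≤ treeDist z u + treeDist u w := by
  have h2 := treeDist_le_gate z w
  by_cases hzu : Together z u
  · have huw : ¬ Together u w := fun h' => h ⟨hzu, h'⟩
    have h1 := depth_le_treeDist hzu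
    rw [treeDist_of_not_together huw]
    rw [hzu.gate_eq] at h2
    linarith
  · rw [treeDist_of_not_together hzu]
    by_cases huw : Together u w
    · have h1 := treeDist_comm w u
      have h4 := depth_le_treeDist huw.symm
      rw [← huw.gate_eq] at h2
      linarith
    · rw [treeDist_of_not_together huw]
      have h3 := dist_triangle (gate z) (gate u) (gate w)
      have h4 := depth_nonneg u
      linarith

theorem treeDist_triangle : {i r : Bool} → (z u w : TreeOf N i r) →
    treeDist z w ≤ treeDist z u + treeDist u w
  | i, r, branch a z, branch b u, branch c w => by
    have ih := treeDist_triangle z u w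
    by_cases h : Together (branch a z) (branch b u) ∧ Together (branch b u) (branch c w)
    · obtain ⟨rfl, rfl⟩ : a = b ∧ b = c := h
      simpa only [treeDist, if_true] using ih
    · exact treeDist_triangle_of_not_together h
  | i, r, edge a s, edge b s', edge c s'' => by
    by_cases h : Together (edge a s) (edge b s') ∧ Together (edge b s') (edge c s'')
    · obtain ⟨rfl, rfl⟩ : a = b ∧ b = c := h
      simp only [treeDist, if_true]
      exact abs_sub_le _ _ _
    · exact treeDist_triangle_of_not_together h
  | i, r, edge a s, edge b s', branch c w => by
    by_cases h : Together (edge a s) (edge b s') ∧ Together (edge b s') (branch c w)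
    · obtain ⟨rfl, rfl⟩ : a = b ∧ b = c := h
      have := neg_abs_le ((s : ℝ) - s')
      simp only [treeDist, if_true]
      linarith
    · exact treeDist_triangle_of_not_together h
  | i, r, edge a s, branch b u, edge c s'' => by
    by_cases h : Together (edge a s) (branch b u) ∧ Together (branch b u) (edge c s'')
    · obtain ⟨rfl, rfl⟩ : a = b ∧ b = c := h
      have := height_nonneg u
      have := s.2.2
      have := s''.2.2
      have : |(s : ℝ) - s''| ≤ (1 - s) + (1 - s'') :=
        abs_le.2 ⟨by linarith, by linarith⟩
      simp only [treeDist, if_true]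
      linarith
    · exact treeDist_triangle_of_not_together h
  | i, r, edge a s, branch b u, branch c w => by
    by_cases h : Together (edge a s) (branch b u) ∧ Together (branch b u) (branch c w)
    · obtain ⟨rfl, rfl⟩ : a = b ∧ b = c := h
      have := (treeDist_le_height w u).2
      have := treeDist_comm w u
      simp only [treeDist, if_true]
      linarith
    · exact treeDist_triangle_of_not_together h
  | i, r, branch a z, edge b s', edge c s'' => by
    by_cases h : Together (branch a z) (edge b s') ∧ Together (edge b s') (edge c s'')
    · obtain ⟨rfl, rfl⟩ : a = b ∧ b = c := h
      have := le_abs_self ((s' : ℝ) - s'')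
      simp only [treeDist, if_true]
      linarith
    · exact treeDist_triangle_of_not_together h
  | i, r, branch a z, edge b s', branch c w => by
    by_cases h : Together (branch a z) (edge b s') ∧ Together (edge b s') (branch c w)
    · obtain ⟨rfl, rfl⟩ : a = b ∧ b = c := h
      have := (treeDist_le_height z w).1
      have := s'.2.2
      simp only [treeDist, if_true]
      linarith
    · exact treeDist_triangle_of_not_together h
  | i, r, branch a z, branch b u, edge c s'' => by
    by_cases h : Together (branch a z) (branch b u) ∧ Together (branch b u) (edge c s'')
    · obtain ⟨rfl, rfl⟩ : a = b ∧ b = c := h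
      have := (treeDist_le_height z u).2
      simp only [treeDist, if_true]
      linarith
    · exact treeDist_triangle_of_not_together h
  | _, _, sheet _, _, _ => treeDist_triangle_of_not_together fun h => h.1.elim
  | _, _, z, sheet _, _ => treeDist_triangle_of_not_together fun h => h.2.elim
  | _, _, z, u, sheet _ => treeDist_triangle_of_not_together fun h => h.2.symm.elim

instance {i r : Bool} : MetricSpace (TreeOf N i r) where
  dist := treeDist
  dist_self := treeDist_self
  dist_comm := treeDist_comm
  dist_triangle := treeDist_triangle
  eq_of_dist_eq_zero := eq_of_treeDist_eq_zero _ _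

/-! ### The bicombing of the free product -/

/-- The concatenation of paths: follow `p` up to time `ℓ`, then follow `q`. -/
def cat {Z : Type*} (ℓ : ℝ) (p q : ℝ → Z) : ℝ → Z := fun s => if s ≤ ℓ then p s else q (s - ℓ)

open Classical in
/-- The point at distance `s` from the root sheet on the (closed) edge of the letter `a`. -/
def edgePt {i r : Bool} (a : Letter N i r) (s : ℝ) : TreeOf N i r :=
  if s ≤ 0 then sheet ((N i).toSpace a.1)
  else if h : 0 < s ∧ s < 1 then edge a ⟨s, h⟩
  else branch a (sheet (N (!i)).pt)

variable (γ : ∀ i, S i → S i → unitInterval → S i)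

/-- The unit speed path in the root sheet from `x` to `y` that is given by the bicombing. -/
def sheetPath {i r : Bool} (x y : S i) : ℝ → TreeOf N i r := fun s => sheet (reparam (γ i) x y s)

/-- The unit speed path from the gate of `z` to `z`, of length `depth z`. -/
def enter : {i r : Bool} → TreeOf N i r → ℝ → TreeOf N i r
  | _, _, sheet x => fun _ => sheet x
  | _, _, edge a _ => fun s => edgePt a s
  | i, _, branch a z => cat 1 (edgePt a) fun s =>
      branch a (cat (dist (N (!i)).pt (gate z)) (sheetPath γ (N (!i)).pt (gate z)) (enter z) s)

/-- The unit speed path from `z` to the gate of `z`, of length `depth z`. -/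
def exit : {i r : Bool} → TreeOf N i r → ℝ → TreeOf N i r
  | _, _, sheet x => fun _ => sheet x
  | _, _, edge a t => fun s => edgePt a (t - s)
  | i, _, branch a z => cat (height z)
      (fun s => branch a (cat (depth z) (exit z) (sheetPath γ (gate z) (N (!i)).pt) s))
      fun s => edgePt a (1 - s)

/-- The unit speed path from the base point of the root sheet to `z`, of length `height z`. -/
def descend {i r : Bool} (z : TreeOf N i r) : ℝ → TreeOf N i r :=
  cat (dist (N i).pt (gate z)) (sheetPath γ (N i).pt (gate z)) (enter γ z)

/-- The unit speed path from `z` to the base point of the root sheet, of length `height z`. -/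
def ascend {i r : Bool} (z : TreeOf N i r) : ℝ → TreeOf N i r :=
  cat (depth z) (exit γ z) (sheetPath γ (gate z) (N i).pt)

/-- The unit speed path from `z` to `w` through the gates of `z` and `w`. -/
def through {i r : Bool} (z w : TreeOf N i r) : ℝ → TreeOf N i r :=
  cat (depth z) (exit γ z) (cat (dist (gate z) (gate w)) (sheetPath γ (gate z) (gate w))
    (enter γ w))

open Classical in
/-- The unit speed path from `z` to `w`, of length `dist z w`: it follows the edges, and in each
sheet that it meets it follows the bicombing of that sheet, from the point where it enters the
sheet (or starts) to the point where it leaves the sheet (or ends). -/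
def path : {i r : Bool} → TreeOf N i r → TreeOf N i r → ℝ → TreeOf N i r
  | _, _, edge a s, edge b t =>
    if a = b then fun τ => edgePt a (if (s : ℝ) ≤ t then s + τ else s - τ)
    else through γ (edge a s) (edge b t)
  | _, _, edge a s, branch b w =>
    if a = b then cat (1 - (s : ℝ)) (fun τ => edgePt a (s + τ)) fun τ => branch b (descend γ w τ)
    else through γ (edge a s) (branch b w)
  | _, _, branch a z, edge b t =>
    if a = b then cat (height z) (fun τ => branch a (ascend γ z τ)) fun τ => edgePt b (1 - τ)
    else through γ (branch a z) (edge b t)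
  | _, _, branch a z, branch b w =>
    if a = b then fun τ => branch b (path z w τ)
    else through γ (branch a z) (branch b w)
  | _, _, z, w => through γ z w

/-- The bicombing that is obtained by concatenating the bicombings of the sheets and the edges,
parametrised proportionally to arc length on `[0,1]`. -/
def bicombing {i r : Bool} (z w : TreeOf N i r) (t : unitInterval) : TreeOf N i r :=
  path γ z w (t * dist z w)

end TreeOf
end FreeProduct

section Pair

/-- Two types as a family. -/
def Pair (X Y : Type u) : Bool → Type u
  | true => X
  | false => Y

variable {X Y : Type u} [MetricSpace X] [MetricSpace Y]

instance : ∀ i, MetricSpace (Pair X Y i)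
  | true => inferInstanceAs (MetricSpace X)
  | false => inferInstanceAs (MetricSpace Y)

/-- The nets of `X` and `Y` as a family. -/
def pairNet (N : Net.{u, v} X) (M : Net.{u, v} Y) : ∀ i, Net.{u, v} (Pair X Y i)
  | true => N
  | false => M

/-- The bicombings of `X` and `Y` as a family. -/
def pairBicombing (γ : X → X → unitInterval → X) (δ : Y → Y → unitInterval → Y) :
    ∀ i, Pair X Y i → Pair X Y i → unitInterval → Pair X Y i
  | true => γ
  | false => δ

/-- The free product `X * Y` of two metric spaces with nets, with its path metric. The root sheet
is a copy of `X`. -/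
abbrev FreeProduct (N : Net.{u, v} X) (M : Net.{u, v} Y) : Type (max u v) :=
  TreeOf (pairNet N M) true true

/-- The bicombing of `X * Y` associated with bicombings of `X` and `Y`. -/
def freeBicombing (N : Net.{u, v} X) (M : Net.{u, v} Y) (γ : X → X → unitInterval → X)
    (δ : Y → Y → unitInterval → Y) :
    FreeProduct N M → FreeProduct N M → unitInterval → FreeProduct N M :=
  TreeOf.bicombing (pairBicombing γ δ)

end Pair

end

/-!
A tree of spaces is the union of its root sheet and its branches, which are again trees of spaces.
All statements are proved for trees with either kind of root sheet, with or without a branch at the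
base point, since this is the form in which they pass to branches.

*Coarse convexity.* The tree is built by gluing at single points. If the coarse convexity inequality
is known on both parts of such a wedge, then it holds on the union, provided that two additive
constants are kept apart: `C` for the comparison of a path with a point, and `2 * C` for the
comparison of two paths. Neither of them grows (`PathConvex.union`): two paths in different parts
are both compared with the gluing point, which costs `C + C`, and in all other cases it suffices to
apply one inequality in one of the parts, and to use the triangle inequality outside of it. Any
finite union of pieces of bounded depth thus has the constants of the sheets, and so has the tree
(`TreeOf.gcc`).

*The boundary.* The boundary depends neither on the constants nor on the base point
(`boundaryHomeo`). A sequence that represents a boundary point either enters one of the branches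
infinitely often, and then stays there, or its projections to the root sheet represent a boundary
point of that sheet. Hence the boundary of the tree is the disjoint union of the boundary of the
root sheet and of the boundaries of its branches (`TreeOf.exists_eq_bSheet_or_bBranch`), and the
latter are open and closed (`TreeOf.exists_nb_subset_bBranch`). Boundary points given by infinite
sequences of letters are in the boundary of a branch at each stage. A branch at a letter close to a
boundary point of the sheet is close to it as a whole (`TreeOf.exists_mem_nb_of_near`).

*The dimension.* The boundary of the root sheet is a retract of the boundary of the tree: a branch
is sent to a boundary point of the sheet to which its letter is as close as possible, up to a bound
(`TreeOf.exists_retraction_bSheet`). The boundary of a branch is open and closed, hence a retract as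
well, unless it is empty. This gives one of the two inequalities. For the other one, let a finite
open cover be given. On the boundary of the root sheet it has a shrinking of small order. A branch
whose letter is sent to a boundary point `η` of the sheet is added to those members of the shrinking
that contain `η` and whose counterpart in the cover contains the branch; if there are none, but some
member of the cover contains the branch, it is added to one of these; and in the remaining branches
the construction is repeated (`TreeOf.Shrinking`). The recursion ends at every boundary point: a
neighbourhood of index `m` of a point behind `m` edges contains everything behind these edges
(`TreeOf.exists_shrinking`).
-/

noncomputable section

/-! ### Convexity along a wedge of two subsets -/

section Wedge

variable {Z : Type*} [MetricSpace Z]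

/-- The path system `P` restricts to a system of unit speed geodesics on `K` which satisfies the
coarse convexity inequality with constants `E` and `2 * C`, and with the better constant `C` when
one of the two paths is replaced by a point. Keeping the two additive constants apart is what makes
the property stable under wedges. -/
structure PathConvex (P : Z → Z → ℝ → Z) (E C : ℝ) (K : Set Z) : Prop where
  mem : ∀ z ∈ K, ∀ w ∈ K, ∀ t, 0 ≤ t → t ≤ dist z w → P z w t ∈ K
  zero : ∀ z ∈ K, ∀ w ∈ K, P z w 0 = z
  endpt : ∀ z ∈ K, ∀ w ∈ K, P z w (dist z w) = w
  geo : ∀ z ∈ K, ∀ w ∈ K, ∀ s t, 0 ≤ s → s ≤ dist z w → 0 ≤ t → t ≤ dist z w →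
    dist (P z w s) (P z w t) = |s - t|
  point : ∀ z ∈ K, ∀ w ∈ K, ∀ p ∈ K, ∀ L c, 0 ≤ L → L ≤ dist z w → 0 ≤ c → c ≤ 1 →
    dist (P z w (c * L)) p ≤ (1 - c) * E * dist z p + c * E * dist (P z w L) p + C
  pair : ∀ z ∈ K, ∀ w ∈ K, ∀ z' ∈ K, ∀ w' ∈ K, ∀ L L' c, 0 ≤ L → L ≤ dist z w →
    0 ≤ L' → L' ≤ dist z' w' → 0 ≤ c → c ≤ 1 →
    dist (P z w (c * L)) (P z' w' (c * L')) ≤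
      (1 - c) * E * dist z z' + c * E * dist (P z w L) (P z' w' L') + 2 * C

/-- A unit speed geodesic on `[0, L]`. -/
def UnitSpeed (g : ℝ → Z) (L : ℝ) : Prop :=
  ∀ s t, 0 ≤ s → s ≤ L → 0 ≤ t → t ≤ L → dist (g s) (g t) = |s - t|

/-- Two geodesics of which the middle parts, of lengths `ℓ` and `ℓ'`, are compared by the
inequality `H`, and whose endpoints are separated by these middle parts: the same parameter can be
used on the middle parts. -/
theorem dist_le_of_middle {g g' : ℝ → Z} {α ℓ β α' ℓ' β' E κ p q F₀ F₁ c : ℝ}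
    (hg : UnitSpeed g (α + ℓ + β)) (hg' : UnitSpeed g' (α' + ℓ' + β'))
    (hα : 0 ≤ α) (hℓ : 0 ≤ ℓ) (hβ : 0 ≤ β) (hα' : 0 ≤ α') (hℓ' : 0 ≤ ℓ') (hβ' : 0 ≤ β')
    (hE : 1 ≤ E) (hc0 : 0 ≤ c) (hc1 : c ≤ 1)
    (H : ∀ s, 0 ≤ s → s ≤ 1 →
      dist (g (α + s * ℓ)) (g' (α' + s * ℓ')) ≤ (1 - s) * E * p + s * E * q + κ)
    (h₀ : α + α' + p ≤ F₀) (h₁ : β + β' + q ≤ F₁) :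
    dist (g (c * (α + ℓ + β))) (g' (c * (α' + ℓ' + β'))) ≤
      (1 - c) * E * F₀ + c * E * F₁ + κ := by
  have err : ∀ {g : ℝ → Z} {α ℓ β : ℝ}, UnitSpeed g (α + ℓ + β) → 0 ≤ α → 0 ≤ ℓ → 0 ≤ β →
      dist (g (c * (α + ℓ + β))) (g (α + c * ℓ)) ≤ (1 - c) * α + c * β := by
    intro g α ℓ β hg hα hℓ hβ
    have h1 : c * ℓ ≤ ℓ := mul_le_of_le_one_left hℓ hc1
    have h2 : c * (α + ℓ + β) ≤ α + ℓ + β := mul_le_of_le_one_left (by positivity) hc1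
    rw [hg _ _ (by positivity) h2 (by positivity) (by linarith), abs_le]
    have h3 : 0 ≤ (1 - c) * α := mul_nonneg (by linarith) hα
    have h4 : 0 ≤ c * β := by positivity
    constructor <;> nlinarith
  have e1 := err hg hα hℓ hβ
  have e2 := err hg' hα' hℓ' hβ'
  have e3 := H c hc0 hc1
  have t := dist_triangle4 (g (c * (α + ℓ + β))) (g (α + c * ℓ)) (g' (α' + c * ℓ'))
    (g' (c * (α' + ℓ' + β')))
  rw [dist_comm (g' (α' + c * ℓ'))] at t
  have a1 : (1 - c) * E * (α + α' + p) ≤ (1 - c) * E * F₀ :=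
    mul_le_mul_of_nonneg_left h₀ (mul_nonneg (by linarith) (by linarith))
  have a2 : c * E * (β + β' + q) ≤ c * E * F₁ :=
    mul_le_mul_of_nonneg_left h₁ (by positivity)
  have a3 : (1 - c) * (α + α') ≤ (1 - c) * E * (α + α') := by
    have : 0 ≤ (1 - c) * (α + α') := mul_nonneg (by linarith) (by linarith)
    nlinarith
  have a4 : c * (β + β') ≤ c * E * (β + β') := by
    have : 0 ≤ c * (β + β') := by positivity
    nlinarith
  nlinarith

/-- Two geodesics whose first parts, of lengths `α` and `α'`, end in a common point. At time `c`
the first geodesic has left its first part. The comparison is made at the parameter at which the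
second part of the first geodesic has reached the point under consideration. -/
theorem dist_le_of_common_start {g g' : ℝ → Z} {α ℓ α' ℓ' E κ q F₀ F₁ c : ℝ}
    (hg' : UnitSpeed g' (α' + ℓ'))
    (hα : 0 ≤ α) (hα' : 0 ≤ α') (hℓ : 0 ≤ ℓ) (hℓ' : 0 ≤ ℓ')
    (hE : 1 ≤ E) (hc0 : 0 ≤ c) (hc1 : c ≤ 1)
    (H : ∀ s, 0 ≤ s → s ≤ 1 → dist (g (α + s * ℓ)) (g' (α' + s * ℓ')) ≤ s * E * q + κ)
    (hq : |ℓ - ℓ'| ≤ q) (h₀ : |α - α'| ≤ F₀) (h₁ : q ≤ F₁) (hpos : (1 - c) * α ≤ c * ℓ) :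
    dist (g (c * (α + ℓ))) (g' (c * (α' + ℓ'))) ≤ (1 - c) * E * F₀ + c * E * F₁ + κ := by
  obtain ⟨k, hk0, hkc, hk⟩ : ∃ k, 0 ≤ k ∧ k ≤ c ∧ k * ℓ = (1 - c) * α := by
    have hnn : 0 ≤ (1 - c) * α := mul_nonneg (by linarith) hα
    rcases eq_or_lt_of_le hℓ with h | h
    · refine ⟨0, le_rfl, hc0, ?_⟩
      rw [← h] at hpos ⊢
      linarith
    · refine ⟨(1 - c) * α / ℓ, by positivity, (div_le_iff₀ h).2 hpos, ?_⟩
      field_simp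
  have e1 : c * (α + ℓ) = α + (c - k) * ℓ := by linarith
  have h3 := H (c - k) (by linarith) (by linarith)
  have hs : (c - k) * ℓ' ≤ ℓ' := mul_le_of_le_one_left hℓ' (by linarith)
  have hs0 : 0 ≤ (c - k) * ℓ' := mul_nonneg (by linarith) hℓ'
  have h4 := hg' (α' + (c - k) * ℓ') (c * (α' + ℓ')) (by linarith) (by linarith) (by positivity)
    (mul_le_of_le_one_left (by positivity) hc1)
  have h5 : |α' + (c - k) * ℓ' - c * (α' + ℓ')| ≤ (1 - c) * |α - α'| + k * |ℓ - ℓ'| := by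
    have : α' + (c - k) * ℓ' - c * (α' + ℓ') = -((1 - c) * (α - α')) + k * (ℓ - ℓ') := by linarith
    rw [this]
    refine (abs_add_le _ _).trans ?_
    rw [abs_neg, abs_mul, abs_mul, abs_of_nonneg hk0, abs_of_nonneg (by linarith : 0 ≤ 1 - c)]
  have t := dist_triangle (g (α + (c - k) * ℓ)) (g' (α' + (c - k) * ℓ')) (g' (c * (α' + ℓ')))
  rw [e1]
  have hq0 : 0 ≤ q := (abs_nonneg _).trans hq
  have hF0 : 0 ≤ F₀ := (abs_nonneg _).trans h₀
  have b1 : (1 - c) * |α - α'| ≤ (1 - c) * E * F₀ := by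
    have h6 : (1 - c) * |α - α'| ≤ (1 - c) * F₀ := mul_le_mul_of_nonneg_left h₀ (by linarith)
    have h7 : 0 ≤ (1 - c) * F₀ := mul_nonneg (by linarith) hF0
    nlinarith
  have b2 : k * |ℓ - ℓ'| ≤ k * E * q := by
    have h6 : k * |ℓ - ℓ'| ≤ k * q := mul_le_mul_of_nonneg_left hq hk0
    have h7 : 0 ≤ k * q := mul_nonneg hk0 hq0
    nlinarith
  have b3 : c * E * q ≤ c * E * F₁ := mul_le_mul_of_nonneg_left h₁ (by positivity)
  nlinarith

/-- The time reversal of `dist_le_of_common_start`: the last parts start in a common point. -/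
theorem dist_le_of_common_end {g g' : ℝ → Z} {β ℓ β' ℓ' E κ p F₀ F₁ c : ℝ}
    (hg' : UnitSpeed g' (ℓ' + β'))
    (hβ : 0 ≤ β) (hβ' : 0 ≤ β') (hℓ : 0 ≤ ℓ) (hℓ' : 0 ≤ ℓ')
    (hE : 1 ≤ E) (hc0 : 0 ≤ c) (hc1 : c ≤ 1)
    (H : ∀ s, 0 ≤ s → s ≤ 1 → dist (g (s * ℓ)) (g' (s * ℓ')) ≤ (1 - s) * E * p + κ)
    (hp : |ℓ - ℓ'| ≤ p) (h₀ : p ≤ F₀) (h₁ : |β - β'| ≤ F₁) (hpos : c * β ≤ (1 - c) * ℓ) :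
    dist (g (c * (ℓ + β))) (g' (c * (ℓ' + β'))) ≤ (1 - c) * E * F₀ + c * E * F₁ + κ := by
  have := dist_le_of_common_start (g := fun t => g (β + ℓ - t)) (g' := fun t => g' (β' + ℓ' - t))
    (α := β) (ℓ := ℓ) (α' := β') (ℓ' := ℓ') (E := E) (κ := κ) (q := p) (F₀ := F₁) (F₁ := F₀)
    (c := 1 - c) (fun s t hs hs' ht ht' => by
      have := hg' (β' + ℓ' - s) (β' + ℓ' - t) (by linarith) (by linarith) (by linarith)
        (by linarith)
      rw [this, ← abs_neg]; congr 1; ring)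
    hβ hβ' hℓ hℓ' hE (by linarith) (by linarith) (fun s hs hs' => by
      have := H (1 - s) (by linarith) (by linarith)
      have e : ∀ b l : ℝ, b + l - (b + s * l) = (1 - s) * l := fun b l => by ring
      simp only [e]
      rw [sub_sub_cancel] at this
      exact this) hp h₁ h₀ (by linarith)
  have e : ∀ b l : ℝ, b + l - (1 - c) * (b + l) = c * (l + b) := fun b l => by ring
  simp only [e] at this
  rw [sub_sub_cancel] at this
  linarith

/-- `A` and `B` meet in `p`, and the paths between them pass through `p`. -/
structure IsWedge (P : Z → Z → ℝ → Z) (p : Z) (A B : Set Z) : Prop where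
  left : p ∈ A
  right : p ∈ B
  dist_eq : ∀ a ∈ A, ∀ b ∈ B, dist a b = dist a p + dist p b
  path_left : ∀ a ∈ A, ∀ b ∈ B, ∀ t, 0 ≤ t → t ≤ dist a b →
    P a b t = if t ≤ dist a p then P a p t else P p b (t - dist a p)
  path_right : ∀ a ∈ A, ∀ b ∈ B, ∀ t, 0 ≤ t → t ≤ dist b a →
    P b a t = if t ≤ dist b p then P b p t else P p a (t - dist b p)

theorem IsWedge.symm {P : Z → Z → ℝ → Z} {p : Z} {A B : Set Z} (h : IsWedge P p A B) :
    IsWedge P p B A where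
  left := h.right
  right := h.left
  dist_eq b hb a ha := by
    rw [dist_comm, h.dist_eq a ha b hb, dist_comm a p, dist_comm p b, add_comm]
  path_left b hb a ha := h.path_right a ha b hb
  path_right b hb a ha := h.path_left a ha b hb

/-- On `[0, L]`, the path `g` is an initial part of a path between points of `A`. -/
def Inside (P : Z → Z → ℝ → Z) (A : Set Z) (g : ℝ → Z) (L : ℝ) : Prop :=
  ∃ z ∈ A, ∃ w ∈ A, 0 ≤ L ∧ L ≤ dist z w ∧ ∀ t, 0 ≤ t → t ≤ L → g t = P z w t

/-- On `[0, L]`, the path `g` runs from a point of `A` to `p`, and then follows an initial part of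
a path from `p` to a point of `B`. -/
def Crossing (P : Z → Z → ℝ → Z) (p : Z) (A B : Set Z) (g : ℝ → Z) (L : ℝ) : Prop :=
  ∃ z ∈ A, ∃ w ∈ B, ∃ m, 0 ≤ m ∧ m ≤ dist p w ∧ L = dist z p + m ∧
    (∀ t, 0 ≤ t → t ≤ dist z p → g t = P z p t) ∧ ∀ t, 0 ≤ t → t ≤ m → g (dist z p + t) = P p w t

theorem IsWedge.inside_or_crossing {P : Z → Z → ℝ → Z} {p : Z} {A B : Set Z}
    (h : IsWedge P p A B) {E C : ℝ} (hA : PathConvex P E C A) (hB : PathConvex P E C B)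
    {z w : Z} (hz : z ∈ A) (hw : w ∈ A ∪ B) {L : ℝ} (hL0 : 0 ≤ L) (hL : L ≤ dist z w) :
    Inside P A (P z w) L ∨ Crossing P p A B (P z w) L := by
  rcases hw with hw | hw
  · exact Or.inl ⟨z, hz, w, hw, hL0, hL, fun _ _ _ => rfl⟩
  rcases le_total L (dist z p) with hp | hp
  · refine Or.inl ⟨z, hz, p, h.left, hL0, hp, fun t h0 h1 => ?_⟩
    rw [h.path_left z hz w hw t h0 (h1.trans hL), if_pos (h1.trans hp)]
  · have hd := h.dist_eq z hz w hw
    refine Or.inr ⟨z, hz, w, hw, L - dist z p, by linarith, by linarith, by ring,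
      fun t h0 h1 => ?_, fun t h0 h1 => ?_⟩
    · rw [h.path_left z hz w hw t h0 (by linarith), if_pos h1]
    · rw [h.path_left z hz w hw _ (by positivity) (by linarith)]
      split_ifs with h2
      · have : t = 0 := by linarith
        rw [this, add_zero, hA.endpt z hz p h.left, hB.zero p h.right w hw]
      · rw [add_sub_cancel_left]

theorem IsWedge.cases {P : Z → Z → ℝ → Z} {p : Z} {A B : Set Z}
    (h : IsWedge P p A B) {E C : ℝ} (hA : PathConvex P E C A) (hB : PathConvex P E C B)
    {z w : Z} (hz : z ∈ A ∪ B) (hw : w ∈ A ∪ B) {L : ℝ} (hL0 : 0 ≤ L) (hL : L ≤ dist z w) :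
    (Inside P A (P z w) L ∨ Crossing P p A B (P z w) L) ∨
      (Inside P B (P z w) L ∨ Crossing P p B A (P z w) L) := by
  rcases hz with hz | hz
  · exact Or.inl (h.inside_or_crossing hA hB hz hw hL0 hL)
  · exact Or.inr (h.symm.inside_or_crossing hB hA hz hw.symm hL0 hL)

theorem Inside.unitSpeed {P : Z → Z → ℝ → Z} {A : Set Z} {E C : ℝ} (hA : PathConvex P E C A)
    {g : ℝ → Z} {L : ℝ} (h : Inside P A g L) : UnitSpeed g L := by
  obtain ⟨z, hz, w, hw, h0, h1, hg⟩ := h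
  intro s t hs hs' ht ht'
  rw [hg s hs hs', hg t ht ht', hA.geo z hz w hw s t hs (hs'.trans h1) ht (ht'.trans h1)]

theorem Crossing.unitSpeed {P : Z → Z → ℝ → Z} {p : Z} {A B : Set Z} (h : IsWedge P p A B)
    {E C : ℝ} (hA : PathConvex P E C A) (hB : PathConvex P E C B)
    {g : ℝ → Z} {L : ℝ} (hg : Crossing P p A B g L) : UnitSpeed g L := by
  obtain ⟨z, hz, w, hw, m, h0, h1, rfl, hg1, hg2⟩ := hg
  have key : ∀ s t, 0 ≤ s → s ≤ t → t ≤ dist z p + m → dist (g s) (g t) = |s - t| := by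
    intro s t hs hst ht
    have hpp := h.left
    rcases le_total t (dist z p) with h2 | h2
    · rw [hg1 s hs (hst.trans h2), hg1 t (hs.trans hst) h2,
        hA.geo z hz p hpp s t hs (hst.trans h2) (hs.trans hst) h2]
    · obtain ⟨t, rfl⟩ : ∃ t', t = dist z p + t' := ⟨t - dist z p, by ring⟩
      have ht0 : 0 ≤ t := by linarith
      rw [hg2 t ht0 (by linarith)]
      rcases le_total s (dist z p) with h3 | h3
      · rw [hg1 s hs h3, h.dist_eq _ (hA.mem z hz p hpp s hs h3) _
          (hB.mem p h.right w hw t ht0 (by linarith))]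
        have e1 := hA.geo z hz p hpp s (dist z p) hs h3 dist_nonneg le_rfl
        have e2 := hB.geo p h.right w hw 0 t le_rfl dist_nonneg ht0 (by linarith)
        rw [hA.endpt z hz p hpp] at e1
        rw [hB.zero p h.right w hw] at e2
        rw [e1, e2, abs_of_nonpos (by linarith), abs_of_nonpos (by linarith),
          abs_of_nonpos (by linarith)]
        ring
      · obtain ⟨s, rfl⟩ : ∃ t', s = dist z p + t' := ⟨s - dist z p, by ring⟩
        rw [hg2 s (by linarith) (by linarith),
          hB.geo p h.right w hw s t (by linarith) (by linarith) ht0 (by linarith)]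
        congr 1; ring
  intro s t hs hs' ht ht'
  rcases le_total s t with h | h
  · exact key s t hs h ht'
  · rw [dist_comm, key t s ht h hs', abs_sub_comm]

/-- The coarse convexity inequality for two paths of lengths `L` and `L'`. -/
def Comparable (E κ : ℝ) (g : ℝ → Z) (L : ℝ) (g' : ℝ → Z) (L' : ℝ) : Prop :=
  ∀ c, 0 ≤ c → c ≤ 1 → dist (g (c * L)) (g' (c * L')) ≤
    (1 - c) * E * dist (g 0) (g' 0) + c * E * dist (g L) (g' L') + κ

theorem Comparable.symm {E κ : ℝ} {g g' : ℝ → Z} {L L' : ℝ} (h : Comparable E κ g L g' L') :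
    Comparable E κ g' L' g L := by
  intro c h0 h1
  rw [dist_comm, dist_comm (g' 0), dist_comm (g' L')]
  exact h c h0 h1

section Comparison

variable {P : Z → Z → ℝ → Z} {p : Z} {A B : Set Z} {E C : ℝ} {g g' : ℝ → Z} {L L' : ℝ}

theorem Inside.comparable (hA : PathConvex P E C A) (h : Inside P A g L) (h' : Inside P A g' L') :
    Comparable E (2 * C) g L g' L' := by
  obtain ⟨z, hz, w, hw, h0, h1, hg⟩ := h
  obtain ⟨z', hz', w', hw', h0', h1', hg'⟩ := h'
  intro c hc hc'
  have e := mul_le_of_le_one_left h0 hc'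
  have e' := mul_le_of_le_one_left h0' hc'
  rw [hg _ (by positivity) e, hg' _ (by positivity) e', hg 0 le_rfl h0, hg' 0 le_rfl h0',
    hg L h0 le_rfl, hg' L' h0' le_rfl, hA.zero z hz w hw, hA.zero z' hz' w' hw']
  exact hA.pair z hz w hw z' hz' w' hw' L L' c h0 h1 h0' h1' hc hc'

/-- Two geodesics in different parts are both compared with the point `p`, which is why the constant
for pairs is twice the constant for points. -/
theorem Inside.comparable_inside (h : IsWedge P p A B) (hA : PathConvex P E C A)
    (hB : PathConvex P E C B) (hg : Inside P A g L) (hg' : Inside P B g' L') :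
    Comparable E (2 * C) g L g' L' := by
  obtain ⟨z, hz, w, hw, h0, h1, hg⟩ := hg
  obtain ⟨z', hz', w', hw', h0', h1', hg'⟩ := hg'
  intro c hc hc'
  have e := mul_le_of_le_one_left h0 hc'
  have e' := mul_le_of_le_one_left h0' hc'
  have ce : 0 ≤ c * L := by positivity
  have ce' : 0 ≤ c * L' := by positivity
  rw [hg _ (by positivity) e, hg' _ (by positivity) e', hg 0 le_rfl h0, hg' 0 le_rfl h0',
    hg L h0 le_rfl, hg' L' h0' le_rfl, hA.zero z hz w hw, hB.zero z' hz' w' hw',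
    h.dist_eq _ (hA.mem z hz w hw _ ce (e.trans h1)) _
      (hB.mem z' hz' w' hw' _ ce' (e'.trans h1')),
    h.dist_eq _ (hA.mem z hz w hw _ h0 h1) _ (hB.mem z' hz' w' hw' _ h0' h1'),
    h.dist_eq z hz z' hz', dist_comm p, dist_comm p, dist_comm p]
  have a1 := hA.point z hz w hw p h.left L c h0 h1 hc hc'
  have a2 := hB.point z' hz' w' hw' p h.right L' c h0' h1' hc hc'
  linarith

/-- The inequality between the part in `A` of a crossing geodesic and a geodesic in `A`: it is
applied to the part of the crossing geodesic in `A`, followed or preceded by a part outside. -/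
theorem Crossing.comparable_inside (h : IsWedge P p A B) (hA : PathConvex P E C A)
    (hB : PathConvex P E C B) (hE : 1 ≤ E) (hg : Crossing P p A B g L) (hg' : Inside P A g' L') :
    Comparable E (2 * C) g L g' L' := by
  have hu := hg.unitSpeed h hA hB
  have hu' := hg'.unitSpeed hA
  obtain ⟨z, hz, w, hw, m, h0, h1, rfl, hg1, hg2⟩ := hg
  obtain ⟨z', hz', w', hw', h0', h1', hg'⟩ := hg'
  intro c hc hc'
  have := dist_le_of_middle (g := g) (g' := g') (α := 0) (ℓ := dist z p) (β := m)
    (α' := 0) (ℓ' := L') (β' := 0) (E := E) (κ := 2 * C) (p := dist z z')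
    (q := dist p (P z' w' L'))
    (F₀ := dist (g 0) (g' 0)) (F₁ := dist (g (dist z p + m)) (g' L')) (c := c)
    (by simpa using hu) (by simpa using hu') le_rfl dist_nonneg h0 le_rfl h0' le_rfl hE hc hc'
    (fun s hs hs' => by
      have e := mul_le_of_le_one_left (dist_nonneg (x := z) (y := p)) hs'
      have e' := mul_le_of_le_one_left h0' hs'
      rw [zero_add, zero_add, hg1 _ (by positivity) e, hg' _ (by positivity) e']
      have := hA.pair z hz p h.left z' hz' w' hw' (dist z p) L' s dist_nonneg le_rfl h0' h1' hs hs'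
      rwa [hA.endpt z hz p h.left] at this)
    (by rw [hg1 0 le_rfl dist_nonneg, hg' 0 le_rfl h0', hA.zero z hz p h.left,
          hA.zero z' hz' w' hw', zero_add, zero_add])
    (by
      rw [hg2 m h0 le_rfl, hg' L' h0' le_rfl, dist_comm (P p w m),
        h.dist_eq _ (hA.mem z' hz' w' hw' L' h0' h1') _ (hB.mem p h.right w hw m h0 h1)]
      have e := hB.geo p h.right w hw 0 m le_rfl dist_nonneg h0 h1
      rw [hB.zero p h.right w hw, zero_sub, abs_neg, abs_of_nonneg h0] at e
      rw [e, dist_comm p]; linarith)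
  simpa using this

theorem Crossing.comparable_inside' (h : IsWedge P p A B) (hA : PathConvex P E C A)
    (hB : PathConvex P E C B) (hE : 1 ≤ E) (hg : Crossing P p B A g L) (hg' : Inside P A g' L') :
    Comparable E (2 * C) g L g' L' := by
  have hu := hg.unitSpeed h.symm hB hA
  have hu' := hg'.unitSpeed hA
  obtain ⟨z, hz, w, hw, m, h0, h1, rfl, hg1, hg2⟩ := hg
  obtain ⟨z', hz', w', hw', h0', h1', hg'⟩ := hg'
  intro c hc hc'
  have := dist_le_of_middle (g := g) (g' := g') (α := dist z p) (ℓ := m) (β := 0)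
    (α' := 0) (ℓ' := L') (β' := 0) (E := E) (κ := 2 * C) (p := dist p z')
    (q := dist (P p w m) (P z' w' L'))
    (F₀ := dist (g 0) (g' 0)) (F₁ := dist (g (dist z p + m)) (g' L')) (c := c)
    (by simpa using hu) (by simpa using hu') dist_nonneg h0 le_rfl le_rfl h0' le_rfl hE hc hc'
    (fun s hs hs' => by
      have e := mul_le_of_le_one_left h0 hs'
      have e' := mul_le_of_le_one_left h0' hs'
      rw [zero_add, hg2 _ (by positivity) e, hg' _ (by positivity) e']
      exact hA.pair p h.left w hw z' hz' w' hw' m L' s h0 h1 h0' h1' hs hs')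
    (by rw [hg1 0 le_rfl dist_nonneg, hg' 0 le_rfl h0', hB.zero z hz p h.right,
          hA.zero z' hz' w' hw', dist_comm z z', h.dist_eq z' hz' z hz, dist_comm p z,
          dist_comm p]
        linarith)
    (by rw [hg2 m h0 le_rfl, hg' L' h0' le_rfl, zero_add, zero_add])
  simpa using this

/-- The parts of the two geodesics in `A`, one of them ending and the other one starting in `p`, are
compared with each other. -/
theorem Crossing.comparable_opposite (h : IsWedge P p A B) (hA : PathConvex P E C A)
    (hB : PathConvex P E C B) (hE : 1 ≤ E) (hg : Crossing P p A B g L)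
    (hg' : Crossing P p B A g' L') : Comparable E (2 * C) g L g' L' := by
  have hu := hg.unitSpeed h hA hB
  have hu' := hg'.unitSpeed h.symm hB hA
  obtain ⟨z, hz, w, hw, m, h0, h1, rfl, hg1, hg2⟩ := hg
  obtain ⟨z', hz', w', hw', m', h0', h1', rfl, hg1', hg2'⟩ := hg'
  intro c hc hc'
  have := dist_le_of_middle (g := g) (g' := g') (α := 0) (ℓ := dist z p) (β := m)
    (α' := dist z' p) (ℓ' := m') (β' := 0) (E := E) (κ := 2 * C) (p := dist z p)
    (q := dist p (P p w' m'))
    (F₀ := dist (g 0) (g' 0)) (F₁ := dist (g (dist z p + m)) (g' (dist z' p + m'))) (c := c)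
    (by simpa using hu) (by simpa using hu') le_rfl dist_nonneg h0 dist_nonneg h0' le_rfl hE hc hc'
    (fun s hs hs' => by
      have e := mul_le_of_le_one_left (dist_nonneg (x := z) (y := p)) hs'
      have e' := mul_le_of_le_one_left h0' hs'
      rw [zero_add, hg1 _ (by positivity) e, hg2' _ (by positivity) e']
      have := hA.pair z hz p h.left p h.left w' hw' (dist z p) m' s dist_nonneg le_rfl h0' h1'
        hs hs'
      rwa [hA.endpt z hz p h.left] at this)
    (by rw [hg1 0 le_rfl dist_nonneg, hg1' 0 le_rfl dist_nonneg, hA.zero z hz p h.left,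
          hB.zero z' hz' p h.right, h.dist_eq z hz z' hz', dist_comm p z']; linarith)
    (by
      rw [hg2 m h0 le_rfl, hg2' m' h0' le_rfl, dist_comm (P p w m),
        h.dist_eq _ (hA.mem p h.left w' hw' m' h0' h1') _ (hB.mem p h.right w hw m h0 h1)]
      have e := hB.geo p h.right w hw 0 m le_rfl dist_nonneg h0 h1
      rw [hB.zero p h.right w hw, zero_sub, abs_neg, abs_of_nonneg h0] at e
      rw [e, dist_comm p]; linarith)
  simpa using this

/-- The case of two crossing geodesics of which the first one is still in `A` at time `c`: their
parts in `A` have the common end `p`. -/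
theorem Crossing.dist_le_of_before (h : IsWedge P p A B) (hA : PathConvex P E C A)
    (hB : PathConvex P E C B) (hE : 1 ≤ E) {z w z' w' : Z} (hz : z ∈ A) (hw : w ∈ B)
    (hz' : z' ∈ A) (hw' : w' ∈ B) {m m' c : ℝ} (h0 : 0 ≤ m) (h1 : m ≤ dist p w)
    (h0' : 0 ≤ m') (h1' : m' ≤ dist p w')
    (hg1 : ∀ t, 0 ≤ t → t ≤ dist z p → g t = P z p t)
    (hg2 : ∀ t, 0 ≤ t → t ≤ m → g (dist z p + t) = P p w t)
    (hg1' : ∀ t, 0 ≤ t → t ≤ dist z' p → g' t = P z' p t)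
    (hg2' : ∀ t, 0 ≤ t → t ≤ m' → g' (dist z' p + t) = P p w' t)
    (hu' : UnitSpeed g' (dist z' p + m')) (hc : 0 ≤ c) (hc' : c ≤ 1)
    (hpos : c * m ≤ (1 - c) * dist z p) :
    dist (g (c * (dist z p + m))) (g' (c * (dist z' p + m'))) ≤
      (1 - c) * E * dist (g 0) (g' 0) + c * E * dist (g (dist z p + m)) (g' (dist z' p + m')) +
        2 * C := by
  refine dist_le_of_common_end (p := dist z z') hu' h0 h0' dist_nonneg dist_nonneg hE hc hc'
    (fun s hs hs' => ?_) ?_ ?_ ?_ hpos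
  · have e := mul_le_of_le_one_left (dist_nonneg (x := z) (y := p)) hs'
    have e' := mul_le_of_le_one_left (dist_nonneg (x := z') (y := p)) hs'
    rw [hg1 _ (by positivity) e, hg1' _ (by positivity) e']
    have := hA.pair z hz p h.left z' hz' p h.left (dist z p) (dist z' p) s dist_nonneg le_rfl
      dist_nonneg le_rfl hs hs'
    rw [hA.endpt z hz p h.left, hA.endpt z' hz' p h.left, dist_self] at this
    linarith
  · rw [abs_le]
    have := dist_triangle z z' p
    have := dist_triangle_left z' p z
    constructor <;> linarith
  · rw [hg1 0 le_rfl dist_nonneg, hg1' 0 le_rfl dist_nonneg, hA.zero z hz p h.left,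
      hA.zero z' hz' p h.left]
  · rw [hg2 m h0 le_rfl, hg2' m' h0' le_rfl]
    have e := hB.geo p h.right w hw 0 m le_rfl dist_nonneg h0 h1
    have e' := hB.geo p h.right w' hw' 0 m' le_rfl dist_nonneg h0' h1'
    rw [hB.zero p h.right w hw, zero_sub, abs_neg, abs_of_nonneg h0] at e
    rw [hB.zero p h.right w' hw', zero_sub, abs_neg, abs_of_nonneg h0'] at e'
    have t1 := dist_triangle p (P p w m) (P p w' m')
    have t2 := dist_triangle_right p (P p w m) (P p w' m')
    rw [abs_le]
    constructor <;> linarith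

/-- If at time `c` one of the two geodesics is still in `A`, the parts in `A` are compared,
otherwise the parts in `B`. -/
theorem Crossing.comparable (h : IsWedge P p A B) (hA : PathConvex P E C A)
    (hB : PathConvex P E C B) (hE : 1 ≤ E) (hg : Crossing P p A B g L)
    (hg' : Crossing P p A B g' L') : Comparable E (2 * C) g L g' L' := by
  have hu := hg.unitSpeed h hA hB
  have hu' := hg'.unitSpeed h hA hB
  obtain ⟨z, hz, w, hw, m, h0, h1, rfl, hg1, hg2⟩ := hg
  obtain ⟨z', hz', w', hw', m', h0', h1', rfl, hg1', hg2'⟩ := hg'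
  intro c hc hc'
  rcases le_total (c * m) ((1 - c) * dist z p) with k | k
  · exact dist_le_of_before h hA hB hE hz hw hz' hw' h0 h1 h0' h1' hg1 hg2 hg1' hg2' hu' hc hc' k
  rcases le_total (c * m') ((1 - c) * dist z' p) with k' | k'
  · have := dist_le_of_before h hA hB hE hz' hw' hz hw h0' h1' h0 h1 hg1' hg2' hg1 hg2 hu hc hc' k'
    rw [dist_comm, dist_comm (g' 0), dist_comm (g' (dist z' p + m'))] at this
    exact this
  refine dist_le_of_common_start (q := dist (P p w m) (P p w' m')) hu' dist_nonneg dist_nonneg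
    h0 h0' hE hc hc' (fun s hs hs' => ?_) ?_ ?_ ?_ k
  · have e := mul_le_of_le_one_left h0 hs'
    have e' := mul_le_of_le_one_left h0' hs'
    rw [hg2 _ (by positivity) e, hg2' _ (by positivity) e']
    have := hB.pair p h.right w hw p h.right w' hw' m m' s h0 h1 h0' h1' hs hs'
    rw [dist_self] at this
    linarith
  · have e := hB.geo p h.right w hw 0 m le_rfl dist_nonneg h0 h1
    have e' := hB.geo p h.right w' hw' 0 m' le_rfl dist_nonneg h0' h1'
    rw [hB.zero p h.right w hw, zero_sub, abs_neg, abs_of_nonneg h0] at e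
    rw [hB.zero p h.right w' hw', zero_sub, abs_neg, abs_of_nonneg h0'] at e'
    have t1 := dist_triangle p (P p w m) (P p w' m')
    have t2 := dist_triangle_right p (P p w m) (P p w' m')
    rw [abs_le]
    constructor <;> linarith
  · rw [hg1 0 le_rfl dist_nonneg, hg1' 0 le_rfl dist_nonneg, hA.zero z hz p h.left,
      hA.zero z' hz' p h.left, abs_le]
    have := dist_triangle z z' p
    have := dist_triangle_left z' p z
    constructor <;> linarith
  · rw [hg2 m h0 le_rfl, hg2' m' h0' le_rfl]

theorem Inside.comparable_const (h : IsWedge P p A B) (hA : PathConvex P E C A)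
    (hE : 1 ≤ E) (hg : Inside P A g L) {o : Z} (ho : o ∈ A ∪ B) :
    Comparable E C g L (fun _ => o) 0 := by
  obtain ⟨z, hz, w, hw, h0, h1, hg⟩ := hg
  intro c hc hc'
  have e := mul_le_of_le_one_left h0 hc'
  rw [hg _ (by positivity) e, hg 0 le_rfl h0, hg L h0 le_rfl, hA.zero z hz w hw]
  rcases ho with ho | ho
  · exact hA.point z hz w hw o ho L c h0 h1 hc hc'
  · rw [h.dist_eq _ (hA.mem z hz w hw _ (by positivity) (e.trans h1)) o ho,
      h.dist_eq _ (hA.mem z hz w hw _ h0 h1) o ho, h.dist_eq z hz o ho]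
    have := hA.point z hz w hw p h.left L c h0 h1 hc hc'
    nlinarith [dist_nonneg (x := p) (y := o)]

theorem unitSpeed_const (o : Z) : UnitSpeed (fun _ => o) 0 := by
  intro s t hs hs' ht ht'
  rw [le_antisymm hs' hs, le_antisymm ht' ht]; simp

theorem Crossing.comparable_const (h : IsWedge P p A B) (hA : PathConvex P E C A)
    (hB : PathConvex P E C B) (hE : 1 ≤ E) (hg : Crossing P p A B g L) {o : Z} (ho : o ∈ A ∪ B) :
    Comparable E C g L (fun _ => o) 0 := by
  have hu := hg.unitSpeed h hA hB
  obtain ⟨z, hz, w, hw, m, h0, h1, rfl, hg1, hg2⟩ := hg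
  have ee := hB.geo p h.right w hw 0 m le_rfl dist_nonneg h0 h1
  rw [hB.zero p h.right w hw, zero_sub, abs_neg, abs_of_nonneg h0] at ee
  intro c hc hc'
  rcases ho with ho | ho
  · have := dist_le_of_middle (g := g) (g' := fun _ => o) (α := 0) (ℓ := dist z p) (β := m)
      (α' := 0) (ℓ' := 0) (β' := 0) (E := E) (κ := C) (p := dist z o)
      (q := dist p o) (F₀ := dist (g 0) o) (F₁ := dist (g (dist z p + m)) o) (c := c)
      (by simpa using hu) (by simpa using unitSpeed_const o) le_rfl dist_nonneg h0 le_rfl le_rfl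
      le_rfl hE hc hc'
      (fun s hs hs' => by
        have e := mul_le_of_le_one_left (dist_nonneg (x := z) (y := p)) hs'
        rw [zero_add, hg1 _ (by positivity) e]
        have := hA.point z hz p h.left o ho (dist z p) s dist_nonneg le_rfl hs hs'
        rwa [hA.endpt z hz p h.left] at this)
      (by rw [hg1 0 le_rfl dist_nonneg, hA.zero z hz p h.left, zero_add, zero_add])
      (by
        rw [hg2 m h0 le_rfl, dist_comm (P p w m),
          h.dist_eq o ho _ (hB.mem p h.right w hw m h0 h1), ee, dist_comm p]; linarith)
    simpa using this
  · have := dist_le_of_middle (g := g) (g' := fun _ => o) (α := dist z p) (ℓ := m) (β := 0)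
      (α' := 0) (ℓ' := 0) (β' := 0) (E := E) (κ := C) (p := dist p o)
      (q := dist (P p w m) o) (F₀ := dist (g 0) o) (F₁ := dist (g (dist z p + m)) o) (c := c)
      (by simpa using hu) (by simpa using unitSpeed_const o) dist_nonneg h0 le_rfl le_rfl le_rfl
      le_rfl hE hc hc'
      (fun s hs hs' => by
        have e := mul_le_of_le_one_left h0 hs'
        rw [hg2 _ (by positivity) e]
        exact hB.point p h.right w hw o ho m s h0 h1 hs hs')
      (by rw [hg1 0 le_rfl dist_nonneg, hA.zero z hz p h.left, h.dist_eq z hz o ho]; linarith)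
      (by rw [hg2 m h0 le_rfl, zero_add, zero_add])
    simpa using this

end Comparison

section Union

variable {P : Z → Z → ℝ → Z} {p : Z} {A B : Set Z} {E C : ℝ}

theorem IsWedge.zero (h : IsWedge P p A B) (hA : PathConvex P E C A) {z : Z} (hz : z ∈ A) {w : Z}
    (hw : w ∈ A ∪ B) : P z w 0 = z := by
  rcases hw with hw | hw
  · exact hA.zero z hz w hw
  · rw [h.path_left z hz w hw 0 le_rfl dist_nonneg, if_pos dist_nonneg, hA.zero z hz p h.left]

theorem IsWedge.endpt (h : IsWedge P p A B) (hA : PathConvex P E C A)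
    (hB : PathConvex P E C B) {z : Z} (hz : z ∈ A) {w : Z} (hw : w ∈ A ∪ B) :
    P z w (dist z w) = w := by
  rcases hw with hw | hw
  · exact hA.endpt z hz w hw
  · rw [h.path_left z hz w hw _ dist_nonneg le_rfl, h.dist_eq z hz w hw]
    split_ifs with h1
    · have h2 : dist p w = 0 := le_antisymm (by linarith) dist_nonneg
      rw [h2, add_zero, hA.endpt z hz p h.left, dist_eq_zero.1 h2]
    · rw [add_sub_cancel_left, hB.endpt p h.right w hw]

theorem IsWedge.mem (h : IsWedge P p A B) (hA : PathConvex P E C A)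
    (hB : PathConvex P E C B) {z : Z} (hz : z ∈ A) {w : Z} (hw : w ∈ A ∪ B) {t : ℝ} (h0 : 0 ≤ t)
    (h1 : t ≤ dist z w) : P z w t ∈ A ∪ B := by
  rcases hw with hw | hw
  · exact Or.inl (hA.mem z hz w hw t h0 h1)
  · rw [h.path_left z hz w hw t h0 h1]
    rw [h.dist_eq z hz w hw] at h1
    split_ifs with h2
    · exact Or.inl (hA.mem z hz p h.left t h0 h2)
    · exact Or.inr (hB.mem p h.right w hw _ (by linarith) (by linarith))

/-- A wedge of two convex subsets is convex, with the same constants. -/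
theorem PathConvex.union (h : IsWedge P p A B) (hA : PathConvex P E C A)
    (hB : PathConvex P E C B) (hE : 1 ≤ E) : PathConvex P E C (A ∪ B) := by
  have zero : ∀ z ∈ A ∪ B, ∀ w ∈ A ∪ B, P z w 0 = z := by
    rintro z (hz | hz) w hw
    · exact h.zero hA hz hw
    · exact h.symm.zero hB hz hw.symm
  refine ⟨?_, zero, ?_, ?_, ?_, ?_⟩
  · rintro z (hz | hz) w hw t h0 h1
    · exact h.mem hA hB hz hw h0 h1
    · exact (h.symm.mem hB hA hz hw.symm h0 h1).symm
  · rintro z (hz | hz) w hw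
    · exact h.endpt hA hB hz hw
    · exact h.symm.endpt hB hA hz hw.symm
  · intro z hz w hw
    rcases h.cases hA hB hz hw dist_nonneg le_rfl with (k | k) | (k | k)
    · exact k.unitSpeed hA
    · exact k.unitSpeed h hA hB
    · exact k.unitSpeed hB
    · exact k.unitSpeed h.symm hB hA
  · intro z hz w hw o ho L c h0 h1 hc hc'
    have : Comparable E C (P z w) L (fun _ => o) 0 := by
      rcases h.cases hA hB hz hw h0 h1 with (k | k) | (k | k)
      · exact k.comparable_const h hA hE ho
      · exact k.comparable_const h hA hB hE ho
      · exact k.comparable_const h.symm hB hE ho.symm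
      · exact k.comparable_const h.symm hB hA hE ho.symm
    have := this c hc hc'
    rwa [zero z hz w hw] at this
  · intro z hz w hw z' hz' w' hw' L L' c h0 h1 h0' h1' hc hc'
    have : Comparable E (2 * C) (P z w) L (P z' w') L' := by
      have s := h.symm
      rcases h.cases hA hB hz hw h0 h1 with (k | k) | (k | k) <;>
        rcases h.cases hA hB hz' hw' h0' h1' with (k' | k') | (k' | k')
      · exact k.comparable hA k'
      · exact (k'.comparable_inside h hA hB hE k).symm
      · exact k.comparable_inside h hA hB k'
      · exact (k'.comparable_inside' h hA hB hE k).symm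
      · exact k.comparable_inside h hA hB hE k'
      · exact k.comparable h hA hB hE k'
      · exact k.comparable_inside' s hB hA hE k'
      · exact k.comparable_opposite h hA hB hE k'
      · exact k.comparable_inside s hB hA k'
      · exact (k'.comparable_inside' s hB hA hE k).symm
      · exact k.comparable hB k'
      · exact (k'.comparable_inside s hB hA hE k).symm
      · exact k.comparable_inside' h hA hB hE k'
      · exact k.comparable_opposite s hB hA hE k'
      · exact k.comparable_inside s hB hA hE k'
      · exact k.comparable s hB hA hE k'
    have := this c hc hc'
    rwa [zero z hz w hw, zero z' hz' w' hw'] at this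

/-- Convexity only depends on the finite subsets. -/
theorem PathConvex.of_finite {K : Set Z}
    (h : ∀ s : Set Z, s.Finite → s ⊆ K → ∃ K' ⊆ K, s ⊆ K' ∧ PathConvex P E C K') :
    PathConvex P E C K := by
  have h2 : ∀ z ∈ K, ∀ w ∈ K, ∃ K' ⊆ K, z ∈ K' ∧ w ∈ K' ∧ PathConvex P E C K' := by
    intro z hz w hw
    obtain ⟨K', h1, h2, h3⟩ := h {z, w} (by simp) (by
      rintro _ (rfl | rfl) <;> assumption)
    exact ⟨K', h1, h2 (by simp), h2 (by simp), h3⟩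
  refine ⟨?_, ?_, ?_, ?_, ?_, ?_⟩
  · intro z hz w hw
    obtain ⟨K', h1, a, b, h3⟩ := h2 z hz w hw
    exact fun t h0 ht => h1 (h3.mem z a w b t h0 ht)
  · intro z hz w hw
    obtain ⟨K', h1, a, b, h3⟩ := h2 z hz w hw
    exact h3.zero z a w b
  · intro z hz w hw
    obtain ⟨K', h1, a, b, h3⟩ := h2 z hz w hw
    exact h3.endpt z a w b
  · intro z hz w hw
    obtain ⟨K', h1, a, b, h3⟩ := h2 z hz w hw
    exact h3.geo z a w b
  · intro z hz w hw o ho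
    obtain ⟨K', h1, h2, h3⟩ := h {z, w, o} (by simp) (by
      rintro _ (rfl | rfl | rfl) <;> assumption)
    exact h3.point z (h2 (by simp)) w (h2 (by simp)) o (h2 (by simp))
  · intro z hz w hw z' hz' w' hw'
    obtain ⟨K', h1, h2, h3⟩ := h {z, w, z', w'} (by simp) (by
      rintro _ (rfl | rfl | rfl | rfl) <;> assumption)
    exact h3.pair z (h2 (by simp)) w (h2 (by simp)) z' (h2 (by simp)) w' (h2 (by simp))

end Union

end Wedge

/-! ### The bicombing of a tree of spaces is coarsely convex -/

section Segments

variable {Z : Type*} [MetricSpace Z] {P : Z → Z → ℝ → Z} {p : Z} {A B : Set Z} {E C : ℝ}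

theorem IsWedge.mono (h : IsWedge P p A B) {A' B' : Set Z} (hA : A' ⊆ A) (hB : B' ⊆ B)
    (hpA : p ∈ A') (hpB : p ∈ B') : IsWedge P p A' B' where
  left := hpA
  right := hpB
  dist_eq a ha b hb := h.dist_eq a (hA ha) b (hB hb)
  path_left a ha b hb := h.path_left a (hA ha) b (hB hb)
  path_right a ha b hb := h.path_right a (hA ha) b (hB hb)

theorem PathConvex.image {Z' : Type*} [MetricSpace Z'] {P' : Z' → Z' → ℝ → Z'} {K : Set Z'}
    (h : PathConvex P' E C K) (f : Z' → Z) (hf : ∀ z w, dist (f z) (f w) = dist z w)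
    (hP : ∀ z ∈ K, ∀ w ∈ K, ∀ t, 0 ≤ t → t ≤ dist z w → P (f z) (f w) t = f (P' z w t)) :
    PathConvex P E C (f '' K) := by
  refine ⟨?_, ?_, ?_, ?_, ?_, ?_⟩
  · rintro _ ⟨z, hz, rfl⟩ _ ⟨w, hw, rfl⟩ t h0 h1
    rw [hf] at h1
    exact ⟨_, h.mem z hz w hw t h0 h1, (hP z hz w hw t h0 h1).symm⟩
  · rintro _ ⟨z, hz, rfl⟩ _ ⟨w, hw, rfl⟩
    rw [hP z hz w hw 0 le_rfl dist_nonneg, h.zero z hz w hw]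
  · rintro _ ⟨z, hz, rfl⟩ _ ⟨w, hw, rfl⟩
    rw [hf, hP z hz w hw _ dist_nonneg le_rfl, h.endpt z hz w hw]
  · rintro _ ⟨z, hz, rfl⟩ _ ⟨w, hw, rfl⟩ s t hs hs' ht ht'
    rw [hf] at hs' ht'
    rw [hP z hz w hw s hs hs', hP z hz w hw t ht ht', hf, h.geo z hz w hw s t hs hs' ht ht']
  · rintro _ ⟨z, hz, rfl⟩ _ ⟨w, hw, rfl⟩ _ ⟨o, ho, rfl⟩ L c h0 h1 hc hc'
    rw [hf] at h1
    rw [hP z hz w hw _ (by positivity) ((mul_le_of_le_one_left h0 hc').trans h1),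
      hP z hz w hw L h0 h1, hf, hf, hf]
    exact h.point z hz w hw o ho L c h0 h1 hc hc'
  · rintro _ ⟨z, hz, rfl⟩ _ ⟨w, hw, rfl⟩ _ ⟨z', hz', rfl⟩ _ ⟨w', hw', rfl⟩ L L' c h0 h1 h0' h1'
      hc hc'
    rw [hf] at h1 h1'
    rw [hP z hz w hw _ (by positivity) ((mul_le_of_le_one_left h0 hc').trans h1),
      hP z' hz' w' hw' _ (by positivity) ((mul_le_of_le_one_left h0' hc').trans h1'),
      hP z hz w hw L h0 h1, hP z' hz' w' hw' L' h0' h1', hf, hf, hf]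
    exact h.pair z hz w hw z' hz' w' hw' L L' c h0 h1 h0' h1' hc hc'

/-- A segment is convex. -/
theorem PathConvex.segment (hE : 1 ≤ E) (hC : 0 ≤ C) (f : ℝ → Z)
    (hf : ∀ s ∈ Set.Icc (0 : ℝ) 1, ∀ t ∈ Set.Icc (0 : ℝ) 1, dist (f s) (f t) = |s - t|)
    (hP : ∀ s ∈ Set.Icc (0 : ℝ) 1, ∀ t ∈ Set.Icc (0 : ℝ) 1, ∀ τ, 0 ≤ τ → τ ≤ |s - t| →
      P (f s) (f t) τ = f (if s ≤ t then s + τ else s - τ)) :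
    PathConvex P E C (f '' Set.Icc 0 1) := by
  set q : ℝ → ℝ → ℝ → ℝ := fun s t τ => if s ≤ t then s + τ else s - τ with hq
  have hmem : ∀ s ∈ Set.Icc (0 : ℝ) 1, ∀ t ∈ Set.Icc (0 : ℝ) 1, ∀ τ, 0 ≤ τ → τ ≤ |s - t| →
      q s t τ ∈ Set.Icc (0 : ℝ) 1 := by
    rintro s ⟨hs, hs'⟩ t ⟨ht, ht'⟩ τ h0 h1
    simp only [hq]
    split_ifs with h
    · rw [abs_of_nonpos (by linarith)] at h1
      exact ⟨by linarith, by linarith⟩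
    · rw [abs_of_nonneg (by linarith)] at h1
      exact ⟨by linarith, by linarith⟩
  -- the signed speed is constant, so positions depend affinely on the parameter
  have haff : ∀ s t, ∃ ε : ℝ, (ε = 1 ∨ ε = -1) ∧ ∀ τ, q s t τ = s + ε * τ := by
    intro s t
    simp only [hq]
    split_ifs with h
    · exact ⟨1, Or.inl rfl, fun τ => by ring⟩
    · exact ⟨-1, Or.inr rfl, fun τ => by ring⟩
  have hcomb : ∀ (x y c : ℝ), 0 ≤ c → c ≤ 1 →
      |(1 - c) * x + c * y| ≤ (1 - c) * E * |x| + c * E * |y| := by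
    intro x y c hc hc'
    refine (abs_add_le _ _).trans ?_
    rw [abs_mul, abs_mul, abs_of_nonneg hc, abs_of_nonneg (by linarith : 0 ≤ 1 - c)]
    have a1 : 0 ≤ (1 - c) * |x| := mul_nonneg (by linarith) (abs_nonneg _)
    have a2 : 0 ≤ c * |y| := by positivity
    nlinarith
  refine ⟨?_, ?_, ?_, ?_, ?_, ?_⟩
  · rintro _ ⟨s, hs, rfl⟩ _ ⟨t, ht, rfl⟩ τ h0 h1
    rw [hf s hs t ht] at h1
    exact ⟨_, hmem s hs t ht τ h0 h1, (hP s hs t ht τ h0 h1).symm⟩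
  · rintro _ ⟨s, hs, rfl⟩ _ ⟨t, ht, rfl⟩
    rw [hP s hs t ht 0 le_rfl (abs_nonneg _)]
    simp
  · rintro _ ⟨s, hs, rfl⟩ _ ⟨t, ht, rfl⟩
    rw [hf s hs t ht, hP s hs t ht _ (abs_nonneg _) le_rfl]
    split_ifs with h
    · rw [abs_of_nonpos (by linarith)]; congr 1; ring
    · rw [abs_of_nonneg (by linarith)]; congr 1; ring
  · rintro _ ⟨s, hs, rfl⟩ _ ⟨t, ht, rfl⟩ τ σ h0 h1 h0' h1'
    rw [hf s hs t ht] at h1 h1'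
    rw [hP s hs t ht τ h0 h1, hP s hs t ht σ h0' h1',
      hf _ (hmem s hs t ht τ h0 h1) _ (hmem s hs t ht σ h0' h1')]
    obtain ⟨ε, hε, h⟩ := haff s t
    rw [h, h]
    rcases hε with rfl | rfl
    · congr 1; ring
    · rw [← abs_neg]; congr 1; ring
  · rintro _ ⟨s, hs, rfl⟩ _ ⟨t, ht, rfl⟩ _ ⟨o, ho, rfl⟩ L c h0 h1 hc hc'
    rw [hf s hs t ht] at h1
    have e := (mul_le_of_le_one_left h0 hc').trans h1
    have ce : 0 ≤ c * L := by positivity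
    rw [hP s hs t ht _ ce e, hP s hs t ht L h0 h1, hf _ (hmem s hs t ht _ ce e) o ho,
      hf _ (hmem s hs t ht _ h0 h1) o ho, hf s hs o ho]
    obtain ⟨ε, -, h⟩ := haff s t
    change |q s t (c * L) - o| ≤ _ + _ * |q s t L - o| + _
    rw [h, h]
    have := hcomb (s - o) (s + ε * L - o) c hc hc'
    have e2 : s + ε * (c * L) - o = (1 - c) * (s - o) + c * (s + ε * L - o) := by ring
    rw [e2]
    linarith
  · rintro _ ⟨s, hs, rfl⟩ _ ⟨t, ht, rfl⟩ _ ⟨s', hs', rfl⟩ _ ⟨t', ht', rfl⟩ L L' c h0 h1 h0' h1'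
      hc hc'
    rw [hf s hs t ht] at h1
    rw [hf s' hs' t' ht'] at h1'
    have e := (mul_le_of_le_one_left h0 hc').trans h1
    have ce : 0 ≤ c * L := by positivity
    have e' := (mul_le_of_le_one_left h0' hc').trans h1'
    have ce' : 0 ≤ c * L' := by positivity
    rw [hP s hs t ht _ ce e, hP s hs t ht L h0 h1, hP s' hs' t' ht' _ ce' e',
      hP s' hs' t' ht' L' h0' h1', hf _ (hmem s hs t ht _ ce e) _ (hmem s' hs' t' ht' _ ce' e'),
      hf _ (hmem s hs t ht _ h0 h1) _ (hmem s' hs' t' ht' _ h0' h1'), hf s hs s' hs']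
    obtain ⟨ε, -, h⟩ := haff s t
    obtain ⟨ε', -, h'⟩ := haff s' t'
    change |q s t (c * L) - q s' t' (c * L')| ≤ _ + _ * |q s t L - q s' t' L'| + _
    rw [h, h, h', h']
    have := hcomb (s - s') (s + ε * L - (s' + ε' * L')) c hc hc'
    have e2 : s + ε * (c * L) - (s' + ε' * (c * L')) =
      (1 - c) * (s - s') + c * (s + ε * L - (s' + ε' * L')) := by ring
    rw [e2]
    linarith

end Segments

namespace GCCBicombing

variable {X : Type u} [MetricSpace X] (γ : GCCBicombing X)

/-- The coarse convexity inequality in the arc length parametrisation. -/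
theorem dist_reparam_mul_le (x y x' y' : X) {L L' c : ℝ} (h0 : 0 ≤ L) (h1 : L ≤ dist x y)
    (h0' : 0 ≤ L') (h1' : L' ≤ dist x' y') (hc : 0 ≤ c) (hc' : c ≤ 1) :
    dist (reparam γ.toFun x y (c * L)) (reparam γ.toFun x' y' (c * L')) ≤
      (1 - c) * γ.E * dist x x' +
        c * γ.E * dist (reparam γ.toFun x y L) (reparam γ.toFun x' y' L') + γ.C := by
  rw [γ.reparam_of_le x y h0 h1, γ.reparam_of_le x' y' h0' h1',
    γ.reparam_of_le x y (by positivity) ((mul_le_of_le_one_left h0 hc').trans h1),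
    γ.reparam_of_le x' y' (by positivity) ((mul_le_of_le_one_left h0' hc').trans h1')]
  have := γ.convex x x' y y' ⟨L / dist x y, unitInterval.div_mem h0 dist_nonneg h1⟩
    ⟨L' / dist x' y', unitInterval.div_mem h0' dist_nonneg h1'⟩ ⟨c, hc, hc'⟩
  convert this using 3
  · ext; simp [mul_div_assoc]
  · ext; simp [mul_div_assoc]

theorem dist_reparam_mul_point_le (x y o : X) {L c : ℝ} (h0 : 0 ≤ L) (h1 : L ≤ dist x y)
    (hc : 0 ≤ c) (hc' : c ≤ 1) :
    dist (reparam γ.toFun x y (c * L)) o ≤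
      (1 - c) * γ.E * dist x o + c * γ.E * dist (reparam γ.toFun x y L) o + γ.C := by
  have := γ.dist_reparam_mul_le x y o o h0 h1 le_rfl dist_nonneg hc hc'
  rw [mul_zero, γ.reparam_zero] at this
  exact this

theorem pathConvex {E C : ℝ} (hE : γ.E ≤ E) (hC : γ.C ≤ C) :
    PathConvex (reparam γ.toFun) E C Set.univ := by
  have hC0 := γ.C_nonneg
  refine ⟨fun _ _ _ _ _ _ _ => Set.mem_univ _, fun z _ w _ => γ.reparam_zero z w,
    fun z _ w _ => γ.reparam_of_ge z w le_rfl,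
    fun z _ w _ s t h0 h1 h0' h1' => γ.dist_reparam z w h0 h1 h0' h1', ?_, ?_⟩
  · intro z _ w _ o _ L c h0 h1 hc hc'
    have := γ.dist_reparam_mul_point_le z w o h0 h1 hc hc'
    have a1 : (1 - c) * γ.E * dist z o ≤ (1 - c) * E * dist z o := by gcongr
    have a2 : c * γ.E * dist (reparam γ.toFun z w L) o ≤
      c * E * dist (reparam γ.toFun z w L) o := by gcongr
    linarith
  · intro z _ w _ z' _ w' _ L L' c h0 h1 h0' h1' hc hc'
    have := γ.dist_reparam_mul_le z w z' w' h0 h1 h0' h1' hc hc'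
    have a1 : (1 - c) * γ.E * dist z z' ≤ (1 - c) * E * dist z z' := by gcongr
    have a2 : c * γ.E * dist (reparam γ.toFun z w L) (reparam γ.toFun z' w' L') ≤
      c * E * dist (reparam γ.toFun z w L) (reparam γ.toFun z' w' L') := by gcongr
    linarith

end GCCBicombing

namespace TreeOf

variable {S : Bool → Type u} [∀ i, MetricSpace (S i)] {N : ∀ i, Net.{u, v} (S i)}
  (γ : ∀ i, GCCBicombing (S i))

/-- The bicombing maps of a family of bicombings. -/
abbrev maps (γ : ∀ i, GCCBicombing (S i)) : ∀ i, S i → S i → unitInterval → S i :=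
  fun i => (γ i).toFun

section Unfold

variable {i r : Bool} (x : S i) (a : Letter N i r) (t : Set.Ioo (0 : ℝ) 1)
  (z : TreeOf N (!i) false)

theorem gate_sheet : gate (sheet x : TreeOf N i r) = x := by simp only [gate]
theorem gate_edge : gate (edge a t) = (N i).toSpace a.1 := by simp only [gate]
theorem gate_branch : gate (branch a z) = (N i).toSpace a.1 := by simp only [gate]
theorem depth_sheet : depth (sheet x : TreeOf N i r) = 0 := by simp only [depth]
theorem depth_edge : depth (edge a t) = t := by simp only [depth]
theorem depth_branch : depth (branch a z) = 1 + height z := by simp only [depth, height]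
theorem height_sheet_pt : height (sheet (N i).pt : TreeOf N i r) = 0 := by
  rw [height, gate_sheet, depth_sheet, dist_self, add_zero]

end Unfold

/-- `z` is an interior point of the edge of the letter `a`, or lies beyond that edge. -/
def Behind {i r : Bool} (a : Letter N i r) : TreeOf N i r → Prop
  | sheet _ => False
  | edge b _ => b = a
  | branch b _ => b = a

theorem Behind.gate_eq {i r : Bool} {a : Letter N i r} {z : TreeOf N i r} (h : Behind a z) :
    gate z = (N i).toSpace a.1 := by
  cases z
  · exact h.elim
  · cases h; rfl
  · cases h; rfl

theorem not_together_of_not_behind {i r : Bool} {a : Letter N i r} {z w : TreeOf N i r}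
    (hz : ¬ Behind a z) (hw : Behind a w) : ¬ Together z w := by
  intro h
  cases z <;> cases w <;> simp_all [Together, Behind]

theorem path_of_not_together (g : ∀ i, S i → S i → unitInterval → S i) {i r : Bool}
    {z w : TreeOf N i r} (h : ¬ Together z w) : path g z w = through g z w := by
  cases z <;> cases w <;> simp_all [Together, path]

theorem dist_of_not_together {i r : Bool} {z w : TreeOf N i r} (h : ¬ Together z w) :
    dist z w = depth z + dist (gate z) (gate w) + depth w := treeDist_of_not_together h

theorem not_together_sheet {i r : Bool} (x : S i) (w : TreeOf N i r) : ¬ Together (sheet x) w := by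
  cases w <;> exact id

theorem not_together_sheet' {i r : Bool} (x : S i) (w : TreeOf N i r) :
    ¬ Together w (sheet x) := fun h => not_together_sheet x w h.symm

theorem dist_sheet {i r : Bool} (x : S i) (w : TreeOf N i r) :
    dist (sheet x) w = dist x (gate w) + depth w := by
  rw [dist_of_not_together (not_together_sheet x w)]
  simp [depth_sheet, gate_sheet]

theorem dist_sheet' {i r : Bool} (x : S i) (w : TreeOf N i r) :
    dist w (sheet x) = depth w + dist (gate w) x := by
  rw [dist_of_not_together (not_together_sheet' x w)]
  simp [depth_sheet, gate_sheet]

theorem path_sheet {i r : Bool} (x : S i) (w : TreeOf N i r) {t : ℝ} (ht : 0 ≤ t) :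
    path (maps γ) (sheet x) w t =
      if t ≤ dist x (gate w) then sheet (reparam (γ i).toFun x (gate w) t)
      else enter (maps γ) w (t - dist x (gate w)) := by
  rw [path_of_not_together _ (not_together_sheet x w)]
  simp only [through, cat, depth_sheet, gate_sheet, exit, sheetPath, sub_zero]
  split_ifs with h1 h2 h2
  · rw [le_antisymm h1 ht, (γ i).reparam_zero]
  · exact absurd (h1.trans dist_nonneg) h2
  · rfl
  · rfl

theorem path_sheet' {i r : Bool} (x : S i) (w : TreeOf N i r) {t : ℝ}
    (ht : t ≤ dist w (sheet x)) :
    path (maps γ) w (sheet x) t =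
      if t ≤ depth w then exit (maps γ) w t
      else sheet (reparam (γ i).toFun (gate w) x (t - depth w)) := by
  rw [dist_sheet'] at ht
  rw [path_of_not_together _ (not_together_sheet' x w)]
  simp only [through, cat, gate_sheet, sheetPath]
  split_ifs with h1 h2
  · rfl
  · rfl
  · exact absurd (by linarith) h2

/-- The part of a tree of spaces behind a letter is glued to the rest at the foot of the edge. -/
theorem isWedge_behind {i r : Bool} (a : Letter N i r) :
    IsWedge (path (maps γ)) (sheet ((N i).toSpace a.1)) {z : TreeOf N i r | ¬ Behind a z}
      (insert (sheet ((N i).toSpace a.1)) {z | Behind a z}) where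
  left := id
  right := Set.mem_insert _ _
  dist_eq z hz w hw := by
    rcases hw with rfl | hw
    · rw [dist_self, add_zero]
    · rw [dist_of_not_together (not_together_of_not_behind hz hw), dist_sheet, dist_sheet',
        hw.gate_eq, dist_self]
      ring
  path_left z hz w hw t h0 h1 := by
    rcases hw with rfl | hw
    · rw [if_pos h1]
    · have hn := not_together_of_not_behind hz hw
      have hd : dist z w = _ := dist_of_not_together hn
      have hg := hw.gate_eq
      rw [path_of_not_together _ hn, dist_sheet']
      split_ifs with h2
      · rw [path_sheet' γ _ _ (by rwa [dist_sheet'])]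
        simp only [through, cat, sheetPath, hg]
        split_ifs with h3 h4
        · rfl
        · rfl
        · exact absurd (by linarith) h4
      · rw [path_sheet γ _ _ (by linarith)]
        have := dist_nonneg (x := gate z) (y := (N i).toSpace a.1)
        simp only [through, cat, sheetPath, hg, dist_self]
        rw [if_neg (by linarith), if_neg (by linarith), if_neg (by linarith)]
        congr 1; ring
  path_right z hz w hw t h0 h1 := by
    rcases hw with rfl | hw
    · rw [dist_self]
      split_ifs with h2
      · rw [le_antisymm h2 h0, path_sheet γ _ _ le_rfl, path_sheet γ _ _ le_rfl,
          if_pos dist_nonneg, if_pos dist_nonneg, (γ i).reparam_zero, (γ i).reparam_zero]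
      · rw [sub_zero]
    · have hn : ¬ Together w z := fun h => not_together_of_not_behind hz hw h.symm
      have hg := hw.gate_eq
      rw [path_of_not_together _ hn, dist_sheet', hg, dist_self, add_zero]
      split_ifs with h2
      · rw [path_sheet' γ _ _ (by rw [dist_sheet', hg, dist_self, add_zero]; exact h2), if_pos h2]
        simp only [through, cat, if_pos h2]
      · rw [path_sheet γ _ _ (by linarith)]
        simp only [through, cat, if_neg h2, sheetPath, hg]

/-- The closed edge of a letter. -/
def closedEdge {i r : Bool} (a : Letter N i r) : Set (TreeOf N i r) :=
  edgePt a '' Set.Icc 0 1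

theorem edgePt_cases {i r : Bool} (a : Letter N i r) {s : ℝ} (hs : s ∈ Set.Icc (0 : ℝ) 1) :
    (s = 0 ∧ edgePt a s = sheet ((N i).toSpace a.1)) ∨
    (∃ h : s ∈ Set.Ioo (0 : ℝ) 1, edgePt a s = edge a ⟨s, h⟩) ∨
    (s = 1 ∧ edgePt a s = branch a (sheet (N (!i)).pt)) := by
  rcases eq_or_lt_of_le hs.1 with h | h
  · left
    subst h
    simp [edgePt]
  · rcases eq_or_lt_of_le hs.2 with h' | h'
    · right; right
      subst h'
      simp [edgePt]
    · right; left
      refine ⟨⟨h, h'⟩, ?_⟩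
      rw [edgePt, if_neg (not_le.2 h), dif_pos ⟨h, h'⟩]

theorem edgePt_zero {i r : Bool} (a : Letter N i r) :
    edgePt a 0 = sheet ((N i).toSpace a.1) := by simp [edgePt]

theorem edgePt_one {i r : Bool} (a : Letter N i r) :
    edgePt a 1 = branch a (sheet (N (!i)).pt) := by simp [edgePt]

theorem dist_branch {i r : Bool} (a : Letter N i r) (z w : TreeOf N (!i) false) :
    dist (branch a z) (branch a w) = dist z w := by
  change treeDist _ _ = treeDist _ _
  simp [treeDist]

theorem path_branch (g : ∀ i, S i → S i → unitInterval → S i) {i r : Bool} (a : Letter N i r)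
    (z w : TreeOf N (!i) false) (t : ℝ) :
    path g (branch a z) (branch a w) t = branch a (path g z w t) := by
  simp [path]

theorem descend_eq {i r : Bool} (w : TreeOf N i r) {t : ℝ} (ht : 0 ≤ t) :
    descend (maps γ) w t = path (maps γ) (sheet (N i).pt) w t := by
  rw [path_sheet γ _ _ ht]
  simp only [descend, cat, sheetPath]

theorem ascend_eq {i r : Bool} (w : TreeOf N i r) {t : ℝ} (ht : t ≤ height w) :
    ascend (maps γ) w t = path (maps γ) w (sheet (N i).pt) t := by
  rw [path_sheet' γ _ _ (by rw [dist_sheet', dist_comm (gate w), add_comm]; exact ht)]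
  simp only [ascend, cat, sheetPath]

theorem dist_edgePt {i r : Bool} (a : Letter N i r) {s t : ℝ} (hs : s ∈ Set.Icc (0 : ℝ) 1)
    (ht : t ∈ Set.Icc (0 : ℝ) 1) : dist (edgePt a s) (edgePt a t) = |s - t| := by
  have hs' := hs.2
  have ht' := ht.2
  have h0 := hs.1
  have h0' := ht.1
  rcases edgePt_cases a hs with ⟨rfl, h⟩ | ⟨h1, h⟩ | ⟨rfl, h⟩ <;>
    rcases edgePt_cases a ht with ⟨rfl, k⟩ | ⟨k1, k⟩ | ⟨rfl, k⟩
  · simp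
  · rw [h, k, dist_sheet, gate_edge, depth_edge]; simp [abs_of_nonneg h0']
  · rw [h, k, dist_sheet, gate_branch, depth_branch, height_sheet_pt]; simp
  · rw [h, k, dist_sheet', gate_edge, depth_edge]; simp [abs_of_nonneg h0]
  · rw [h, k]
    change treeDist _ _ = _
    simp [treeDist]
  · rw [h, k]
    change treeDist _ _ = _
    simp [treeDist, height_sheet_pt, abs_of_nonpos (sub_nonpos.2 hs')]
  · rw [h, k, dist_sheet', gate_branch, depth_branch, height_sheet_pt]; simp
  · rw [h, k]
    change treeDist _ _ = _
    simp [treeDist, height_sheet_pt, abs_of_nonneg (sub_nonneg.2 ht')]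
  · simp

theorem path_edgePt {i r : Bool} (a : Letter N i r) {s t : ℝ} (hs : s ∈ Set.Icc (0 : ℝ) 1)
    (ht : t ∈ Set.Icc (0 : ℝ) 1) {τ : ℝ} (h0 : 0 ≤ τ) (h1 : τ ≤ |s - t|) :
    path (maps γ) (edgePt a s) (edgePt a t) τ = edgePt a (if s ≤ t then s + τ else s - τ) := by
  have hs' := hs.2
  have ht' := ht.2
  have hs0 := hs.1
  have ht0 := ht.1
  rcases edgePt_cases a hs with ⟨rfl, h⟩ | ⟨hs1, h⟩ | ⟨rfl, h⟩ <;>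
    rcases edgePt_cases a ht with ⟨rfl, k⟩ | ⟨ht1, k⟩ | ⟨rfl, k⟩
  · have : τ = 0 := by simpa using le_antisymm (by simpa using h1) h0
    subst this
    rw [h, path_sheet γ _ _ le_rfl, if_pos dist_nonneg, (γ i).reparam_zero]
    simp [h]
  · rw [h, k, path_sheet γ _ _ h0, if_pos ht0]
    simp only [gate_edge, dist_self, zero_add, sub_zero]
    split_ifs with h2
    · rw [le_antisymm h2 h0, h, (γ i).reparam_zero]
    · rfl
  · rw [h, k, path_sheet γ _ _ h0, if_pos ht0]
    simp only [gate_branch, dist_self, zero_add, sub_zero]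
    split_ifs with h2
    · rw [le_antisymm h2 h0, h, (γ i).reparam_zero]
    · have : τ ≤ 1 := by simpa using h1
      simp only [enter, cat, if_pos this]
  · rw [sub_zero, abs_of_nonneg hs0] at h1
    rw [h, k, path_sheet' γ _ _ (by
      rw [dist_sheet', depth_edge, gate_edge, dist_self, add_zero]
      exact h1), depth_edge, if_pos h1, if_neg (not_le.2 hs1.1), exit]
  · rw [h, k]
    simp [path]
  · rw [h, k, if_pos hs']
    rw [abs_of_nonpos (by linarith)] at h1
    simp only [path, if_true, cat]
    rw [if_pos (by linarith)]
  · have h2 : τ ≤ 1 := by simpa using h1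
    rw [h, k, path_sheet' γ _ _ (by
      rw [dist_sheet', depth_branch, gate_branch, dist_self, add_zero, height_sheet_pt, add_zero]
      exact h2), depth_branch, height_sheet_pt, add_zero, if_pos h2, if_neg (by norm_num)]
    simp only [exit, depth_sheet, cat, height_sheet_pt, sub_zero]
    split_ifs with h3
    · rw [le_antisymm h3 h0, sub_zero, edgePt_one]
    · rfl
  · rw [abs_of_nonneg (by linarith)] at h1
    rw [h, k, if_neg (not_le.2 ht1.2)]
    simp only [path, if_true, cat, height_sheet_pt]
    split_ifs with h3
    · have : τ = 0 := le_antisymm h3 h0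
      rw [this, sub_zero, edgePt_one, ascend_eq γ _ height_sheet_pt.ge, path_sheet γ _ _ le_rfl,
        if_pos dist_nonneg, (γ _).reparam_zero]
    · rw [sub_zero]
  · have : τ = 0 := by simpa using le_antisymm (by simpa using h1) h0
    subst this
    rw [h, path_branch, path_sheet γ _ _ le_rfl, if_pos dist_nonneg, (γ _).reparam_zero]
    simp [h]

theorem enter_branch (g : ∀ i, S i → S i → unitInterval → S i) {i r : Bool} (a : Letter N i r)
    (w : TreeOf N (!i) false) (t : ℝ) : enter g (branch a w) t =
      if t ≤ 1 then edgePt a t else branch a (descend g w (t - 1)) := rfl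

theorem exit_branch (g : ∀ i, S i → S i → unitInterval → S i) {i r : Bool} (a : Letter N i r)
    (w : TreeOf N (!i) false) (t : ℝ) : exit g (branch a w) t =
      if t ≤ height w then branch a (ascend g w t) else edgePt a (1 - (t - height w)) := rfl

theorem path_branch_edge (g : ∀ i, S i → S i → unitInterval → S i) {i r : Bool}
    (a : Letter N i r) (w : TreeOf N (!i) false) (s : Set.Ioo (0 : ℝ) 1) (t : ℝ) :
    path g (branch a w) (edge a s) t =
      if t ≤ height w then branch a (ascend g w t) else edgePt a (1 - (t - height w)) := by
  simp [path, cat]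

theorem dist_closedEdge_branch {i r : Bool} (a : Letter N i r) :
    ∀ z ∈ closedEdge a, ∀ w ∈ Set.range (branch a), dist z w =
      dist z (branch a (sheet (N (!i)).pt)) + dist (branch a (sheet (N (!i)).pt)) w := by
  rintro _ ⟨s, hs, rfl⟩ _ ⟨w, rfl⟩
  rcases edgePt_cases a hs with ⟨rfl, h⟩ | ⟨hs1, h⟩ | ⟨rfl, h⟩ <;> rw [h]
  · rw [dist_branch, dist_sheet, dist_sheet, dist_sheet]
    simp only [gate_branch, depth_branch, gate_sheet, depth_sheet, dist_self, height]
    ring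
  · rw [dist_branch, dist_sheet]
    change treeDist _ _ = treeDist _ _ + _
    simp [treeDist, height, gate_sheet, depth_sheet]
  · rw [dist_self, zero_add]

theorem path_closedEdge_branch {i r : Bool} (a : Letter N i r) :
    ∀ z ∈ closedEdge a, ∀ w ∈ Set.range (branch a), ∀ t, 0 ≤ t → t ≤ dist z w →
      path (maps γ) z w t = if t ≤ dist z (branch a (sheet (N (!i)).pt))
        then path (maps γ) z (branch a (sheet (N (!i)).pt)) t
        else path (maps γ) (branch a (sheet (N (!i)).pt)) w
          (t - dist z (branch a (sheet (N (!i)).pt))) := by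
  rintro _ ⟨s, hs, rfl⟩ _ ⟨w, rfl⟩ t h0 h1
  rcases edgePt_cases a hs with ⟨rfl, h⟩ | ⟨hs1, h⟩ | ⟨rfl, h⟩ <;> rw [h]
  · rw [dist_sheet, path_sheet γ _ _ h0, path_sheet γ _ _ h0]
    simp only [gate_branch, depth_branch, dist_self, height_sheet_pt, add_zero, zero_add,
      sub_zero]
    rcases le_or_gt t 0 with h2 | h2
    · rw [if_pos h2, if_pos h2, if_pos (h2.trans zero_le_one)]
    · rw [if_neg (not_le.2 h2), if_neg (not_le.2 h2), enter_branch, enter_branch]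
      split_ifs with h5
      · rfl
      · rw [path_branch, descend_eq γ w (by linarith)]
  · have hd : dist (edge a ⟨s, hs1⟩) (branch a (sheet (N (!i)).pt)) = 1 - s := by
      change treeDist _ _ = _
      simp [treeDist, height_sheet_pt]
    rw [hd, path_branch]
    simp only [path, if_true, cat]
    split_ifs with h2
    · rfl
    · rw [descend_eq γ w (by linarith), path_of_not_together _ (not_together_sheet _ _)]
  · rw [dist_self]
    split_ifs with h2
    · rw [le_antisymm h2 h0, path_branch, path_branch, path_sheet γ _ _ le_rfl,
        path_sheet γ _ _ le_rfl, if_pos dist_nonneg, if_pos dist_nonneg, (γ _).reparam_zero,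
        (γ _).reparam_zero]
    · rw [sub_zero]

theorem path_branch_closedEdge {i r : Bool} (a : Letter N i r) :
    ∀ z ∈ closedEdge a, ∀ w ∈ Set.range (branch a), ∀ t, 0 ≤ t → t ≤ dist w z →
      path (maps γ) w z t = if t ≤ dist w (branch a (sheet (N (!i)).pt))
        then path (maps γ) w (branch a (sheet (N (!i)).pt)) t
        else path (maps γ) (branch a (sheet (N (!i)).pt)) z
          (t - dist w (branch a (sheet (N (!i)).pt))) := by
  rintro _ ⟨s, hs, rfl⟩ _ ⟨w, rfl⟩ t h0 h1
  have hd : dist (branch a w) (branch a (sheet (N (!i)).pt) : TreeOf N i r) = height w := by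
    rw [dist_branch, dist_sheet', dist_comm, add_comm]; rfl
  rcases edgePt_cases a hs with ⟨rfl, h⟩ | ⟨hs1, h⟩ | ⟨rfl, h⟩ <;> rw [h] at h1 ⊢
  · have h1' := h1
    rw [dist_sheet', depth_branch, gate_branch, dist_self, add_zero] at h1
    rw [path_sheet' γ _ _ h1', hd, path_branch, depth_branch, if_pos h1, exit_branch]
    split_ifs with h2
    · rw [ascend_eq γ w h2]
    · have h3 : t - height w ≤ 1 := by linarith
      have h4 : dist (branch a (sheet (N (!i)).pt)) (sheet ((N i).toSpace a.1) : TreeOf N i r) =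
          1 := by
        rw [dist_sheet', depth_branch, gate_branch, height_sheet_pt, dist_self, add_zero, add_zero]
      have h5 : ¬ t - height w ≤ 0 := by linarith
      rw [path_sheet' γ _ _ (h3.trans h4.ge), depth_branch, height_sheet_pt, add_zero, if_pos h3,
        exit_branch, height_sheet_pt, if_neg h5, sub_zero]
  · rw [hd, path_branch, path_branch_edge, path_branch_edge, height_sheet_pt]
    split_ifs with h2 h3
    · rw [ascend_eq γ w h2]
    · exact absurd (sub_nonpos.1 h3) h2
    · rw [sub_zero]
  · rw [hd]
    split_ifs with h2
    · rfl
    · rw [hd] at h1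
      exact absurd h1 h2

/-- A branch is glued to its edge at its base point. -/
theorem isWedge_edge_branch {i r : Bool} (a : Letter N i r) :
    IsWedge (path (maps γ)) (branch a (sheet (N (!i)).pt)) (closedEdge a)
      (Set.range (branch a)) where
  left := ⟨1, by simp, edgePt_one a⟩
  right := ⟨_, rfl⟩
  dist_eq := dist_closedEdge_branch a
  path_left := path_closedEdge_branch γ a
  path_right := path_branch_closedEdge γ a

theorem pathConvex_range_sheet {E C : ℝ} (hE : ∀ i, (γ i).E ≤ E) (hC : ∀ i, (γ i).C ≤ C)
    (i r : Bool) :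
    PathConvex (path (maps γ)) E C (Set.range (sheet : S i → TreeOf N i r)) := by
  rw [← Set.image_univ]
  refine ((γ i).pathConvex (hE i) (hC i)).image _ (fun z w => ?_) fun z _ w _ t h0 h1 => ?_
  · rw [dist_sheet]; simp [gate, depth]
  · rw [path_sheet γ _ _ h0]
    rw [gate_sheet, if_pos h1]

/-- The points that are reached from the root sheet by crossing at most `k` edges. -/
def lvl : ℕ → ∀ i r : Bool, Set (TreeOf N i r)
  | 0, _, _ => Set.range sheet
  | k + 1, i, _ => Set.range sheet ∪ ⋃ a, (closedEdge a ∪ branch a '' lvl k (!i) false)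

theorem sheet_mem_lvl {i r : Bool} (k : ℕ) (x : S i) : (sheet x : TreeOf N i r) ∈ lvl k i r := by
  cases k
  · exact ⟨x, rfl⟩
  · exact Or.inl ⟨x, rfl⟩

theorem exists_mem_lvl : ∀ {i r : Bool} (z : TreeOf N i r), ∃ k₀, ∀ k, k₀ ≤ k → z ∈ lvl k i r
  | _, _, sheet x => ⟨0, fun k _ => sheet_mem_lvl k x⟩
  | _, _, edge a t => ⟨1, fun k hk => by
      obtain ⟨k, rfl⟩ := Nat.exists_eq_add_of_le' hk
      refine Or.inr (Set.mem_iUnion.2 ⟨a, Or.inl ⟨t, ⟨t.2.1.le, t.2.2.le⟩, ?_⟩⟩)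
      exact (if_neg (not_le.2 t.2.1)).trans (dif_pos ⟨t.2.1, t.2.2⟩)⟩
  | _, _, branch a z => by
      obtain ⟨k₀, h⟩ := exists_mem_lvl z
      refine ⟨k₀ + 1, fun k hk => ?_⟩
      obtain ⟨k, rfl⟩ := Nat.exists_eq_add_of_le' (le_trans (Nat.le_add_left 1 k₀) hk)
      exact Or.inr (Set.mem_iUnion.2 ⟨a, Or.inr ⟨z, h k (by omega), rfl⟩⟩)

theorem closedEdge_union_subset {i r : Bool} (a : Letter N i r) (k : ℕ) :
    closedEdge a ∪ branch a '' lvl k (!i) false ⊆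
      insert (sheet ((N i).toSpace a.1)) {z | Behind a z} := by
  rintro z (⟨s, hs, rfl⟩ | ⟨w, -, rfl⟩)
  · rcases edgePt_cases a hs with ⟨rfl, h⟩ | ⟨hs1, h⟩ | ⟨rfl, h⟩ <;> rw [h]
    · exact Or.inl rfl
    · exact Or.inr rfl
    · exact Or.inr rfl
  · exact Or.inr rfl

/-- Gluing edges and branches one after the other, the constants of the sheets persist. -/
theorem pathConvex_lvl {E C : ℝ} (hE : ∀ i, (γ i).E ≤ E) (hC : ∀ i, (γ i).C ≤ C) (k : ℕ) :
    ∀ i r, PathConvex (path (maps γ)) E C (lvl k i r : Set (TreeOf N i r)) := by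
  have hE1 : 1 ≤ E := (γ true).one_le_E.trans (hE true)
  have hC0 : 0 ≤ C := (γ true).C_nonneg.trans (hC true)
  induction k with
  | zero => exact pathConvex_range_sheet γ hE hC
  | succ k ih =>
    intro i r
    -- one letter: an edge and a branch, glued at the end of the edge
    have hB : ∀ a : Letter N i r,
        PathConvex (path (maps γ)) E C (closedEdge a ∪ branch a '' lvl k (!i) false) := by
      intro a
      refine PathConvex.union ((isWedge_edge_branch γ a).mono subset_rfl
        (Set.image_subset_range _ _) ⟨1, by simp, edgePt_one a⟩ ⟨_, sheet_mem_lvl k _, rfl⟩)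
        ?_ ?_ hE1
      · exact PathConvex.segment hE1 hC0 _ (fun s hs t ht => dist_edgePt a hs ht)
          fun s hs t ht τ h0 h1 => path_edgePt γ a hs ht h0 h1
      · exact (ih (!i) false).image _ (dist_branch a) fun z _ w _ t _ _ => path_branch _ a z w t
    -- finitely many letters: one is glued after the other to the root sheet
    have hF : ∀ F : Finset (Letter N i r), PathConvex (path (maps γ)) E C
        (Set.range sheet ∪ ⋃ a ∈ F, (closedEdge a ∪ branch a '' lvl k (!i) false)) := by
      intro F
      classical
      induction F using Finset.induction_on with
      | empty => simpa using pathConvex_range_sheet γ hE hC i r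
      | insert a F ha hF =>
        have e : (Set.range sheet ∪ ⋃ b ∈ insert a F,
            (closedEdge b ∪ branch b '' lvl k (!i) false) : Set (TreeOf N i r)) =
            (Set.range sheet ∪ ⋃ b ∈ F, (closedEdge b ∪ branch b '' lvl k (!i) false)) ∪
              (closedEdge a ∪ branch a '' lvl k (!i) false) := by
          rw [Finset.set_biUnion_insert, Set.union_comm (closedEdge a ∪ _), Set.union_assoc]
        rw [e]
        refine PathConvex.union ((isWedge_behind γ a).mono ?_ (closedEdge_union_subset a k)
          (Or.inl ⟨_, rfl⟩) (Or.inl ⟨0, by simp, edgePt_zero a⟩)) hF (hB a) hE1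
        rintro z (⟨x, rfl⟩ | hz) hza
        · exact hza
        · obtain ⟨b, hb, hz⟩ := Set.mem_iUnion₂.1 hz
          rcases closedEdge_union_subset b k hz with rfl | hz
          · exact hza
          · have : b = a := by
              cases z
              · exact hz.elim
              · exact (hz : _ = _).symm.trans hza
              · exact (hz : _ = _).symm.trans hza
            exact ha (this ▸ hb)
    refine PathConvex.of_finite fun s hs hsub => ?_
    have : ∃ F : Finset (Letter N i r), s ⊆
        Set.range sheet ∪ ⋃ a ∈ F, (closedEdge a ∪ branch a '' lvl k (!i) false) := by
      classical
      induction s, hs using Set.Finite.induction_on with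
      | empty => exact ⟨∅, Set.empty_subset _⟩
      | @insert z s _ _ ihs =>
        obtain ⟨F, hF⟩ := ihs ((Set.subset_insert _ _).trans hsub)
        rcases hsub (Set.mem_insert _ _) with hz | hz
        · exact ⟨F, Set.insert_subset (Or.inl hz) hF⟩
        · obtain ⟨a, hz⟩ := Set.mem_iUnion.1 hz
          refine ⟨insert a F, Set.insert_subset (Or.inr (Set.mem_iUnion₂.2
            ⟨a, Finset.mem_insert_self _ _, hz⟩)) (hF.trans (Set.union_subset_union_right _ ?_))⟩
          exact Set.biUnion_subset_biUnion_left fun b hb => Finset.mem_insert_of_mem hb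
    obtain ⟨F, hF'⟩ := this
    refine ⟨_, ?_, hF', hF F⟩
    exact Set.union_subset_union_right _ (Set.iUnion₂_subset_iUnion _ _)

theorem pathConvex_univ {E C : ℝ} (hE : ∀ i, (γ i).E ≤ E) (hC : ∀ i, (γ i).C ≤ C) (i r : Bool) :
    PathConvex (path (maps γ)) E C (Set.univ : Set (TreeOf N i r)) := by
  refine PathConvex.of_finite fun s hs _ => ?_
  have : ∃ k₀, ∀ k, k₀ ≤ k → s ⊆ lvl k i r := by
    induction s, hs using Set.Finite.induction_on with
    | empty => exact ⟨0, fun _ _ => Set.empty_subset _⟩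
    | @insert z s _ _ ihs =>
      obtain ⟨k₁, h1⟩ := ihs (Set.subset_univ _)
      obtain ⟨k₂, h2⟩ := exists_mem_lvl z
      exact ⟨max k₁ k₂, fun k hk => Set.insert_subset (h2 k ((le_max_right _ _).trans hk))
        (h1 k ((le_max_left _ _).trans hk))⟩
  obtain ⟨k, hk⟩ := this
  exact ⟨_, Set.subset_univ _, hk k le_rfl, pathConvex_lvl γ hE hC k i r⟩

/-- The bicombing of a tree of spaces, as a geodesic coarsely convex bicombing. The constants do
not depend on the type of the root sheet. -/
def gcc (i r : Bool) : GCCBicombing (TreeOf N i r) where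
  toFun := bicombing (maps γ)
  E := max (γ true).E (γ false).E
  C := 2 * max (γ true).C (γ false).C
  one_le_E := (γ true).one_le_E.trans (le_max_left _ _)
  C_nonneg := mul_nonneg zero_le_two ((γ true).C_nonneg.trans (le_max_left _ _))
  map_zero x y := by
    have h := pathConvex_univ (N := N) γ (E := max (γ true).E (γ false).E)
      (C := max (γ true).C (γ false).C) (by simp) (by simp) i r
    simp [bicombing, h.zero x trivial y trivial]
  map_one x y := by
    have h := pathConvex_univ (N := N) γ (E := max (γ true).E (γ false).E)
      (C := max (γ true).C (γ false).C) (by simp) (by simp) i r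
    simp [bicombing, h.endpt x trivial y trivial]
  geodesic x y s t := by
    have h := pathConvex_univ (N := N) γ (E := max (γ true).E (γ false).E)
      (C := max (γ true).C (γ false).C) (by simp) (by simp) i r
    simp only [bicombing]
    rw [h.geo x trivial y trivial _ _ (mul_nonneg t.2.1 dist_nonneg)
      (mul_le_of_le_one_left dist_nonneg t.2.2) (mul_nonneg s.2.1 dist_nonneg)
      (mul_le_of_le_one_left dist_nonneg s.2.2), ← sub_mul, abs_mul, abs_of_nonneg dist_nonneg]
  convex x₁ x₂ y₁ y₂ a b c := by
    have h := pathConvex_univ (N := N) γ (E := max (γ true).E (γ false).E)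
      (C := max (γ true).C (γ false).C) (by simp) (by simp) i r
    have := h.pair x₁ trivial y₁ trivial x₂ trivial y₂ trivial (a * dist x₁ y₁) (b * dist x₂ y₂) c
      (mul_nonneg a.2.1 dist_nonneg) (mul_le_of_le_one_left dist_nonneg a.2.2)
      (mul_nonneg b.2.1 dist_nonneg) (mul_le_of_le_one_left dist_nonneg b.2.2) c.2.1 c.2.2
    simpa only [bicombing, Set.Icc.coe_mul, mul_assoc] using this

end TreeOf

/-! ### The ideal boundary in terms of closeness relations -/

namespace GCCBicombing

variable {X : Type u} [MetricSpace X] (γ : GCCBicombing X) (e : X)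

/-- The relation `n < (x | y)_e`. The ideal boundary and its topology are determined by the
asymptotic behaviour of these relations. -/
def Rel (n : ℕ) (x y : X) : Prop := (n : ℝ≥0∞) < γ.gromovProd e x y

theorem one_le_D₁ : 1 ≤ γ.D₁ := by
  have := γ.one_le_E
  have := γ.C_nonneg
  unfold D₁; linarith

variable {γ e}

theorem rel_iff {n : ℕ} {x y : X} : γ.Rel e n x y ↔ (n : ℝ) < dist e x ∧ (n : ℝ) < dist e y ∧
    ∃ τ : ℝ, (n : ℝ) < τ ∧ dist (reparam γ.toFun e x τ) (reparam γ.toFun e y τ) ≤ γ.D₁ := by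
  have hn : (n : ℝ≥0∞) = ENNReal.ofReal n := by simp
  have h0 : (0 : ℝ) ≤ n := n.cast_nonneg
  simp only [Rel, gromovProd, lt_min_iff, edist_dist, hn, lt_iSup_iff, Set.mem_ofPred_eq,
    ENNReal.ofReal_lt_ofReal_iff_of_nonneg h0]
  constructor
  · rintro ⟨h1, h2, τ, ⟨-, h3⟩, h4⟩
    exact ⟨h1, h2, τ, h4, h3⟩
  · rintro ⟨h1, h2, τ, h4, h3⟩
    exact ⟨h1, h2, τ, ⟨h0.trans h4.le, h3⟩, h4⟩

theorem Rel.symm {n : ℕ} {x y : X} (h : γ.Rel e n x y) : γ.Rel e n y x := by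
  rwa [Rel, gromovProd_comm]

theorem Rel.mono {m n : ℕ} {x y : X} (h : γ.Rel e m x y) (hnm : n ≤ m) : γ.Rel e n x y :=
  lt_of_le_of_lt (by exact_mod_cast hnm) h

theorem Rel.lt_dist {n : ℕ} {x y : X} (h : γ.Rel e n x y) : (n : ℝ) < dist e x := (rel_iff.1 h).1

variable (γ e) in
/-- Approximate transitivity, from the quasi-ultrametric inequality for the Gromov product. -/
theorem rel_trans (n : ℕ) : ∃ m, n ≤ m ∧
    ∀ x y z, γ.Rel e m x y → γ.Rel e m y z → γ.Rel e n x z := by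
  have hE := γ.one_le_E
  have hD := γ.one_le_D₁
  have hK : 1 ≤ 2 * γ.E * γ.D₁ := by nlinarith
  set K := 2 * γ.E * γ.D₁ with hKdef
  obtain ⟨m, hm⟩ := exists_nat_ge (K * n)
  have hn0 : (0 : ℝ) ≤ n := n.cast_nonneg
  refine ⟨m, by exact_mod_cast (show (n : ℝ) ≤ m by nlinarith), fun x y z h1 h2 => ?_⟩
  have h3 : ENNReal.ofReal K * n < ENNReal.ofReal K * γ.gromovProd e x z := by
    refine lt_of_le_of_lt ?_ ((lt_min h1 h2).trans_le (γ.gromovProd_quasiUltra e x y z))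
    rw [← ENNReal.ofReal_natCast n, ← ENNReal.ofReal_mul (by linarith),
      ← ENNReal.ofReal_natCast m]
    exact ENNReal.ofReal_le_ofReal hm
  exact lt_of_mul_lt_mul_left' h3

variable (γ e) in
/-- A sequence converges to infinity in the sense of the Gromov product. -/
def ConvInfty (x : ℕ → X) : Prop := ∀ n, ∃ N, ∀ i j, N ≤ i → N ≤ j → γ.Rel e n (x i) (x j)

theorem tendsto_iff_convInfty {x : ℕ → X} :
    Tendsto (fun p : ℕ × ℕ => γ.gromovProd e (x p.1) (x p.2)) atTop (𝓝 ∞) ↔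
      γ.ConvInfty e x := by
  rw [ENNReal.tendsto_nhds_top_iff_nat]
  simp only [eventually_atTop_prod_self, ConvInfty, Rel]

variable (γ) in
/-- The sequence `x` represents the boundary point `ξ`. -/
def Reps (x : ℕ → X) (ξ : γ.IdealBoundary e) : Prop := γ.Represents x (γ.ofBoundary ξ)

theorem exists_reps (ξ : γ.IdealBoundary e) : ∃ x, γ.Reps x ξ := by
  obtain ⟨s, rfl⟩ := Quotient.exists_rep ξ
  exact ⟨s.1, s, rfl, rfl⟩

theorem Reps.convInfty {x : ℕ → X} {ξ : γ.IdealBoundary e} (h : γ.Reps x ξ) :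
    γ.ConvInfty e x := by
  obtain ⟨s, rfl, -⟩ := h
  exact tendsto_iff_convInfty.1 s.2

theorem ConvInfty.exists_reps {x : ℕ → X} (h : γ.ConvInfty e x) :
    ∃ ξ : γ.IdealBoundary e, γ.Reps x ξ :=
  ⟨Quotient.mk _ ⟨x, tendsto_iff_convInfty.2 h⟩, _, rfl, rfl⟩

theorem Reps.eq_iff {x y : ℕ → X} {ξ η : γ.IdealBoundary e} (hx : γ.Reps x ξ)
    (hy : γ.Reps y η) : ξ = η ↔ ∀ n, ∃ N, ∀ i, N ≤ i → γ.Rel e n (x i) (y i) := by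
  obtain ⟨s, rfl, rfl⟩ := hx
  obtain ⟨t, rfl, rfl⟩ := hy
  refine (Quotient.eq (r := γ.sInftySetoid e)).trans ?_
  change Tendsto (fun i => γ.gromovProd e (s.1 i) (t.1 i)) atTop (𝓝 ∞) ↔ _
  rw [ENNReal.tendsto_nhds_top_iff_nat]
  simp only [eventually_atTop, Rel]

theorem Reps.unique {x : ℕ → X} {ξ η : γ.IdealBoundary e} (hx : γ.Reps x ξ)
    (hy : γ.Reps x η) : ξ = η := by
  obtain ⟨s, rfl, rfl⟩ := hx
  obtain ⟨t, h, rfl⟩ := hy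
  rw [Subtype.ext h]

theorem Reps.close {x y : ℕ → X} {ξ : γ.IdealBoundary e} (hx : γ.Reps x ξ) (hy : γ.Reps y ξ)
    (n : ℕ) : ∃ N, ∀ i j, N ≤ i → N ≤ j → γ.Rel e n (x i) (y j) := by
  obtain ⟨m, hm, h⟩ := γ.rel_trans e n
  obtain ⟨N₁, h1⟩ := hx.convInfty m
  obtain ⟨N₂, h2⟩ := (hx.eq_iff hy).1 rfl m
  refine ⟨max N₁ N₂, fun i j hi hj => h _ (x j) _ (h1 i j (by omega) (by omega))
    (h2 j (by omega))⟩

/-- A sequence close to a representing sequence represents the same point. -/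
theorem Reps.of_close {x y : ℕ → X} {ξ : γ.IdealBoundary e} (hx : γ.Reps x ξ)
    (h : ∀ n, ∃ N, ∀ i, N ≤ i → γ.Rel e n (x i) (y i)) : γ.Reps y ξ := by
  have hy : γ.ConvInfty e y := by
    intro n
    obtain ⟨m, -, h1⟩ := γ.rel_trans e n
    obtain ⟨m', hm, h2⟩ := γ.rel_trans e m
    obtain ⟨N₁, h3⟩ := hx.convInfty m
    obtain ⟨N₂, h4⟩ := h m'
    obtain ⟨N₃, h5⟩ := hx.convInfty m'
    refine ⟨max N₂ N₃, fun i j hi hj => h1 _ (x j) _ (h2 _ (x i) _ (h4 i (by omega)).symm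
      (h5 i j (by omega) (by omega))) ((h4 j (by omega)).mono hm)⟩
  obtain ⟨η, hη⟩ := hy.exists_reps (γ := γ)
  rwa [(hx.eq_iff hη).2 h]

theorem Reps.comp {x : ℕ → X} {ξ : γ.IdealBoundary e} (hx : γ.Reps x ξ) {φ : ℕ → ℕ}
    (hφ : ∀ i, i ≤ φ i) : γ.Reps (x ∘ φ) ξ := by
  refine hx.of_close fun n => ?_
  obtain ⟨N, h⟩ := hx.convInfty n
  exact ⟨N, fun i hi => h _ _ hi (hi.trans (hφ i))⟩

/-- The points `η` with `(ξ | η) > n`, up to the choice of representing sequences. -/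
def Nb (n : ℕ) (ξ : γ.IdealBoundary e) : Set (γ.IdealBoundary e) :=
  {η | ∃ x y, γ.Reps x ξ ∧ γ.Reps y η ∧ ∃ N, ∀ i, N ≤ i → γ.Rel e n (x i) (y i)}

variable (γ e) in
theorem exists_rel_of_mem_nb (n : ℕ) : ∃ m, n ≤ m ∧ ∀ ξ η : γ.IdealBoundary e, η ∈ Nb m ξ →
    ∀ x y, γ.Reps x ξ → γ.Reps y η → ∃ N, ∀ i j, N ≤ i → N ≤ j → γ.Rel e n (x i) (y j) := by
  obtain ⟨m, hm, h1⟩ := γ.rel_trans e n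
  obtain ⟨m', hm', h2⟩ := γ.rel_trans e m
  refine ⟨m', hm.trans hm', ?_⟩
  rintro ξ η ⟨x', y', hx', hy', N, h⟩ x y hx hy
  obtain ⟨N₁, h3⟩ := hx.close hx' m'
  obtain ⟨N₂, h4⟩ := hy'.close hy m
  refine ⟨max N (max N₁ N₂), fun i j hi hj => h1 _ (y' i) _ (h2 _ (x' i) _
    (h3 i i (by omega) (by omega)) (h i (by omega))) (h4 i j (by omega) (by omega))⟩

/-- Boundary points have infinite Gromov product with no point of the space, so `X` is open in
`X ∪ ∂X`, and the topology of the boundary can be described without reference to `X`. -/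
theorem isOpen_iff_nb {U : Set (γ.IdealBoundary e)} :
    IsOpen U ↔ ∀ ξ ∈ U, ∃ n, Nb n ξ ⊆ U := by
  constructor
  · rintro ⟨U', hU', rfl⟩ ξ hξ
    obtain ⟨n, hn, h⟩ := hU' _ hξ
    refine ⟨n + 1, fun η hη => h (Or.inl ?_)⟩
    obtain ⟨x, y, hx, hy, N, hN⟩ := hη
    refine lt_of_lt_of_le (b := ((n + 1 : ℕ) : ℝ≥0∞)) (by exact_mod_cast Nat.lt_succ_self n) ?_
    refine le_trans ?_ (le_sSup ⟨x, y, hx, hy, rfl⟩)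
    exact le_liminf_of_le (by isBoundedDefault) (eventually_atTop.2 ⟨N, fun i hi => (hN i hi).le⟩)
  · intro h
    refine ⟨{ζ | ∀ ξ, ζ = γ.ofBoundary ξ → ξ ∈ U}, ?_, ?_⟩
    · rintro (x | ξ) hζ
      · obtain ⟨n, hn⟩ := exists_nat_gt (dist e x)
        refine ⟨n + 1, by omega, fun η hη ξ hξ => ?_⟩
        rcases hη with hη | ⟨_, y, -, hy, -⟩
        · obtain ⟨r, ⟨a, b, ha, hb, rfl⟩, hr⟩ := lt_sSup_iff.1 hη
          exfalso
          obtain ⟨i, hi⟩ := (eventually_lt_of_lt_liminf hr).exists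
          have hi' : γ.Rel e (n + 1) (a i) (b i) := hi
          have h1 := hi'.lt_dist
          have ha' : a = fun _ => x := ha
          rw [ha'] at h1
          push_cast at h1
          linarith
        · rw [hy] at hξ
          cases hξ
      · obtain ⟨n, hn⟩ := h ξ (hζ ξ rfl)
        refine ⟨n + 1, by omega, fun η hη ξ' hξ' => hn ?_⟩
        subst hξ'
        rcases hη with hη | ⟨_, y, -, hy, -⟩
        · obtain ⟨r, ⟨a, b, ha, hb, rfl⟩, hr⟩ := lt_sSup_iff.1 hη
          obtain ⟨N, hN⟩ := eventually_atTop.1 (eventually_lt_of_lt_liminf hr)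
          refine ⟨a, b, ha, hb, N, fun i hi => ?_⟩
          exact (show γ.Rel e (n + 1) (a i) (b i) from hN i hi).mono (Nat.le_succ n)
        · cases hy
    · ext ξ
      constructor
      · exact fun h' => h' ξ rfl
      · rintro h' η hη
        cases hη
        exact h'

/-! ### Maps between ideal boundaries -/

section Map

variable {X' : Type*} [MetricSpace X'] {γ' : GCCBicombing X'} {e' : X'} {f : X → X'}

variable (γ e γ' e' f) in
/-- `f` maps pairs with large Gromov product to pairs with large Gromov product. -/
def Pushes : Prop := ∀ n, ∃ m, ∀ x y, γ.Rel e m x y → γ'.Rel e' n (f x) (f y)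

variable (γ e γ' e' f) in
/-- Pairs whose images have large Gromov product have large Gromov product. -/
def Pulls : Prop := ∀ n, ∃ m, ∀ x y, γ'.Rel e' m (f x) (f y) → γ.Rel e n x y

theorem Pushes.convInfty (hf : Pushes γ e γ' e' f) {x : ℕ → X} (hx : γ.ConvInfty e x) :
    γ'.ConvInfty e' (f ∘ x) := by
  intro n
  obtain ⟨m, hm⟩ := hf n
  obtain ⟨N, hN⟩ := hx m
  exact ⟨N, fun i j hi hj => hm _ _ (hN i j hi hj)⟩

theorem Pulls.convInfty (hf : Pulls γ e γ' e' f) {x : ℕ → X} (hx : γ'.ConvInfty e' (f ∘ x)) :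
    γ.ConvInfty e x := by
  intro n
  obtain ⟨m, hm⟩ := hf n
  obtain ⟨N, hN⟩ := hx m
  exact ⟨N, fun i j hi hj => hm _ _ (hN i j hi hj)⟩

/-- The map of ideal boundaries that is induced by `f`. -/
def bmap (hf : Pushes γ e γ' e' f) (ξ : γ.IdealBoundary e) : γ'.IdealBoundary e' :=
  ((hf.convInfty (exists_reps ξ).choose_spec.convInfty).exists_reps).choose

theorem Reps.bmap (hf : Pushes γ e γ' e' f) {ξ : γ.IdealBoundary e} {x : ℕ → X}
    (hx : γ.Reps x ξ) : γ'.Reps (f ∘ x) (bmap hf ξ) := by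
  have h := ((hf.convInfty (exists_reps ξ).choose_spec.convInfty).exists_reps).choose_spec
  refine h.of_close fun n => ?_
  obtain ⟨m, hm⟩ := hf n
  obtain ⟨N, hN⟩ := ((exists_reps ξ).choose_spec.eq_iff hx).1 rfl m
  exact ⟨N, fun i hi => hm _ _ (hN i hi)⟩

theorem bmap_eq_iff (hf : Pushes γ e γ' e' f) {ξ : γ.IdealBoundary e}
    {η : γ'.IdealBoundary e'} {x : ℕ → X} (hx : γ.Reps x ξ) :
    bmap hf ξ = η ↔ γ'.Reps (f ∘ x) η :=
  ⟨fun h => h ▸ hx.bmap hf, fun h => (hx.bmap hf).unique h⟩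

theorem bmap_mem_nb (hf : Pushes γ e γ' e' f) {m n : ℕ}
    (h : ∀ x y, γ.Rel e m x y → γ'.Rel e' n (f x) (f y)) {ξ η : γ.IdealBoundary e}
    (hη : η ∈ Nb m ξ) : bmap hf η ∈ Nb n (bmap hf ξ) := by
  obtain ⟨x, y, hx, hy, N, hN⟩ := hη
  exact ⟨_, _, hx.bmap hf, hy.bmap hf, N, fun i hi => h _ _ (hN i hi)⟩

theorem continuous_bmap (hf : Pushes γ e γ' e' f) : Continuous (bmap hf) := by
  refine ⟨fun U hU => isOpen_iff_nb.2 fun ξ hξ => ?_⟩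
  obtain ⟨n, hn⟩ := isOpen_iff_nb.1 hU _ hξ
  obtain ⟨m, hm⟩ := hf n
  exact ⟨m, fun η hη => hn (bmap_mem_nb hf hm hη)⟩

theorem bmap_injective (hf : Pushes γ e γ' e' f) (hf' : Pulls γ e γ' e' f) :
    Function.Injective (bmap hf) := by
  intro ξ η h
  obtain ⟨x, hx⟩ := exists_reps ξ
  obtain ⟨y, hy⟩ := exists_reps η
  refine (hx.eq_iff hy).2 fun n => ?_
  obtain ⟨m, hm⟩ := hf' n
  obtain ⟨N, hN⟩ := ((hx.bmap hf).eq_iff (hy.bmap hf)).1 h m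
  exact ⟨N, fun i hi => hm _ _ (hN i hi)⟩

end Map

/-! ### Independence of the base point and of the constants -/

/-- Geodesics from two base points to the same point are close, after a shift of the parameter by
the distance of the base points. -/
theorem dist_base_change (γ : GCCBicombing X) (e e' x : X) {t : ℝ} (h0 : dist e e' ≤ t)
    (h1 : t ≤ dist e x) :
    dist (reparam γ.toFun e x t) (reparam γ.toFun e' x (t - dist e e')) ≤
      (γ.E + 2) * dist e e' + γ.C := by
  set δ := dist e e' with hδ
  have hE := γ.one_le_E
  have hδ0 : 0 ≤ δ := dist_nonneg
  have ht : 0 ≤ t := hδ0.trans h0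
  have hd1 : dist e x ≤ δ + dist e' x := dist_triangle e e' x
  have hd2 : dist e' x ≤ δ + dist e x := by
    rw [hδ, dist_comm e e']; exact dist_triangle e' e x
  obtain ⟨c, hc0, hc1, hc⟩ : ∃ c, 0 ≤ c ∧ c ≤ 1 ∧ c * dist e x = t := by
    rcases eq_or_lt_of_le (dist_nonneg (x := e) (y := x)) with h | h
    · exact ⟨0, le_rfl, zero_le_one, by linarith⟩
    · exact ⟨t / dist e x, by positivity, (div_le_one h).2 h1, by field_simp⟩
  have h2 := γ.dist_reparam_mul_le e x e' x dist_nonneg le_rfl dist_nonneg le_rfl hc0 hc1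
  rw [γ.reparam_of_ge e x le_rfl, γ.reparam_of_ge e' x le_rfl, dist_self, hc, ← hδ] at h2
  have h3 := γ.dist_reparam e' x (s := c * dist e' x) (t := t - δ) (by positivity)
    (mul_le_of_le_one_left dist_nonneg hc1) (by linarith) (by linarith)
  have h4 : |c * dist e' x - (t - δ)| ≤ 2 * δ := by
    rw [abs_le]
    constructor <;> nlinarith
  have h5 : (1 - c) * γ.E * δ ≤ γ.E * δ := by
    have : 0 ≤ γ.E * δ := by positivity
    nlinarith
  have := dist_triangle (reparam γ.toFun e x t) (reparam γ.toFun e' x (c * dist e' x))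
    (reparam γ.toFun e' x (t - δ))
  linarith

/-- Changing the base point or the constants of a bicombing changes the Gromov product only in a
controlled way. -/
theorem pushes_id {γ γ' : GCCBicombing X} (h : γ.toFun = γ'.toFun) (e e' : X) :
    Pushes γ e γ' e' id := by
  intro n
  have hE := γ.one_le_E
  have hE' := γ'.one_le_E
  have hC := γ.C_nonneg
  have hC' := γ'.C_nonneg
  have hD := γ.one_le_D₁
  set δ := dist e e' with hδ
  have hδ0 : 0 ≤ δ := dist_nonneg
  set M : ℝ := 1 + γ.C + 2 * ((γ'.E + 2) * δ + γ'.C) with hM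
  have hM1 : 1 ≤ M := by
    have : 0 ≤ (γ'.E + 2) * δ := by positivity
    linarith
  -- the times are chosen such that the time `s - δ` can be scaled down by `γ'.E * M`
  have hEM : 1 ≤ γ'.E * M := by nlinarith
  set s : ℝ := γ'.E * M * (n + 1) + δ with hs
  have hs0 : 0 ≤ γ'.E * M * (n + 1) := by positivity
  obtain ⟨m, hm⟩ := exists_nat_ge (2 * γ.E * γ.D₁ * s)
  refine ⟨m, fun x y hxy => ?_⟩
  have hK : 1 ≤ 2 * γ.E * γ.D₁ := by nlinarith
  have hsm : s ≤ m / (2 * γ.E * γ.D₁) := by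
    rw [le_div_iff₀ (by linarith)]; linarith
  have hmm : (m : ℝ) / (2 * γ.E * γ.D₁) ≤ m := div_le_self m.cast_nonneg hK
  have hx := (rel_iff.1 hxy).1
  have hy := (rel_iff.1 hxy).2.1
  obtain ⟨t, ht0, htm, htr⟩ : ∃ t, s ≤ t ∧ t ≤ m ∧
      dist (reparam γ.toFun e x t) (reparam γ.toFun e y t) ≤ 1 + γ.C := by
    refine ⟨_, hsm, hmm, γ.dist_reparam_le m.cast_nonneg ?_⟩
    rw [ENNReal.ofReal_natCast]; exact hxy
  rw [h] at htr
  have bx := γ'.dist_base_change e e' x (t := t) (by linarith) (by linarith)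
  have hby := γ'.dist_base_change e e' y (t := t) (by linarith) (by linarith)
  rw [← hδ] at bx hby
  have htM : dist (reparam γ'.toFun e' x (t - δ)) (reparam γ'.toFun e' y (t - δ)) ≤ M := by
    rw [dist_comm] at bx
    have := dist_triangle4 (reparam γ'.toFun e' x (t - δ)) (reparam γ'.toFun e x t)
      (reparam γ'.toFun e y t) (reparam γ'.toFun e' y (t - δ))
    linarith
  have hd1 : t - δ ≤ dist e' x := by
    have : dist e x ≤ δ + dist e' x := dist_triangle e e' x
    linarith
  have hd2 : t - δ ≤ dist e' y := by
    have : dist e y ≤ δ + dist e' y := dist_triangle e e' y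
    linarith
  have hEM0 : 0 < γ'.E * M := by linarith
  have hc : 1 / (γ'.E * M) ≤ 1 := (div_le_one hEM0).2 hEM
  have hc0 : 0 ≤ 1 / (γ'.E * M) := by positivity
  have hfin := γ'.dist_reparam_mul_le e' x e' y (L := t - δ) (L' := t - δ)
    (c := 1 / (γ'.E * M)) (by linarith) hd1 (by linarith) hd2 hc0 hc
  rw [dist_self, mul_zero, zero_add] at hfin
  have h6 : 1 / (γ'.E * M) * γ'.E * dist (reparam γ'.toFun e' x (t - δ))
      (reparam γ'.toFun e' y (t - δ)) ≤ 1 := by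
    calc _ ≤ 1 / (γ'.E * M) * γ'.E * M := by gcongr
      _ = 1 := by field_simp
  have h7 : (n : ℝ) + 1 ≤ 1 / (γ'.E * M) * (t - δ) := by
    have : (n : ℝ) + 1 = 1 / (γ'.E * M) * (γ'.E * M * (n + 1)) := by field_simp
    rw [this]
    exact mul_le_mul_of_nonneg_left (by linarith) hc0
  have h8 : (n : ℝ) + 1 ≤ t - δ := h7.trans (mul_le_of_le_one_left (by linarith) hc)
  refine rel_iff.2 ⟨?_, ?_, 1 / (γ'.E * M) * (t - δ), by linarith, hfin.trans ?_⟩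
  · simp only [id]; linarith
  · simp only [id]; linarith
  · have : 1 + γ'.C ≤ γ'.D₁ := by unfold D₁; linarith
    linarith

/-- The ideal boundary, as a topological space, depends neither on the base point nor on the
constants. -/
def boundaryHomeo {γ γ' : GCCBicombing X} (h : γ.toFun = γ'.toFun) (e e' : X) :
    γ.IdealBoundary e ≃ₜ γ'.IdealBoundary e' where
  toFun := bmap (pushes_id h e e')
  invFun := bmap (pushes_id h.symm e' e)
  left_inv ξ := by
    obtain ⟨x, hx⟩ := exists_reps ξ
    exact (bmap_eq_iff _ (hx.bmap _)).2 hx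
  right_inv ξ := by
    obtain ⟨x, hx⟩ := exists_reps ξ
    exact (bmap_eq_iff _ (hx.bmap _)).2 hx
  continuous_toFun := continuous_bmap _
  continuous_invFun := continuous_bmap _

/-! ### Boundary points close to points of the space -/

/-- The point `g` has Gromov product larger than `n` with a sequence representing `ξ`. -/
def Near (n : ℕ) (g : X) (ξ : γ.IdealBoundary e) : Prop :=
  ∃ x, γ.Reps x ξ ∧ ∃ N, ∀ i, N ≤ i → γ.Rel e n g (x i)

variable (γ e) in
/-- A coarse projection of the space to its boundary, with values in the sets with at most one
element: a boundary point whose Gromov product with `g` is as large as possible is close to every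
boundary point that is close to `g`. -/
theorem exists_projection : ∃ p : X → Set (γ.IdealBoundary e), (∀ g, (p g).Subsingleton) ∧
    ∀ n, ∃ m, ∀ g ξ, Near m g ξ → ∃ η ∈ p g, η ∈ Nb n ξ := by
  have hmax : ∀ g : X, ∃ q : Set (γ.IdealBoundary e), q.Subsingleton ∧
      ∀ m (ξ : γ.IdealBoundary e), Near m g ξ → ∃ η ∈ q, Near m g η := by
    intro g
    by_cases h : ∃ m, ∃ ξ : γ.IdealBoundary e, Near m g ξ
    · classical
      obtain ⟨b, hb⟩ := exists_nat_gt (dist e g)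
      have hbd : ∀ m, (∃ ξ : γ.IdealBoundary e, Near m g ξ) → m ≤ b := by
        rintro m ⟨ξ, x, -, N, hN⟩
        have := (hN N le_rfl).lt_dist
        exact_mod_cast (this.trans hb).le
      obtain ⟨m₀, ξ₀, h₀⟩ := h
      obtain ⟨η, hη⟩ := Nat.findGreatest_spec (P := fun m => ∃ ξ : γ.IdealBoundary e, Near m g ξ)
        (hbd m₀ ⟨ξ₀, h₀⟩) ⟨ξ₀, h₀⟩
      refine ⟨{η}, Set.subsingleton_singleton, fun m ξ hm => ⟨η, rfl, ?_⟩⟩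
      obtain ⟨x, hx, N, hN⟩ := hη
      exact ⟨x, hx, N, fun i hi => (hN i hi).mono
        (Nat.le_findGreatest (hbd m ⟨ξ, hm⟩) ⟨ξ, hm⟩)⟩
    · exact ⟨∅, Set.subsingleton_empty, fun m ξ hm => (h ⟨m, ξ, hm⟩).elim⟩
  choose p hp1 hp2 using hmax
  refine ⟨p, hp1, fun n => ?_⟩
  obtain ⟨m, -, hm⟩ := γ.rel_trans e n
  refine ⟨m, fun g ξ hg => ?_⟩
  obtain ⟨η, hη, y, hy, N₂, h2⟩ := hp2 g m ξ hg
  obtain ⟨x, hx, N₁, h1⟩ := hg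
  exact ⟨η, hη, x, y, hx, hy, max N₁ N₂, fun i hi =>
    hm _ g _ (h1 i (by omega)).symm (h2 i (by omega))⟩

end GCCBicombing

namespace GCCBicombing

variable {X : Type u} [MetricSpace X] (γ : GCCBicombing X)

theorem dist_base_reparam (e x : X) {t : ℝ} (h0 : 0 ≤ t) :
    dist e (reparam γ.toFun e x t) = min t (dist e x) := by
  rcases le_total t (dist e x) with h | h
  · have := γ.dist_reparam e x le_rfl dist_nonneg h0 h
    rw [γ.reparam_zero, zero_sub, abs_neg, abs_of_nonneg h0] at this
    rw [this, min_eq_left h]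
  · rw [γ.reparam_of_ge e x h, min_eq_right h]

variable {γ}

theorem rel_self {e x : X} {n : ℕ} (h : (n : ℝ) < dist e x) : γ.Rel e n x x := by
  refine rel_iff.2 ⟨h, h, n + 1, by linarith, ?_⟩
  rw [dist_self]
  exact zero_le_one.trans γ.one_le_D₁

theorem rel_zero {e x y : X} (hx : 0 < dist e x) (hy : 0 < dist e y) : γ.Rel e 0 x y := by
  refine rel_iff.2 ⟨by simpa using hx, by simpa using hy, 1 / 2, by norm_num, ?_⟩
  have h1 := γ.dist_base_reparam e x (t := 1 / 2) (by norm_num)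
  have h2 := γ.dist_base_reparam e y (t := 1 / 2) (by norm_num)
  have := dist_triangle_left (reparam γ.toFun e x (1 / 2)) (reparam γ.toFun e y (1 / 2)) e
  have := min_le_left (1 / 2) (dist e x)
  have := min_le_left (1 / 2) (dist e y)
  have := γ.one_le_D₁
  linarith

theorem nb_zero {e : X} (ξ : γ.IdealBoundary e) : Nb 0 ξ = Set.univ := by
  refine Set.eq_univ_of_forall fun η => ?_
  obtain ⟨x, hx⟩ := exists_reps ξ
  obtain ⟨y, hy⟩ := exists_reps η
  obtain ⟨N₁, h1⟩ := hx.convInfty 0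
  obtain ⟨N₂, h2⟩ := hy.convInfty 0
  refine ⟨x, y, hx, hy, max N₁ N₂, fun i hi => rel_zero ?_ ?_⟩
  · simpa using (h1 i i (by omega) (by omega)).lt_dist
  · simpa using (h2 i i (by omega) (by omega)).lt_dist

end GCCBicombing

open GCCBicombing

namespace TreeOf

variable {S : Bool → Type u} [∀ i, MetricSpace (S i)] {N : ∀ i, Net.{u, v} (S i)}
  (γ : ∀ i, GCCBicombing (S i)) {i r : Bool}

/-! ### Geodesics from the base point of a tree of spaces -/

/-- The bicombing of a sheet, with the constants of the bicombing of the tree of spaces. -/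
def sheetGcc (i : Bool) : GCCBicombing (S i) where
  toFun := (γ i).toFun
  E := max (γ true).E (γ false).E
  C := 2 * max (γ true).C (γ false).C
  one_le_E := (γ true).one_le_E.trans (le_max_left _ _)
  C_nonneg := mul_nonneg zero_le_two ((γ true).C_nonneg.trans (le_max_left _ _))
  map_zero := (γ i).map_zero
  map_one := (γ i).map_one
  geodesic := (γ i).geodesic
  convex x₁ x₂ y₁ y₂ a b c := by
    have h := (γ i).convex x₁ x₂ y₁ y₂ a b c
    have hE : (γ i).E ≤ max (γ true).E (γ false).E := by cases i <;> simp
    have hC : (γ i).C ≤ max (γ true).C (γ false).C := by cases i <;> simp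
    have hC0 := (γ i).C_nonneg
    have hc : (0 : ℝ) ≤ 1 - c := sub_nonneg.2 c.2.2
    have hc0 : (0 : ℝ) ≤ c := c.2.1
    refine h.trans (add_le_add (add_le_add ?_ ?_) (by linarith))
    · gcongr
    · gcongr

/-- The base point of the root sheet. -/
abbrev root (N : ∀ i, Net.{u, v} (S i)) (i r : Bool) : TreeOf N i r := sheet (N i).pt

theorem dist_root (z : TreeOf N i r) : dist (root N i r) z = height z := dist_sheet _ z

theorem height_eq (z : TreeOf N i r) : height z = dist (N i).pt (gate z) + depth z := rfl

theorem height_branch (a : Letter N i r) (z : TreeOf N (!i) false) :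
    height (branch a z) = dist (N i).pt ((N i).toSpace a.1) + 1 + height z := by
  rw [height_eq, gate_branch, depth_branch, add_assoc]

/-- The unit speed path from the root to `z`, constant after the time `height z`. -/
def ray (z : TreeOf N i r) (τ : ℝ) : TreeOf N i r :=
  reparam (gcc γ i r).toFun (root N i r) z τ

theorem ray_of_le {z : TreeOf N i r} {τ : ℝ} (h0 : 0 ≤ τ) (h : τ ≤ height z) :
    ray γ z τ = path (maps γ) (root N i r) z τ := by
  rw [← dist_root] at h
  rw [ray, (gcc γ i r).reparam_of_le _ _ h0 h]
  change path (maps γ) _ _ (τ / dist _ _ * dist _ _) = _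
  rcases eq_or_lt_of_le (dist_nonneg (x := root N i r) (y := z)) with h1 | h1
  · rw [← h1] at h ⊢
    rw [le_antisymm h h0]; simp
  · rw [div_mul_cancel₀ _ h1.ne']

theorem ray_of_ge {z : TreeOf N i r} {τ : ℝ} (h : height z ≤ τ) : ray γ z τ = z :=
  (gcc γ i r).reparam_of_ge _ _ ((dist_root z).trans_le h)

theorem height_ray (z : TreeOf N i r) {τ : ℝ} (h0 : 0 ≤ τ) :
    height (ray γ z τ) = min τ (height z) := by
  rw [← dist_root, ← dist_root]
  exact (gcc γ i r).dist_base_reparam _ _ h0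

theorem ray_of_le_gate {z : TreeOf N i r} {τ : ℝ} (h0 : 0 ≤ τ) (h : τ ≤ dist (N i).pt (gate z)) :
    ray γ z τ = sheet (reparam (γ i).toFun (N i).pt (gate z) τ) := by
  have := depth_nonneg z
  rw [ray_of_le γ h0 (by rw [height_eq]; linarith), path_sheet γ _ _ h0, if_pos h]

theorem ray_sheet (x : S i) {τ : ℝ} (h0 : 0 ≤ τ) :
    ray γ (sheet x : TreeOf N i r) τ = sheet (reparam (γ i).toFun (N i).pt x τ) := by
  rcases le_total τ (dist (N i).pt x) with h | h
  · rw [ray_of_le_gate γ h0 (by rwa [gate_sheet]), gate_sheet]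
  · rw [ray_of_ge γ (by rwa [height_eq, gate_sheet, depth_sheet, add_zero]),
      (γ i).reparam_of_ge _ _ h]

theorem ray_branch (a : Letter N i r) (z : TreeOf N (!i) false) {τ : ℝ} (h0 : 0 ≤ τ) :
    ray γ (branch a z) (dist (N i).pt ((N i).toSpace a.1) + 1 + τ) = branch a (ray γ z τ) := by
  have hl := dist_nonneg (x := (N i).pt) (y := (N i).toSpace a.1)
  have hp : ∀ {σ : ℝ}, 0 ≤ σ → σ ≤ height z →
      ray γ z σ = descend (maps γ) z σ := fun h h' => by
    rw [ray_of_le γ h h', descend_eq γ _ h]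
  rcases le_total τ (height z) with h | h
  · rw [ray_of_le γ (by positivity) (by rw [height_branch]; linarith),
      path_sheet γ _ _ (by positivity), gate_branch, if_neg (by linarith), enter_branch]
    split_ifs with h2
    · have : τ = 0 := by linarith
      subst this
      rw [hp le_rfl h, add_zero, add_sub_cancel_left, edgePt_one, descend_eq γ _ le_rfl,
        path_sheet γ _ _ le_rfl, if_pos dist_nonneg, (γ _).reparam_zero]
    · rw [hp h0 h]
      congr 2; ring
  · rw [ray_of_ge γ (by rw [height_branch]; linarith), ray_of_ge γ h]

/-- Beyond the root sheet, the path from the root to `z` stays behind the letter of `z`. -/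
theorem Behind.ray {a : Letter N i r} {z : TreeOf N i r} (hz : Behind a z) {τ : ℝ}
    (h : dist (N i).pt (gate z) < τ) : Behind a (ray γ z τ) := by
  have hl := dist_nonneg (x := (N i).pt) (y := gate z)
  rcases le_total (height z) τ with h1 | h1
  · rwa [ray_of_ge γ h1]
  have key : ∀ s : ℝ, 0 < s → s ≤ 1 → Behind a (edgePt a s) := by
    intro s hs hs'
    rcases edgePt_cases a ⟨hs.le, hs'⟩ with ⟨rfl, -⟩ | ⟨_, h⟩ | ⟨_, h⟩
    · exact absurd hs (lt_irrefl _)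
    · rw [h]; rfl
    · rw [h]; rfl
  cases z with
  | sheet x => exact hz.elim
  | edge b t =>
    cases hz
    rw [ray_of_le γ (by linarith) h1, path_sheet γ _ _ (by linarith), if_neg (not_le.2 h)]
    rw [height_eq, depth_edge] at h1
    exact key _ (by linarith) (by linarith [t.2.2])
  | branch b w =>
    cases hz
    rw [gate_branch] at h
    rcases le_total τ (dist (N i).pt ((N i).toSpace a.1) + 1) with h2 | h2
    · rw [ray_of_le γ (by rw [gate_branch] at hl; linarith) h1,
        path_sheet γ _ _ (by rw [gate_branch] at hl; linarith),
        gate_branch, if_neg (not_le.2 h), enter_branch, if_pos (by linarith)]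
      exact key _ (by linarith) (by linarith)
    · have := ray_branch γ a w (τ := τ - (dist (N i).pt ((N i).toSpace a.1) + 1)) (by linarith)
      rw [add_sub_cancel] at this
      rw [this]; rfl

theorem sheet_or_behind (z : TreeOf N i r) : (∃ x, z = sheet x) ∨ ∃ a, Behind a z := by
  cases z with
  | sheet x => exact Or.inl ⟨x, rfl⟩
  | edge a t => exact Or.inr ⟨a, rfl⟩
  | branch a w => exact Or.inr ⟨a, rfl⟩

theorem together_iff {z w : TreeOf N i r} : Together z w ↔ ∃ a, Behind a z ∧ Behind a w := by
  cases z <;> cases w <;> simp [Together, Behind, eq_comm]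

theorem Behind.unique {a b : Letter N i r} {z : TreeOf N i r} (h : Behind a z) (h' : Behind b z) :
    a = b := by
  cases z
  · exact h.elim
  · exact (h : _ = _).symm.trans h'
  · exact (h : _ = _).symm.trans h'

theorem gate_ray (z : TreeOf N i r) {τ : ℝ} (h0 : 0 ≤ τ) :
    gate (ray γ z τ) = reparam (γ i).toFun (N i).pt (gate z) τ := by
  rcases le_or_gt τ (dist (N i).pt (gate z)) with h | h
  · rw [ray_of_le_gate γ h0 h, gate_sheet]
  · rcases sheet_or_behind z with ⟨x, rfl⟩ | ⟨a, ha⟩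
    · rw [ray_sheet γ x h0, gate_sheet, gate_sheet]
    · rw [(ha.ray γ h).gate_eq, ← ha.gate_eq, (γ i).reparam_of_ge _ _ h.le]

theorem behind_of_behind_ray {a : Letter N i r} {z : TreeOf N i r} {τ : ℝ} (h0 : 0 ≤ τ)
    (h : Behind a (ray γ z τ)) : Behind a z := by
  rcases le_or_gt τ (dist (N i).pt (gate z)) with h1 | h1
  · rw [ray_of_le_gate γ h0 h1] at h
    exact h.elim
  · rcases sheet_or_behind z with ⟨x, rfl⟩ | ⟨b, hb⟩
    · rw [ray_sheet γ x h0] at h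
      exact h.elim
    · rwa [h.unique (hb.ray γ h1)]

theorem min_le_depth_ray (z : TreeOf N i r) {τ : ℝ} (h0 : 0 ≤ τ) :
    min (τ - dist (N i).pt (gate z)) (depth z) ≤ depth (ray γ z τ) := by
  have h1 := height_ray γ z h0
  rw [height_eq, height_eq, gate_ray γ z h0] at h1
  have h2 : dist (N i).pt (reparam (γ i).toFun (N i).pt (gate z) τ) ≤
      dist (N i).pt (gate z) := by
    rw [(γ i).dist_base_reparam _ _ h0]; exact min_le_right _ _
  rcases min_cases τ (dist (N i).pt (gate z) + depth z) with ⟨h3, h4⟩ | ⟨h3, h4⟩ <;>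
    rcases min_cases (τ - dist (N i).pt (gate z)) (depth z) with ⟨h5, h6⟩ | ⟨h5, h6⟩ <;>
    rw [h5] <;> linarith

theorem not_together_ray {z w : TreeOf N i r} (h : ¬ Together z w) {τ : ℝ} (h0 : 0 ≤ τ) :
    ¬ Together (ray γ z τ) (ray γ w τ) := by
  rw [together_iff] at h ⊢
  rintro ⟨a, h1, h2⟩
  exact h ⟨a, behind_of_behind_ray γ h0 h1, behind_of_behind_ray γ h0 h2⟩

/-! ### The Gromov product of a tree of spaces -/

/-- The relation `n < (z | w)` in a tree of spaces, with respect to the root. -/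
abbrev TRel (n : ℕ) (z w : TreeOf N i r) : Prop := (gcc γ i r).Rel (root N i r) n z w

/-- The relation `n < (x | y)` in a sheet. -/
abbrev SRel (N : ∀ i, Net.{u, v} (S i)) (n : ℕ) (x y : S i) : Prop :=
  (sheetGcc γ i).Rel (N i).pt n x y

/-- The constant that is used in the Gromov products of all sheets and trees. -/
def D (γ : ∀ i, GCCBicombing (S i)) : ℝ := (sheetGcc γ true).D₁

theorem D_nonneg : 0 ≤ D γ := zero_le_one.trans (one_le_D₁ _)

theorem tRel_iff {n : ℕ} {z w : TreeOf N i r} : TRel γ n z w ↔ (n : ℝ) < height z ∧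
    (n : ℝ) < height w ∧ ∃ τ : ℝ, (n : ℝ) < τ ∧ dist (ray γ z τ) (ray γ w τ) ≤ D γ := by
  rw [TRel, rel_iff, dist_root, dist_root]
  rfl

theorem sRel_iff {n : ℕ} {x y : S i} : SRel γ N n x y ↔ (n : ℝ) < dist (N i).pt x ∧
    (n : ℝ) < dist (N i).pt y ∧ ∃ τ : ℝ, (n : ℝ) < τ ∧
      dist (reparam (γ i).toFun (N i).pt x τ) (reparam (γ i).toFun (N i).pt y τ) ≤ D γ := by
  rw [SRel, rel_iff]
  rfl

theorem tRel_branch (a : Letter N i r) {n : ℕ} {z w : TreeOf N (!i) false} (h : TRel γ n z w) :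
    TRel γ (n + 1) (branch a z) (branch a w) := by
  obtain ⟨h1, h2, τ, h3, h4⟩ := (tRel_iff γ).1 h
  have hl := dist_nonneg (x := (N i).pt) (y := (N i).toSpace a.1)
  have hn : (0 : ℝ) ≤ n := n.cast_nonneg
  refine (tRel_iff γ).2 ⟨?_, ?_, dist (N i).pt ((N i).toSpace a.1) + 1 + τ, ?_, ?_⟩
  · rw [height_branch]; push_cast; linarith
  · rw [height_branch]; push_cast; linarith
  · push_cast; linarith
  · rwa [ray_branch γ a z (by linarith), ray_branch γ a w (by linarith), dist_branch]

theorem exists_tRel_of_branch (a : Letter N i r) (n : ℕ) : ∃ m, ∀ z w : TreeOf N (!i) false,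
    TRel γ m (branch a z) (branch a w) → TRel γ n z w := by
  obtain ⟨m, hm⟩ := exists_nat_ge (dist (N i).pt ((N i).toSpace a.1) + 1 + n)
  have hn : (0 : ℝ) ≤ n := n.cast_nonneg
  refine ⟨m, fun z w h => ?_⟩
  obtain ⟨h1, h2, τ, h3, h4⟩ := (tRel_iff γ).1 h
  rw [height_branch] at h1 h2
  obtain ⟨σ, rfl⟩ : ∃ σ, τ = dist (N i).pt ((N i).toSpace a.1) + 1 + σ :=
    ⟨τ - (dist (N i).pt ((N i).toSpace a.1) + 1), by ring⟩
  rw [ray_branch γ a z (by linarith), ray_branch γ a w (by linarith), dist_branch] at h4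
  exact (tRel_iff γ).2 ⟨by linarith, by linarith, σ, by linarith, h4⟩

/-- If the paths to two points that are not in the same branch are close at time `τ`, then these
paths have only just left the root sheet at this time, and their projections to it are close. -/
theorem le_of_not_together {z w : TreeOf N i r} (h : ¬ Together z w) {τ : ℝ} (h0 : 0 ≤ τ)
    (hd : dist (ray γ z τ) (ray γ w τ) ≤ D γ) :
    min (τ - dist (N i).pt (gate z)) (depth z) ≤ D γ ∧
      dist (reparam (γ i).toFun (N i).pt (gate z) τ)
        (reparam (γ i).toFun (N i).pt (gate w) τ) ≤ D γ := by
  rw [dist_of_not_together (not_together_ray γ h h0), gate_ray γ z h0, gate_ray γ w h0] at hd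
  have h1 := min_le_depth_ray γ z h0
  have h2 := depth_nonneg (ray γ z τ)
  have h3 := depth_nonneg (ray γ w τ)
  have h4 := dist_nonneg (x := reparam (γ i).toFun (N i).pt (gate z) τ)
    (y := reparam (γ i).toFun (N i).pt (gate w) τ)
  constructor <;> linarith

/-- A point that has a large Gromov product with a point behind the letter `a` is in the branch at
`a`, and not on its edge. -/
theorem exists_mem_range_branch (a : Letter N i r) : ∃ m, ∀ z w : TreeOf N i r,
    TRel γ m z w → Behind a z → ∃ w', w = branch a w' := by
  obtain ⟨m, hm⟩ := exists_nat_ge (dist (N i).pt ((N i).toSpace a.1) + 1 + D γ)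
  have hl := dist_nonneg (x := (N i).pt) (y := (N i).toSpace a.1)
  have hD := D_nonneg γ
  refine ⟨m, fun z w h hz => ?_⟩
  obtain ⟨h1, h2, τ, h3, h4⟩ := (tRel_iff γ).1 h
  have hw : Behind a w := by
    by_contra hw
    have hn : ¬ Together z w := fun h => not_together_of_not_behind hw hz h.symm
    have h5 := (le_of_not_together γ hn (by linarith) h4).1
    rw [height_eq, hz.gate_eq] at h1
    rw [hz.gate_eq, min_le_iff] at h5
    rcases h5 with h5 | h5 <;> linarith
  cases w with
  | sheet x => exact hw.elim
  | edge b t =>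
    cases hw
    rw [height_eq, gate_edge, depth_edge] at h2
    have := t.2.2
    linarith
  | branch b w => cases hw; exact ⟨w, rfl⟩

/-- For points not in a common branch, a large Gromov product passes to the projections to the root
sheet. -/
theorem exists_sRel_gate (n : ℕ) : ∃ m, ∀ z w : TreeOf N i r, ¬ Together z w → TRel γ m z w →
    SRel γ N n (gate z) (gate w) := by
  obtain ⟨m, hm⟩ := exists_nat_ge (n + D γ)
  have hD := D_nonneg γ
  have hn : (0 : ℝ) ≤ n := n.cast_nonneg
  refine ⟨m, fun z w hzw h => ?_⟩
  obtain ⟨h1, h2, τ, h3, h4⟩ := (tRel_iff γ).1 h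
  have hτ : 0 ≤ τ := by linarith
  have h5 := le_of_not_together γ hzw hτ h4
  have h6 := (le_of_not_together γ (fun h => hzw h.symm) hτ (by rwa [dist_comm])).1
  rw [height_eq] at h1 h2
  rw [min_le_iff] at h6
  rw [min_le_iff] at h5
  refine (sRel_iff γ).2 ⟨?_, ?_, τ, by linarith, h5.2⟩
  · rcases h5.1 with h | h <;> linarith
  · rcases h6 with h | h <;> linarith

/-- If the projections of two points to the root sheet have a large Gromov product, then so have the
points themselves, since their paths agree with those of the projections up to the time when they
leave the sheet. -/
theorem exists_tRel_of_gate (n : ℕ) : ∃ m, ∀ z w : TreeOf N i r,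
    SRel γ N m (gate z) (gate w) → TRel γ n z w := by
  have hE := (sheetGcc γ i).one_le_E
  have hC := (sheetGcc γ i).C_nonneg
  have hD := (sheetGcc γ i).one_le_D₁
  have hK : 1 ≤ 2 * (sheetGcc γ i).E * (sheetGcc γ i).D₁ := by nlinarith
  set K := 2 * (sheetGcc γ i).E * (sheetGcc γ i).D₁ with hKdef
  have hn : (0 : ℝ) ≤ n := n.cast_nonneg
  obtain ⟨m, hm⟩ := exists_nat_ge (K * (n + 1))
  refine ⟨m, fun z w h => ?_⟩
  have h1 := (sRel_iff γ).1 h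
  have h2 : dist (reparam (γ i).toFun (N i).pt (gate z) (m / K))
      (reparam (γ i).toFun (N i).pt (gate w) (m / K)) ≤ 1 + (sheetGcc γ i).C := by
    refine (sheetGcc γ i).dist_reparam_le m.cast_nonneg ?_
    rw [ENNReal.ofReal_natCast]; exact h
  have h3 : (m : ℝ) / K ≤ m := div_le_self m.cast_nonneg hK
  have h4 : (n : ℝ) + 1 ≤ m / K := by
    rw [le_div_iff₀ (by linarith)]; linarith
  have hz := depth_nonneg z
  have hw := depth_nonneg w
  refine (tRel_iff γ).2 ⟨by rw [height_eq]; linarith, by rw [height_eq]; linarith, m / K,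
    by linarith, ?_⟩
  rw [ray_of_le_gate γ (by linarith) (by linarith), ray_of_le_gate γ (by linarith) (by linarith),
    dist_sheet, gate_sheet, depth_sheet, add_zero]
  refine h2.trans ?_
  change _ ≤ (sheetGcc γ i).D₁
  unfold D₁; linarith

/-! ### The ideal boundary of a tree of spaces -/

/-- The ideal boundary of a tree of spaces. -/
abbrev BT (N : ∀ i, Net.{u, v} (S i)) (i r : Bool) : Type _ :=
  (gcc γ i r).IdealBoundary (root N i r)

/-- The ideal boundary of a sheet. -/
abbrev BS (N : ∀ i, Net.{u, v} (S i)) (i : Bool) : Type _ :=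
  (sheetGcc γ i).IdealBoundary (N i).pt

theorem pushes_sheet : Pushes (sheetGcc γ i) (N i).pt (gcc γ i r) (root N i r) sheet := by
  intro n
  obtain ⟨m, hm⟩ := exists_tRel_of_gate (N := N) (i := i) (r := r) γ n
  exact ⟨m, fun x y h => hm _ _ (by rwa [gate_sheet, gate_sheet])⟩

theorem pulls_sheet : Pulls (sheetGcc γ i) (N i).pt (gcc γ i r) (root N i r) sheet := by
  intro n
  obtain ⟨m, hm⟩ := exists_sRel_gate (N := N) (i := i) (r := r) γ n
  refine ⟨m, fun x y h => ?_⟩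
  have := hm _ _ (not_together_sheet _ _) h
  rwa [gate_sheet, gate_sheet] at this

theorem pushes_branch (a : Letter N i r) :
    Pushes (gcc γ (!i) false) (root N (!i) false) (gcc γ i r) (root N i r) (branch a) :=
  fun n => ⟨n, fun _ _ h => (tRel_branch γ a h).mono (Nat.le_succ n)⟩

theorem pulls_branch (a : Letter N i r) :
    Pulls (gcc γ (!i) false) (root N (!i) false) (gcc γ i r) (root N i r) (branch a) :=
  exists_tRel_of_branch γ a

/-- The inclusion of the boundary of the root sheet. -/
def bSheet : BS γ N i → BT γ N i r := bmap (pushes_sheet γ)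

/-- The inclusion of the boundary of the branch at the letter `a`. -/
def bBranch (a : Letter N i r) : BT γ N (!i) false → BT γ N i r := bmap (pushes_branch γ a)

theorem reps_bSheet {ζ : BS γ N i} {x : ℕ → S i} (hx : (sheetGcc γ i).Reps x ζ) :
    (gcc γ i r).Reps (fun k => sheet (x k)) (bSheet γ ζ : BT γ N i r) := hx.bmap _

theorem reps_bBranch (a : Letter N i r) {ζ : BT γ N (!i) false} {x : ℕ → TreeOf N (!i) false}
    (hx : (gcc γ (!i) false).Reps x ζ) :
    (gcc γ i r).Reps (fun k => branch a (x k)) (bBranch γ a ζ) := hx.bmap _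

theorem bSheet_injective : Function.Injective (bSheet γ : BS γ N i → BT γ N i r) :=
  bmap_injective _ (pulls_sheet γ)

theorem bBranch_injective (a : Letter N i r) : Function.Injective (bBranch γ a) :=
  bmap_injective _ (pulls_branch γ a)

theorem continuous_bSheet : Continuous (bSheet γ : BS γ N i → BT γ N i r) := continuous_bmap _

theorem continuous_bBranch (a : Letter N i r) : Continuous (bBranch γ a) := continuous_bmap _

theorem bBranch_mem_nb (a : Letter N i r) {n : ℕ} {ζ η : BT γ N (!i) false} (h : η ∈ Nb n ζ) :
    bBranch γ a η ∈ Nb (n + 1) (bBranch γ a ζ) :=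
  bmap_mem_nb _ (fun _ _ => tRel_branch γ a) h

/-- A boundary point of a tree of spaces is a boundary point of the root sheet or of a branch. -/
theorem exists_eq_bSheet_or_bBranch (ξ : BT γ N i r) :
    (∃ ζ, ξ = bSheet γ ζ) ∨ ∃ a ζ, ξ = bBranch γ a ζ := by
  obtain ⟨x, hx⟩ := exists_reps ξ
  by_cases h : ∃ a, ∀ K, ∃ k, K ≤ k ∧ Behind a (x k)
  · obtain ⟨a, ha⟩ := h
    right
    obtain ⟨m, hm⟩ := exists_mem_range_branch γ a
    obtain ⟨K, hK⟩ := hx.convInfty m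
    obtain ⟨k, hk, hak⟩ := ha K
    choose y hy using fun j : ℕ => hm _ _ (hK k (j + K) hk (Nat.le_add_left _ _)) hak
    have hr : (gcc γ i r).Reps (branch a ∘ y) ξ := by
      have : branch a ∘ y = x ∘ (· + K) := funext fun j => (hy j).symm
      rw [this]
      exact hx.comp fun j => Nat.le_add_right _ _
    obtain ⟨ζ, hζ⟩ := ((pulls_branch γ a).convInfty hr.convInfty).exists_reps
    exact ⟨a, ζ, ((bmap_eq_iff _ hζ).2 hr).symm⟩
  · push Not at h
    left
    have hfar : ∀ k K, ∃ j, K ≤ j ∧ ¬ Together (x k) (x j) := by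
      intro k K
      rcases sheet_or_behind (x k) with ⟨y, hy⟩ | ⟨a, ha⟩
      · rw [hy]
        exact ⟨K, le_rfl, not_together_sheet _ _⟩
      · obtain ⟨K', hK'⟩ := h a
        exact ⟨max K K', le_max_left _ _,
          fun ht => not_together_of_not_behind (hK' _ (le_max_right _ _)) ha ht.symm⟩
    have hr : (gcc γ i r).Reps (sheet ∘ fun k => gate (x k)) ξ := by
      refine hx.of_close fun n => ?_
      obtain ⟨m, hm⟩ := exists_tRel_of_gate (N := N) (i := i) (r := r) γ n
      obtain ⟨m', hm'⟩ := exists_sRel_gate (N := N) (i := i) (r := r) γ m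
      obtain ⟨K, hK⟩ := hx.convInfty m'
      refine ⟨K, fun k hk => hm _ _ ?_⟩
      obtain ⟨j, hj, hkj⟩ := hfar k K
      have := hm' _ _ hkj (hK k j hk hj)
      simp only [Function.comp, gate_sheet]
      exact rel_self this.lt_dist
    obtain ⟨ζ, hζ⟩ := ((pulls_sheet γ).convInfty hr.convInfty).exists_reps
    exact ⟨ζ, ((bmap_eq_iff _ hζ).2 hr).symm⟩

/-- The boundaries of the branches are uniformly open. -/
theorem exists_nb_subset_bBranch (a : Letter N i r) (n : ℕ) : ∃ m, ∀ ζ : BT γ N (!i) false,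
    ∀ η ∈ Nb m (bBranch γ a ζ), ∃ η' ∈ Nb n ζ, η = bBranch γ a η' := by
  obtain ⟨m₁, h1⟩ := exists_mem_range_branch γ a
  obtain ⟨m₂, h2⟩ := pulls_branch γ a n
  obtain ⟨m, -, hm⟩ := (gcc γ i r).exists_rel_of_mem_nb (root N i r) (max m₁ m₂)
  refine ⟨m, fun ζ η hη => ?_⟩
  obtain ⟨x, hx⟩ := exists_reps ζ
  rcases exists_eq_bSheet_or_bBranch γ η with ⟨ζ', rfl⟩ | ⟨b, ζ', rfl⟩
  · obtain ⟨y, hy⟩ := exists_reps ζ'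
    obtain ⟨K, hK⟩ := hm _ _ hη _ _ (reps_bBranch γ a hx) (reps_bSheet γ hy)
    obtain ⟨w, hw⟩ := h1 _ _ ((hK K K le_rfl le_rfl).mono (le_max_left _ _)) rfl
    cases hw
  · obtain ⟨y, hy⟩ := exists_reps ζ'
    obtain ⟨K, hK⟩ := hm _ _ hη _ _ (reps_bBranch γ a hx) (reps_bBranch γ b hy)
    obtain ⟨w, hw⟩ := h1 _ _ ((hK K K le_rfl le_rfl).mono (le_max_left _ _)) rfl
    obtain rfl : b = a := by injection hw
    exact ⟨ζ', ⟨x, y, hx, hy, K, fun k hk => h2 _ _ ((hK k k hk hk).mono (le_max_right _ _))⟩, rfl⟩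

theorem bSheet_ne_bBranch (a : Letter N i r) (ζ : BS γ N i) (ζ' : BT γ N (!i) false) :
    bSheet γ ζ ≠ bBranch γ a ζ' := by
  intro h
  obtain ⟨m, hm⟩ := exists_mem_range_branch γ a
  obtain ⟨x, hx⟩ := exists_reps ζ
  obtain ⟨y, hy⟩ := exists_reps ζ'
  obtain ⟨K, hK⟩ := ((reps_bBranch γ a hy).eq_iff (reps_bSheet γ hx)).1 h.symm m
  obtain ⟨w, hw⟩ := hm _ _ (hK K le_rfl) rfl
  cases hw

theorem letter_eq_of_bBranch_eq {a b : Letter N i r} {ζ ζ' : BT γ N (!i) false}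
    (h : bBranch γ a ζ = bBranch γ b ζ') : a = b := by
  obtain ⟨m, hm⟩ := exists_mem_range_branch γ a
  obtain ⟨x, hx⟩ := exists_reps ζ
  obtain ⟨y, hy⟩ := exists_reps ζ'
  obtain ⟨K, hK⟩ := ((reps_bBranch γ a hx).eq_iff (reps_bBranch γ b hy)).1 h m
  obtain ⟨w, hw⟩ := hm _ _ (hK K le_rfl) rfl
  obtain rfl : b = a := by injection hw
  rfl

/-- Boundary points close to a boundary point `ζ` of the root sheet lie on the root sheet, or in
branches at letters that are close to `ζ`. -/
theorem exists_near_of_mem_nb (n : ℕ) : ∃ m, ∀ (ζ : BS γ N i) (η : BT γ N i r),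
    η ∈ Nb m (bSheet γ ζ) → (∃ ζ' ∈ Nb n ζ, η = bSheet γ ζ') ∨
      ∃ a ζ', η = bBranch γ a ζ' ∧ Near n ((N i).toSpace a.1) ζ := by
  obtain ⟨m₁, h1⟩ := exists_sRel_gate (N := N) (i := i) (r := r) γ n
  obtain ⟨m, -, hm⟩ := (gcc γ i r).exists_rel_of_mem_nb (root N i r) m₁
  refine ⟨m, fun ζ η hη => ?_⟩
  obtain ⟨x, hx⟩ := exists_reps ζ
  rcases exists_eq_bSheet_or_bBranch γ η with ⟨ζ', rfl⟩ | ⟨b, ζ', rfl⟩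
  · obtain ⟨y, hy⟩ := exists_reps ζ'
    obtain ⟨K, hK⟩ := hm _ _ hη _ _ (reps_bSheet γ hx) (reps_bSheet γ hy)
    refine Or.inl ⟨ζ', ⟨x, y, hx, hy, K, fun k hk => ?_⟩, rfl⟩
    have := h1 _ _ (not_together_sheet _ _) (hK k k hk hk)
    rwa [gate_sheet, gate_sheet] at this
  · obtain ⟨y, hy⟩ := exists_reps ζ'
    obtain ⟨K, hK⟩ := hm _ _ hη _ _ (reps_bSheet γ hx) (reps_bBranch γ b hy)
    refine Or.inr ⟨b, ζ', rfl, x, hx, K, fun k hk => ?_⟩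
    have := h1 _ _ (not_together_sheet _ _) (hK k k hk hk)
    rw [gate_sheet, gate_branch] at this
    exact this.symm

/-- The whole branch at a letter close to a boundary point of the root sheet is close to it. -/
theorem exists_mem_nb_of_near (n : ℕ) : ∃ m, ∀ (a : Letter N i r) (ζ : BS γ N i),
    Near m ((N i).toSpace a.1) ζ → ∀ η, bBranch γ a η ∈ Nb n (bSheet γ ζ) := by
  obtain ⟨m, hm⟩ := exists_tRel_of_gate (N := N) (i := i) (r := r) γ n
  refine ⟨m, ?_⟩
  rintro a ζ ⟨x, hx, K, hK⟩ η
  obtain ⟨y, hy⟩ := exists_reps η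
  refine ⟨_, _, reps_bSheet γ hx, reps_bBranch γ a hy, K, fun k hk => hm _ _ ?_⟩
  rw [gate_sheet, gate_branch]
  exact (hK k hk).symm

end TreeOf

/-! ### Covering dimension -/

section CoveringDim

/-- Covering dimension at most `n`, in terms of indexed covers and their shrinkings. -/
def IndexedDimLE (M : Type*) [TopologicalSpace M] (n : ℕ) : Prop :=
  ∀ (k : ℕ) (U : Fin k → Set M), (∀ j, IsOpen (U j)) → (∀ p, ∃ j, p ∈ U j) →
    ∃ V : Fin k → Set M, (∀ j, IsOpen (V j)) ∧ (∀ j, V j ⊆ U j) ∧ (∀ p, ∃ j, p ∈ V j) ∧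
      ∀ p, {j | p ∈ V j}.ncard ≤ n + 1

theorem coveringDimLE_iff_indexed {M : Type*} [TopologicalSpace M] {n : ℕ} :
    CoveringDimLE M n ↔ IndexedDimLE M n := by
  constructor
  · intro h k U hU hcov
    obtain ⟨𝒱, hfin, hopen, hc, hsub, hcard⟩ := h (Set.range U) (Set.finite_range U)
      (by rintro _ ⟨j, rfl⟩; exact hU j)
      (Set.eq_univ_of_forall fun p => by
        obtain ⟨j, hj⟩ := hcov p
        exact ⟨U j, ⟨j, rfl⟩, hj⟩)
    have hsub' : ∀ W : 𝒱, ∃ j, W.1 ⊆ U j := by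
      rintro ⟨W, hW⟩
      obtain ⟨_, ⟨j, rfl⟩, hj⟩ := hsub W hW
      exact ⟨j, hj⟩
    choose f hf using hsub'
    have := hfin.to_subtype
    refine ⟨fun j => ⋃ (W : 𝒱) (_ : f W = j), W.1, fun j => ?_, fun j => ?_, fun p => ?_,
      fun p => ?_⟩
    · exact isOpen_iUnion fun W => isOpen_iUnion fun _ => hopen W.1 W.2
    · exact Set.iUnion₂_subset fun W hW => hW ▸ hf W
    · obtain ⟨W, hW, hp⟩ := Set.mem_sUnion.1 (hc.symm ▸ Set.mem_univ p)
      exact ⟨f ⟨W, hW⟩, Set.mem_iUnion₂.2 ⟨⟨W, hW⟩, rfl, hp⟩⟩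
    · refine le_trans ?_ (hcard p)
      have e : {j | p ∈ ⋃ (W : 𝒱) (_ : f W = j), W.1} ⊆ f '' {W : 𝒱 | p ∈ W.1} := by
        intro j hj
        obtain ⟨W, hW, hp⟩ := Set.mem_iUnion₂.1 hj
        exact ⟨W, hp, hW⟩
      refine (Set.ncard_le_ncard e (Set.toFinite _)).trans
        ((Set.ncard_image_le (Set.toFinite _)).trans ?_)
      rw [← Set.ncard_image_of_injective _ Subtype.val_injective]
      refine Set.ncard_le_ncard ?_ (hfin.subset fun W hW => hW.1)
      rintro _ ⟨W, hW, rfl⟩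
      exact ⟨W.2, hW⟩
  · intro h 𝒰 hfin hopen hc
    have := hfin.to_subtype
    obtain ⟨k, ⟨φ⟩⟩ := Finite.exists_equiv_fin 𝒰
    obtain ⟨V, hV, hsub, hcov, hcard⟩ := h k (fun j => (φ.symm j).1)
      (fun j => hopen _ (φ.symm j).2) fun p => by
        obtain ⟨W, hW, hp⟩ := Set.mem_sUnion.1 (hc.symm ▸ Set.mem_univ p)
        exact ⟨φ ⟨W, hW⟩, by simpa using hp⟩
    refine ⟨Set.range V, Set.finite_range V, ?_, ?_, ?_, fun p => ?_⟩
    · rintro _ ⟨j, rfl⟩; exact hV j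
    · refine Set.eq_univ_of_forall fun p => ?_
      obtain ⟨j, hj⟩ := hcov p
      exact ⟨V j, ⟨j, rfl⟩, hj⟩
    · rintro _ ⟨j, rfl⟩
      exact ⟨_, (φ.symm j).2, hsub j⟩
    · refine le_trans ?_ (hcard p)
      have e : {W ∈ Set.range V | p ∈ W} ⊆ V '' {j | p ∈ V j} := by
        rintro _ ⟨⟨j, rfl⟩, hj⟩
        exact ⟨j, hj, rfl⟩
      exact (Set.ncard_le_ncard e (Set.toFinite _)).trans (Set.ncard_image_le (Set.toFinite _))

theorem CoveringDimLE.mono {M : Type*} [TopologicalSpace M] {m n : ℕ} (h : CoveringDimLE M m)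
    (hmn : m ≤ n) : CoveringDimLE M n := by
  intro 𝒰 hfin hopen hc
  obtain ⟨𝒱, h1, h2, h3, h4, h5⟩ := h 𝒰 hfin hopen hc
  exact ⟨𝒱, h1, h2, h3, h4, fun p => (h5 p).trans (by omega)⟩

theorem coveringDim_le_natCast_iff {M : Type*} [TopologicalSpace M] {n : ℕ} :
    coveringDim M ≤ ((n : ℕ∞) : WithBot ℕ∞) ↔ CoveringDimLE M n := by
  unfold coveringDim
  split_ifs with hM
  · refine iff_of_true bot_le fun 𝒰 _ _ _ => ⟨∅, Set.finite_empty, by simp, ?_, by simp, by simp⟩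
    exact Set.eq_univ_of_forall fun p => (hM.false p).elim
  · rw [WithBot.coe_le_coe]
    constructor
    · intro h
      have hlt : (⨅ (n : ℕ) (_ : CoveringDimLE M n), (n : ℕ∞) : ℕ∞) < ((n + 1 : ℕ) : ℕ∞) :=
        lt_of_le_of_lt h (by exact_mod_cast Nat.lt_succ_self n)
      obtain ⟨m, hm⟩ := iInf_lt_iff.1 hlt
      obtain ⟨hm1, hm2⟩ := iInf_lt_iff.1 hm
      exact hm1.mono (Nat.lt_succ_iff.1 (by exact_mod_cast hm2))
    · exact fun h => iInf₂_le n h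

theorem coveringDim_eq_bot_iff {M : Type*} [TopologicalSpace M] :
    coveringDim M = ⊥ ↔ IsEmpty M := by
  unfold coveringDim
  split_ifs with hM
  · simp [hM]
  · simp [hM, WithBot.coe_ne_bot]

theorem WithBot.le_of_forall_natCast {a b : WithBot ℕ∞} (hb : b ≠ ⊥)
    (h : ∀ n : ℕ, b ≤ ((n : ℕ∞) : WithBot ℕ∞) → a ≤ ((n : ℕ∞) : WithBot ℕ∞)) : a ≤ b := by
  induction b with
  | bot => exact (hb rfl).elim
  | coe b =>
    induction b using ENat.recTopCoe with
    | top => exact le_top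
    | coe n => exact h n le_rfl

/-- The covering dimension of a retract. -/
theorem coveringDim_le_of_leftInverse {A M : Type*} [TopologicalSpace A] [TopologicalSpace M]
    {f : A → M} {g : M → A} (hf : Continuous f) (hg : Continuous g)
    (hgf : Function.LeftInverse g f) : coveringDim A ≤ coveringDim M := by
  by_cases hM : coveringDim M = ⊥
  · have := coveringDim_eq_bot_iff.1 hM
    rw [coveringDim_eq_bot_iff.2 (Function.isEmpty f)]
    exact bot_le
  refine WithBot.le_of_forall_natCast hM fun n hn => ?_
  rw [coveringDim_le_natCast_iff, coveringDimLE_iff_indexed] at hn ⊢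
  intro k U hU hcov
  obtain ⟨V, h1, h2, h3, h4⟩ := hn k (fun j => g ⁻¹' U j) (fun j => (hU j).preimage hg)
    fun p => hcov (g p)
  refine ⟨fun j => f ⁻¹' V j, fun j => (h1 j).preimage hf, fun j p hp => ?_, fun p => h3 (f p),
    fun p => h4 (f p)⟩
  have : g (f p) ∈ U j := h2 j hp
  rwa [hgf p] at this

theorem Homeomorph.coveringDim_eq {A M : Type*} [TopologicalSpace A] [TopologicalSpace M]
    (f : A ≃ₜ M) : coveringDim A = coveringDim M :=
  le_antisymm (coveringDim_le_of_leftInverse f.continuous f.symm.continuous f.left_inv)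
    (coveringDim_le_of_leftInverse f.symm.continuous f.continuous f.right_inv)

end CoveringDim

namespace GCCBicombing

variable {X : Type u} [MetricSpace X] {γ : GCCBicombing X} {e : X}

theorem nb_anti {m n : ℕ} (h : n ≤ m) (ξ : γ.IdealBoundary e) : Nb m ξ ⊆ Nb n ξ := by
  rintro η ⟨x, y, hx, hy, N, hN⟩
  exact ⟨x, y, hx, hy, N, fun i hi => (hN i hi).mono h⟩

theorem mem_nb_comm {n : ℕ} {ξ η : γ.IdealBoundary e} (h : η ∈ Nb n ξ) : ξ ∈ Nb n η := by
  obtain ⟨x, y, hx, hy, N, hN⟩ := h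
  exact ⟨y, x, hy, hx, N, fun i hi => (hN i hi).symm⟩

theorem Near.mono {m n : ℕ} {g : X} {ξ : γ.IdealBoundary e} (hg : Near m g ξ) (h : n ≤ m) :
    Near n g ξ := by
  obtain ⟨x, hx, N, hN⟩ := hg
  exact ⟨x, hx, N, fun i hi => (hN i hi).mono h⟩

end GCCBicombing

open GCCBicombing

namespace TreeOf

variable {S : Bool → Type u} [∀ i, MetricSpace (S i)] {N : ∀ i, Net.{u, v} (S i)}
  (γ : ∀ i, GCCBicombing (S i)) {i r : Bool}

/-! ### Retractions to the boundaries of the root sheet and of a branch -/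

/-- A continuous retraction to the boundary of the root sheet: a branch is sent to a boundary point
of the sheet that is close to the branch. -/
theorem exists_retraction_bSheet [h : Nonempty (BS γ N i)] :
    ∃ g : BT γ N i r → BS γ N i, Continuous g ∧ Function.LeftInverse g (bSheet γ) := by
  obtain ⟨ζ₀⟩ := h
  obtain ⟨p, hp1, hp2⟩ := (sheetGcc γ i).exists_projection (N i).pt
  have hq : ∀ a : Letter N i r, ∃ ζ, ∀ η ∈ p ((N i).toSpace a.1), η = ζ := by
    intro a
    rcases (p ((N i).toSpace a.1)).eq_empty_or_nonempty with h | ⟨ζ, hζ⟩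
    · exact ⟨ζ₀, by simp [h]⟩
    · exact ⟨ζ, fun η hη => hp1 _ hη hζ⟩
  choose q hq using hq
  have hg : ∀ ξ : BT γ N i r, ∃ ζ, (∀ ζ', ξ = bSheet γ ζ' → ζ = ζ') ∧
      ∀ a ζ', ξ = bBranch γ a ζ' → ζ = q a := by
    intro ξ
    rcases exists_eq_bSheet_or_bBranch γ ξ with ⟨ζ, rfl⟩ | ⟨a, ζ, rfl⟩
    · exact ⟨ζ, fun ζ' h => bSheet_injective γ h,
        fun a ζ' h => (bSheet_ne_bBranch γ a ζ ζ' h).elim⟩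
    · exact ⟨q a, fun ζ' h => (bSheet_ne_bBranch γ a ζ' ζ h.symm).elim,
        fun b ζ' h => by rw [letter_eq_of_bBranch_eq γ h]⟩
  choose g hg1 hg2 using hg
  refine ⟨g, ⟨fun U hU => isOpen_iff_nb.2 fun ξ hξ => ?_⟩, fun ζ => hg1 _ _ rfl⟩
  rcases exists_eq_bSheet_or_bBranch γ ξ with ⟨ζ, rfl⟩ | ⟨a, ζ, rfl⟩
  · have hζ : ζ ∈ U := by rwa [Set.mem_preimage, hg1 _ _ rfl] at hξ
    obtain ⟨n, hn⟩ := isOpen_iff_nb.1 hU ζ hζ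
    obtain ⟨m, hm⟩ := hp2 n
    obtain ⟨m', hm'⟩ := exists_near_of_mem_nb (N := N) (i := i) (r := r) γ (max n m)
    refine ⟨m', fun η hη => ?_⟩
    rw [Set.mem_preimage]
    rcases hm' ζ η hη with ⟨ζ', hζ', rfl⟩ | ⟨a, ζ', rfl, ha⟩
    · rw [hg1 _ _ rfl]
      exact hn (nb_anti (le_max_left _ _) _ hζ')
    · obtain ⟨η', hη', h⟩ := hm _ _ (ha.mono (le_max_right _ _))
      rw [hg2 _ a ζ' rfl, ← hq a η' hη']
      exact hn h
  · obtain ⟨m, hm⟩ := exists_nb_subset_bBranch γ a 0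
    refine ⟨m, fun η hη => ?_⟩
    obtain ⟨η', -, rfl⟩ := hm ζ η hη
    rw [Set.mem_preimage, hg2 _ a _ rfl] at hξ ⊢
    exact hξ

/-- The boundary of a branch is open and closed, so that its complement can be sent to one
point. -/
theorem exists_retraction_bBranch (a : Letter N i r) [h : Nonempty (BT γ N (!i) false)] :
    ∃ g : BT γ N i r → BT γ N (!i) false, Continuous g ∧
      Function.LeftInverse g (bBranch γ a) := by
  obtain ⟨ζ₀⟩ := h
  have hg : ∀ ξ : BT γ N i r, ∃ ζ, (∀ ζ', ξ = bBranch γ a ζ' → ζ = ζ') ∧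
      ((∀ ζ', ξ ≠ bBranch γ a ζ') → ζ = ζ₀) := by
    intro ξ
    by_cases h : ∃ ζ, ξ = bBranch γ a ζ
    · obtain ⟨ζ, rfl⟩ := h
      exact ⟨ζ, fun ζ' h => bBranch_injective γ a h, fun h => (h ζ rfl).elim⟩
    · exact ⟨ζ₀, fun ζ' h' => (h ⟨ζ', h'⟩).elim, fun _ => rfl⟩
  choose g hg1 hg2 using hg
  refine ⟨g, ⟨fun U hU => isOpen_iff_nb.2 fun ξ hξ => ?_⟩, fun ζ => hg1 _ _ rfl⟩
  rw [Set.mem_preimage] at hξ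
  by_cases h : ∃ ζ, ξ = bBranch γ a ζ
  · obtain ⟨ζ, rfl⟩ := h
    rw [hg1 _ _ rfl] at hξ
    obtain ⟨n, hn⟩ := isOpen_iff_nb.1 hU ζ hξ
    obtain ⟨m, hm⟩ := exists_nb_subset_bBranch γ a n
    refine ⟨m, fun η hη => ?_⟩
    obtain ⟨η', hη', rfl⟩ := hm ζ η hη
    rw [Set.mem_preimage, hg1 _ _ rfl]
    exact hn hη'
  · push Not at h
    rw [hg2 _ h] at hξ
    obtain ⟨m, hm⟩ := exists_nb_subset_bBranch γ a 0
    refine ⟨m, fun η hη => ?_⟩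
    rw [Set.mem_preimage, hg2 η fun ζ' hζ' => ?_]
    · exact hξ
    · subst hζ'
      obtain ⟨η', -, h'⟩ := hm ζ' ξ (mem_nb_comm hη)
      exact h η' h'

/-! ### The upper bound for the dimension -/

section Shrinking

variable {γ} {k : ℕ} (sh : ∀ i, (Fin k → Set (BS γ N i)) → Fin k → Set (BS γ N i))
  (p : ∀ i, S i → Set (BS γ N i))

/-- The indices `j` for which the branch at `a` is contained in `U j`, and the boundary points of
the root sheet close to this branch are in the `j`-th set of the shrinking. -/
def goodIndices (U : Fin k → Set (BT γ N i r)) (a : Letter N i r) : Set (Fin k) :=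
  {j | bBranch γ a ⁻¹' U j = Set.univ ∧
    (p i ((N i).toSpace a.1) ∩ sh i (fun j => bSheet γ ⁻¹' U j) j).Nonempty}

/-- The indices of the sets of the shrinking that contain the whole branch at `a`: the good indices,
or, if there are none, one index `j` chosen such that `U j` contains the branch. -/
def LeafIndex (U : Fin k → Set (BT γ N i r)) (a : Letter N i r) (j : Fin k) : Prop :=
  j ∈ goodIndices sh p U a ∨ goodIndices sh p U a = ∅ ∧
    ∃ h : ∃ j, bBranch γ a ⁻¹' U j = Set.univ, j = h.choose

/-- The shrinking of a cover `U` of the boundary of a tree of spaces, no member of which is the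
whole boundary. On the boundary of the root sheet it is the given shrinking. A branch that is
contained in a member of the cover is not subdivided. The other branches are treated
recursively. -/
inductive Shrinking : ∀ {i r : Bool}, (Fin k → Set (BT γ N i r)) → Fin k → BT γ N i r → Prop
  | sheet {i r : Bool} {U : Fin k → Set (BT γ N i r)} {j : Fin k} {ζ : BS γ N i}
      (h : ζ ∈ sh i (fun j => bSheet γ ⁻¹' U j) j) : Shrinking U j (bSheet γ ζ)
  | leaf {i r : Bool} {U : Fin k → Set (BT γ N i r)} {j : Fin k} (a : Letter N i r)
      (ζ : BT γ N (!i) false) (h : LeafIndex sh p U a j) : Shrinking U j (bBranch γ a ζ)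
  | node {i r : Bool} {U : Fin k → Set (BT γ N i r)} {j : Fin k} {a : Letter N i r}
      {ζ : BT γ N (!i) false} (h : ∀ j, bBranch γ a ⁻¹' U j ≠ Set.univ)
      (h' : Shrinking (fun j => bBranch γ a ⁻¹' U j) j ζ) : Shrinking U j (bBranch γ a ζ)

variable {sh p}

theorem LeafIndex.preimage_eq {U : Fin k → Set (BT γ N i r)} {a : Letter N i r} {j : Fin k}
    (h : LeafIndex sh p U a j) : bBranch γ a ⁻¹' U j = Set.univ := by
  rcases h with h | ⟨-, h, rfl⟩
  · exact h.1
  · exact h.choose_spec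

theorem exists_leafIndex {U : Fin k → Set (BT γ N i r)} {a : Letter N i r}
    (h : ∃ j, bBranch γ a ⁻¹' U j = Set.univ) : ∃ j, LeafIndex sh p U a j := by
  rcases (goodIndices sh p U a).eq_empty_or_nonempty with h' | ⟨j, hj⟩
  · exact ⟨_, Or.inr ⟨h', h, rfl⟩⟩
  · exact ⟨j, Or.inl hj⟩

theorem shrinking_bSheet_iff {U : Fin k → Set (BT γ N i r)} {j : Fin k} {ζ : BS γ N i} :
    Shrinking sh p U j (bSheet γ ζ) ↔ ζ ∈ sh i (fun j => bSheet γ ⁻¹' U j) j := by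
  refine ⟨fun h => ?_, Shrinking.sheet⟩
  generalize hξ : (bSheet γ ζ : BT γ N i r) = ξ at h
  cases h with
  | sheet h => rwa [bSheet_injective γ hξ]
  | leaf a ζ' h => exact (bSheet_ne_bBranch γ a _ _ hξ).elim
  | node h h' => exact (bSheet_ne_bBranch γ _ _ _ hξ).elim

theorem shrinking_bBranch_iff {U : Fin k → Set (BT γ N i r)} {j : Fin k} {a : Letter N i r}
    {ζ : BT γ N (!i) false} : Shrinking sh p U j (bBranch γ a ζ) ↔ LeafIndex sh p U a j ∨
      (∀ j, bBranch γ a ⁻¹' U j ≠ Set.univ) ∧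
        Shrinking sh p (fun j => bBranch γ a ⁻¹' U j) j ζ := by
  refine ⟨fun h => ?_, fun h => h.elim (Shrinking.leaf a ζ) fun h => Shrinking.node h.1 h.2⟩
  generalize hξ : bBranch γ a ζ = ξ at h
  cases h with
  | sheet h => exact (bSheet_ne_bBranch γ a _ _ hξ.symm).elim
  | leaf b ζ' h =>
    obtain rfl := letter_eq_of_bBranch_eq γ hξ
    exact Or.inl h
  | node h h' =>
    obtain rfl := letter_eq_of_bBranch_eq γ hξ
    rw [bBranch_injective γ a hξ]
    exact Or.inr ⟨h, h'⟩

theorem Shrinking.mem (hsub : ∀ i U j, sh i U j ⊆ U j) {U : Fin k → Set (BT γ N i r)} {j : Fin k}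
    {ξ : BT γ N i r} (h : Shrinking sh p U j ξ) : ξ ∈ U j := by
  induction h with
  | sheet h => exact hsub _ _ _ h
  | leaf a ζ h =>
    have : ζ ∈ bBranch γ a ⁻¹' _ := h.preimage_eq ▸ Set.mem_univ ζ
    exact this
  | node h h' ih => exact ih

/-- The shrinking is open. At a boundary point `ζ` of the root sheet, the branches close to `ζ` are
contained in the same member of the cover as `ζ`, and their letters are sent to points near `ζ`, so
that they fall under the good indices. -/
theorem Shrinking.exists_nb_subset (hsub : ∀ i U j, sh i U j ⊆ U j)
    (hopen : ∀ i (U : Fin k → Set (BS γ N i)), (∀ j, IsOpen (U j)) → ∀ j, IsOpen (sh i U j))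
    (hp : ∀ i n, ∃ m, ∀ g ξ, Near m g ξ → ∃ η ∈ p i g, η ∈ Nb n ξ)
    {U : Fin k → Set (BT γ N i r)} {j : Fin k} {ξ : BT γ N i r} (h : Shrinking sh p U j ξ)
    (hU : ∀ j, IsOpen (U j)) : ∃ n, ∀ η ∈ Nb n ξ, Shrinking sh p U j η := by
  induction h with
  | @sheet i r U j ζ h =>
    obtain ⟨n₁, h1⟩ := isOpen_iff_nb.1
      (hopen i _ (fun j => (hU j).preimage (continuous_bSheet γ)) j) ζ h
    obtain ⟨n₂, h2⟩ := isOpen_iff_nb.1 (hU j) _ (hsub _ _ _ h)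
    obtain ⟨m₁, h3⟩ := hp i n₁
    obtain ⟨m₂, h4⟩ := exists_mem_nb_of_near (N := N) (i := i) (r := r) γ n₂
    obtain ⟨n, hn⟩ := exists_near_of_mem_nb (N := N) (i := i) (r := r) γ (max n₁ (max m₁ m₂))
    refine ⟨n, fun η hη => ?_⟩
    rcases hn ζ η hη with ⟨ζ', hζ', rfl⟩ | ⟨a, ζ', rfl, ha⟩
    · exact Shrinking.sheet (h1 (nb_anti (le_max_left _ _) _ hζ'))
    · obtain ⟨η', hη', h'⟩ := h3 _ _ (ha.mono ((le_max_left _ _).trans (le_max_right _ _)))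
      refine Shrinking.leaf a ζ' (Or.inl ⟨Set.eq_univ_of_forall fun x => h2 ?_, η', hη', h1 h'⟩)
      exact h4 a ζ (ha.mono ((le_max_right _ _).trans (le_max_right _ _))) x
  | leaf a ζ h =>
    obtain ⟨n, hn⟩ := exists_nb_subset_bBranch γ a 0
    refine ⟨n, fun η hη => ?_⟩
    obtain ⟨η', -, rfl⟩ := hn ζ η hη
    exact Shrinking.leaf a η' h
  | @node i r U j a ζ h h' ih =>
    obtain ⟨m, hm⟩ := ih fun j => (hU j).preimage (continuous_bBranch γ a)
    obtain ⟨n, hn⟩ := exists_nb_subset_bBranch γ a m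
    refine ⟨n, fun η hη => ?_⟩
    obtain ⟨η', hη', rfl⟩ := hn ζ η hη
    exact Shrinking.node h (hm η' hη')

/-- The order of the shrinking: a branch that is not subdivided is contained either in one of its
sets only, or in no more of its sets than the boundary point that the letter is sent to. -/
theorem Shrinking.ncard_le {n : ℕ}
    (hcard : ∀ i (U : Fin k → Set (BS γ N i)), (∀ j, IsOpen (U j)) → (∀ q, ∃ j, q ∈ U j) →
      ∀ q, {j | q ∈ sh i U j}.ncard ≤ n + 1)
    (hp : ∀ i g, (p i g).Subsingleton)
    {U : Fin k → Set (BT γ N i r)} {j : Fin k} {ξ : BT γ N i r} (h : Shrinking sh p U j ξ)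
    (hU : ∀ j, IsOpen (U j)) (hcov : ∀ q, ∃ j, q ∈ U j) :
    {j | Shrinking sh p U j ξ}.ncard ≤ n + 1 := by
  induction h with
  | sheet h =>
    simp only [shrinking_bSheet_iff]
    exact hcard _ _ (fun j => (hU j).preimage (continuous_bSheet γ)) (fun q => hcov _) _
  | @leaf i r U j a ζ h =>
    have e : {j | Shrinking sh p U j (bBranch γ a ζ)} ⊆ {j | LeafIndex sh p U a j} := by
      intro j' hj'
      rcases shrinking_bBranch_iff.1 hj' with h' | h'
      · exact h'
      · exact (h'.1 j h.preimage_eq).elim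
    refine (Set.ncard_le_ncard e (Set.toFinite _)).trans ?_
    rcases (goodIndices sh p U a).eq_empty_or_nonempty with hg | ⟨j₁, hj₁, η, hη, hηj⟩
    · refine le_trans ?_ (Nat.le_add_left 1 n)
      refine (Set.ncard_le_one_iff (Set.toFinite _)).2 ?_
      rintro b c (hb | ⟨-, _, rfl⟩) (hc | ⟨-, _, rfl⟩)
      · exact (hg ▸ hb).elim
      · exact (hg ▸ hb).elim
      · exact (hg ▸ hc).elim
      · rfl
    · refine le_trans (Set.ncard_le_ncard ?_ (Set.toFinite _))
        (hcard i _ (fun j => (hU j).preimage (continuous_bSheet γ)) (fun q => hcov _) η)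
      rintro j' (⟨-, η', hη', h'⟩ | ⟨hg, -⟩)
      · rw [hp i _ hη hη']; exact h'
      · have : j₁ ∈ goodIndices sh p U a := ⟨hj₁, η, hη, hηj⟩
        rw [hg] at this
        exact this.elim
  | @node i r U j a ζ h h' ih =>
    have e : {j | Shrinking sh p U j (bBranch γ a ζ)} =
        {j | Shrinking sh p (fun j => bBranch γ a ⁻¹' U j) j ζ} := by
      ext j'
      refine ⟨fun hj' => ?_, fun hj' => Shrinking.node h hj'⟩
      rcases shrinking_bBranch_iff.1 hj' with h' | h'
      · exact (h j' h'.preimage_eq).elim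
      · exact h'.2
    rw [e]
    exact ih (fun j => (hU j).preimage (continuous_bBranch γ a)) fun q => hcov _

/-- A neighbourhood of index `m` of a boundary point behind `m` edges contains everything behind
these edges, so that the recursion ends after at most `m` steps. -/
theorem exists_shrinking
    (hcov : ∀ i (U : Fin k → Set (BS γ N i)), (∀ j, IsOpen (U j)) → (∀ q, ∃ j, q ∈ U j) →
      ∀ q, ∃ j, q ∈ sh i U j) (m : ℕ) :
    ∀ {i r : Bool} {U : Fin k → Set (BT γ N i r)}, (∀ j, IsOpen (U j)) → (∀ q, ∃ j, q ∈ U j) →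
      (∀ j, U j ≠ Set.univ) → ∀ ξ, (∃ j, Nb m ξ ⊆ U j) → ∃ j, Shrinking sh p U j ξ := by
  induction m with
  | zero =>
    rintro i r U - - hne ξ ⟨j, hj⟩
    rw [nb_zero] at hj
    exact (hne j (Set.univ_subset_iff.1 hj)).elim
  | succ m ih =>
    rintro i r U hU hc hne ξ ⟨j, hj⟩
    rcases exists_eq_bSheet_or_bBranch γ ξ with ⟨ζ, rfl⟩ | ⟨a, ζ, rfl⟩
    · obtain ⟨j', hj'⟩ := hcov i (fun j => bSheet γ ⁻¹' U j)
        (fun j => (hU j).preimage (continuous_bSheet γ)) (fun q => hc _) ζ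
      exact ⟨j', Shrinking.sheet hj'⟩
    · by_cases h : ∃ j, bBranch γ a ⁻¹' U j = Set.univ
      · obtain ⟨j', hj'⟩ := exists_leafIndex (sh := sh) (p := p) h
        exact ⟨j', Shrinking.leaf a ζ hj'⟩
      · push Not at h
        obtain ⟨j', hj'⟩ := ih (U := fun j => bBranch γ a ⁻¹' U j)
          (fun j => (hU j).preimage (continuous_bBranch γ a)) (fun q => hc _) h ζ
          ⟨j, fun η hη => hj (bBranch_mem_nb γ a hη)⟩
        exact ⟨j', Shrinking.node h hj'⟩

end Shrinking

/-- If the boundaries of both kinds of sheets have dimension at most `n`, then so has the boundary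
of the tree of spaces. -/
theorem indexedDimLE_tree {n : ℕ} (h : ∀ i, IndexedDimLE (BS γ N i) n) (i r : Bool) :
    IndexedDimLE (BT γ N i r) n := by
  intro k U hU hcov
  by_cases huniv : ∃ j, U j = Set.univ
  · obtain ⟨j₀, h0⟩ := huniv
    refine ⟨fun j => {_q | j = j₀}, fun j => isOpen_const, ?_, fun q => ⟨j₀, rfl⟩, fun q => ?_⟩
    · rintro j q (rfl : j = j₀)
      rw [h0]; trivial
    · refine le_trans ?_ (Nat.le_add_left 1 n)
      exact (Set.ncard_singleton j₀).le
  push Not at huniv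
  have hex : ∀ (i : Bool) (U : Fin k → Set (BS γ N i)), ∃ V : Fin k → Set (BS γ N i),
      (∀ j, V j ⊆ U j) ∧ ((∀ j, IsOpen (U j)) → ∀ j, IsOpen (V j)) ∧
      ((∀ j, IsOpen (U j)) → (∀ q, ∃ j, q ∈ U j) →
        (∀ q, ∃ j, q ∈ V j) ∧ ∀ q, {j | q ∈ V j}.ncard ≤ n + 1) := by
    intro i U
    by_cases hc : (∀ j, IsOpen (U j)) ∧ ∀ q, ∃ j, q ∈ U j
    · obtain ⟨V, h1, h2, h3, h4⟩ := h i k U hc.1 hc.2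
      exact ⟨V, h2, fun _ => h1, fun _ _ => ⟨h3, h4⟩⟩
    · exact ⟨U, fun _ => subset_rfl, id, fun h1 h2 => (hc ⟨h1, h2⟩).elim⟩
  choose sh hsub hopen hsh using hex
  choose p hp1 hp2 using fun i => (sheetGcc γ i).exists_projection (N i).pt
  refine ⟨fun j => {ξ | Shrinking sh p U j ξ}, fun j => isOpen_iff_nb.2 fun ξ hξ => ?_,
    fun j ξ hξ => hξ.mem hsub, fun ξ => ?_, fun ξ => ?_⟩
  · exact hξ.exists_nb_subset hsub hopen hp2 hU
  · obtain ⟨j, hj⟩ := hcov ξ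
    obtain ⟨m, hm⟩ := isOpen_iff_nb.1 (hU j) ξ hj
    exact exists_shrinking (fun i U h1 h2 => (hsh i U h1 h2).1) m hU hcov huniv ξ ⟨j, hm⟩
  · rcases Set.eq_empty_or_nonempty {j | Shrinking sh p U j ξ} with h0 | ⟨j, hj⟩
    · have : {j | ξ ∈ {ξ | Shrinking sh p U j ξ}} = ∅ := h0
      rw [this, Set.ncard_empty]
      exact Nat.zero_le _
    · exact hj.ncard_le (fun i U h1 h2 => (hsh i U h1 h2).2) hp1 hU hcov

theorem coveringDim_BS_le (i r : Bool) : coveringDim (BS γ N i) ≤ coveringDim (BT γ N i r) := by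
  rcases isEmpty_or_nonempty (BS γ N i) with h | h
  · rw [coveringDim_eq_bot_iff.2 h]; exact bot_le
  · obtain ⟨g, hg, hgf⟩ := exists_retraction_bSheet (N := N) (i := i) (r := r) γ
    exact coveringDim_le_of_leftInverse (continuous_bSheet γ) hg hgf

theorem coveringDim_branch_le (a : Letter N i r) :
    coveringDim (BT γ N (!i) false) ≤ coveringDim (BT γ N i r) := by
  rcases isEmpty_or_nonempty (BT γ N (!i) false) with h | h
  · rw [coveringDim_eq_bot_iff.2 h]; exact bot_le
  · obtain ⟨g, hg, hgf⟩ := exists_retraction_bBranch γ a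
    exact coveringDim_le_of_leftInverse (continuous_bBranch γ a) hg hgf

/-- The dimension of the boundary of a free product. -/
theorem coveringDim_BT (i : Bool) (h : Nonempty (BS γ N i) ∨ Nonempty (BS γ N (!i))) :
    coveringDim (BT γ N i true) = max (coveringDim (BS γ N i)) (coveringDim (BS γ N (!i))) := by
  refine le_antisymm (WithBot.le_of_forall_natCast ?_ fun n hn => ?_) (max_le ?_ ?_)
  · rw [Ne, max_eq_bot, coveringDim_eq_bot_iff, coveringDim_eq_bot_iff]
    rintro ⟨h1, h2⟩
    rcases h with ⟨⟨x⟩⟩ | ⟨⟨x⟩⟩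
    · exact h1.false x
    · exact h2.false x
  · rw [max_le_iff] at hn
    simp only [coveringDim_le_natCast_iff, coveringDimLE_iff_indexed] at hn ⊢
    refine indexedDimLE_tree γ (fun i' => ?_) i true
    rcases Bool.eq_or_eq_not i' i with rfl | rfl
    · exact hn.1
    · exact hn.2
  · exact coveringDim_BS_le γ i true
  · exact (coveringDim_BS_le γ (!i) false).trans
      (coveringDim_branch_le γ ⟨(N i).base, fun h => by cases h⟩)

end TreeOf

/-- Two bicombings as a family. -/
def pairGcc {X Y : Type u} [MetricSpace X] [MetricSpace Y] (γ : GCCBicombing X)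
    (δ : GCCBicombing Y) : ∀ i, GCCBicombing (Pair X Y i)
  | true => γ
  | false => δ

theorem gcc_pair_toFun {X Y : Type u} [MetricSpace X] [MetricSpace Y]
    (N : Net.{u, v} X) (M : Net.{u, v} Y) (γ : GCCBicombing X) (δ : GCCBicombing Y) :
    (TreeOf.gcc (N := pairNet N M) (pairGcc γ δ) true true).toFun =
      freeBicombing N M γ.toFun δ.toFun := by
  have : TreeOf.maps (pairGcc γ δ) = pairBicombing γ.toFun δ.toFun := by
    funext i
    cases i <;> rfl
  change TreeOf.bicombing (TreeOf.maps (pairGcc γ δ)) = _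
  rw [this]
  rfl

end

theorem theorem1p4 {X Y : Type u} [MetricSpace X] [MetricSpace Y]
    (N : Net.{u, v} X) (M : Net.{u, v} Y) (γ : GCCBicombing X) (δ : GCCBicombing Y) :
    (∃ Γ : GCCBicombing (FreeProduct N M), Γ.toFun = freeBicombing N M γ.toFun δ.toFun) ∧
    ∀ Γ : GCCBicombing (FreeProduct N M), Γ.toFun = freeBicombing N M γ.toFun δ.toFun →
      ∀ (x₀ : X) (y₀ : Y) (z₀ : FreeProduct N M),
        (Nonempty (γ.IdealBoundary x₀) ∨ Nonempty (δ.IdealBoundary y₀)) →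
        coveringDim (Γ.IdealBoundary z₀) =
          max (coveringDim (γ.IdealBoundary x₀)) (coveringDim (δ.IdealBoundary y₀)) := by
  refine ⟨⟨_, gcc_pair_toFun N M γ δ⟩, fun Γ hΓ x₀ y₀ z₀ h => ?_⟩
  let φ : γ.IdealBoundary x₀ ≃ₜ TreeOf.BS (pairGcc γ δ) (pairNet N M) true :=
    GCCBicombing.boundaryHomeo (γ := γ) (γ' := TreeOf.sheetGcc (pairGcc γ δ) true) rfl x₀ N.pt
  let ψ : δ.IdealBoundary y₀ ≃ₜ TreeOf.BS (pairGcc γ δ) (pairNet N M) false :=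
    GCCBicombing.boundaryHomeo (γ := δ) (γ' := TreeOf.sheetGcc (pairGcc γ δ) false) rfl y₀ M.pt
  rw [φ.coveringDim_eq, ψ.coveringDim_eq,
    (GCCBicombing.boundaryHomeo (hΓ.trans (gcc_pair_toFun N M γ δ).symm) z₀
      (TreeOf.root _ _ _)).coveringDim_eq]
  exact TreeOf.coveringDim_BT (pairGcc γ δ) true
    (h.imp (fun h => h.map φ) fun h => h.map ψ)
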